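/- All graphs are finite and simple. Let $G$ be a graph and let $x,y$ be two distinct vertices of $G$. Let $G+xy$ denote $G$ itself if $x$ and $y$ are adjacent in $G$, and otherwise the graph obtained from $G$ by adding the edge $xy$. Suppose that $G+xy$ is $2$-connected (it has at least three vertices, is connected, and remains connected after the deletion of any single vertex), that every vertex of $G$ other than $x$ and $y$ has degree at least $4$ in $G$, and that $G-x$ is triangle-free. Then $G$ contains three paths $P_1,P_2,P_3$, each with endpoints $x$ and $y$, whose lengths (numbers of edges) $\ell_1,\ell_2,\ell_3$ satisfy $\ell_1>\ell_2>\ell_3\ge 2$ and, in addition, either $\ell_1-\ell_2=\ell_2-\ell_3=2$ or $\{\ell_1-\ell_2,\ \ell_2-\ell_3\}=\{1,2\}$. -/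

import Mathlib

namespace RootedPaths

/-- A graph is `2`-connected if it has at least three vertices, it is connected, and it stays
connected whenever a single vertex is deleted. -/
def IsTwoConnected {V : Type*} (G : SimpleGraph V) : Prop :=
  3 ≤ Nat.card V ∧ G.Connected ∧ ∀ v : V, (G.induce ({v}ᶜ : Set V)).Connected

/-- `(G, x, y)` is a `2`-connected rooted graph: the roots `x`, `y` are distinct, and the graph
`G + xy` (which is `G` itself if `x` and `y` are adjacent) is `2`-connected. -/
def IsTwoConnectedRooted {V : Type*} (G : SimpleGraph V) (x y : V) : Prop :=
  x ≠ y ∧ IsTwoConnected (G ⊔ SimpleGraph.edge x y)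

/-- The rooted graph `(G, x, y)` has minimum degree at least `d`: every vertex other than the
two roots has degree at least `d` in `G`. -/
def HasRootedMinDegreeAtLeast {V : Type*} [Fintype V] (G : SimpleGraph V) [DecidableRel G.Adj]
    (x y : V) (d : ℕ) : Prop :=
  ∀ v : V, v ≠ x → v ≠ y → d ≤ G.degree v

/-- Three paths are nice if their lengths, from the shortest path `P₃` to the longest path `P₁`,
form an arithmetic progression with initial term at least `2` and common difference `2`. -/
def AreNice {V : Type*} {G : SimpleGraph V} {x y : V} (P₁ P₂ P₃ : G.Path x y) : Prop :=
  2 ≤ P₃.1.length ∧ P₂.1.length = P₃.1.length + 2 ∧ P₁.1.length = P₂.1.length + 2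

/-- Three paths are good if their lengths are strictly decreasing and at least `2`, and either
the paths are nice or the set of the two successive gaps is `{1, 2}`. (The truncated
subtractions are true ones, by the first two conditions.) -/
def AreGood {V : Type*} {G : SimpleGraph V} {x y : V} (P₁ P₂ P₃ : G.Path x y) : Prop :=
  P₂.1.length < P₁.1.length ∧ P₃.1.length < P₂.1.length ∧ 2 ≤ P₃.1.length ∧
    (AreNice P₁ P₂ P₃ ∨
      ({P₁.1.length - P₂.1.length, P₂.1.length - P₃.1.length} : Set ℕ) = {1, 2})

end RootedPaths

/-! The roots are kept implicit. A rooted graph is a set `C` of inner vertices together with the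
neighbourhoods `X` and `Y` of the two roots, and a path of length n inside `C` from `X` to `Y`
stands for a path of length n + 2 between the roots. Contracting vertices into a root then only
changes `C` and the root's neighbourhood, so the induction needs no quotient graphs.

The statement is strengthened by letting one vertex `z` violate the degree bound; this absorbs a
vertex that loses degree when the graph is cut. A counterexample to `Rooted.good` is taken minimal
in the size of `C` and then in the number of root edges. Passing to one side of a separator makes it
essentially 3-connected (`Minimal.tight`), and deleting root edges bounds the degrees of the
neighbours of the roots by four.

If every vertex outside `X` except `z` has at most one neighbour in `X`, contractions preserve
degrees and contradict minimality (`false_of_unique_nbrs`). Otherwise some `d` outside `X` has a set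
`T` of at least two neighbours in `X`. A path starting at t in `T` may then start with t', d, t
instead, which adds two to its length. So two paths in the rest whose lengths differ by one or two
suffice: together with their prolongations they give lengths m, m + 1, m + 3 or m, m + 2, m + 4.
Minimum degree three in the rest provides such a pair (`Rooted.hasPair`). Triangle-freeness and the
bound on common neighbours (`ncard_common_nbrs_le`) ensure that removing `d` and `T` costs each
vertex at most one degree. The degenerate positions of `Y` and `z` are treated separately
(`reach_nonempty`, `false_of_single_attachment`). -/

namespace RootedPaths

open Set

/-! ### Paths confined to a vertex set -/

/-- `PathIn G C u v n`: there is a path of length `n` from `u` to `v` all of whose vertices lie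
in `C`. -/
inductive PathIn {V : Type*} (G : SimpleGraph V) : Set V → V → V → ℕ → Prop
  | nil {C : Set V} {u : V} : u ∈ C → PathIn G C u u 0
  -- Taking `u` away from the tail is what forbids repeated vertices.
  | cons {C : Set V} {u w v : V} {n : ℕ} :
      u ∈ C → G.Adj u w → PathIn G (C \ {u}) w v n → PathIn G C u v (n + 1)

variable {V : Type*} {G : SimpleGraph V}

namespace PathIn

theorem mono {C D : Set V} {u v : V} {n : ℕ} (h : PathIn G C u v n) (hCD : C ⊆ D) :
    PathIn G D u v n := by
  induction h generalizing D with
  | nil hu => exact nil (hCD hu)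
  | cons hu ha _ ih => exact cons (hCD hu) ha (ih (sdiff_subset_sdiff_left hCD))

theorem left_mem {C : Set V} {u v : V} {n : ℕ} (h : PathIn G C u v n) : u ∈ C := by
  cases h <;> assumption

theorem right_mem {C : Set V} {u v : V} {n : ℕ} (h : PathIn G C u v n) : v ∈ C := by
  induction h with
  | nil hu => exact hu
  | cons _ _ _ ih => exact ih.1

theorem append {C D E : Set V} {u v w y : V} {n m : ℕ} (h : PathIn G C u v n) (ha : G.Adj v w)
    (h' : PathIn G D w y m) (hd : Disjoint C D) (hC : C ⊆ E) (hD : D ⊆ E) :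
    PathIn G E u y (n + m + 1) := by
  induction h generalizing E with
  | nil hu =>
    rw [Nat.zero_add]
    exact cons (hC hu) ha (h'.mono fun x hx => ⟨hD hx, fun hxu =>
      Set.disjoint_left.1 hd hu (by rw [mem_singleton_iff] at hxu; exact hxu ▸ hx)⟩)
  | @cons C u w' v n hu ha' _ ih =>
    have := ih (E := E \ {u}) ha (hd.mono_left sdiff_subset) (sdiff_subset_sdiff_left hC)
      (fun x hx => ⟨hD hx, fun hxu =>
        Set.disjoint_left.1 hd hu (by rw [mem_singleton_iff] at hxu; exact hxu ▸ hx)⟩)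
    have h2 := cons (hC hu) ha' this
    convert h2 using 1
    omega

theorem snoc {C E : Set V} {u v w : V} {n : ℕ} (h : PathIn G C u v n) (ha : G.Adj v w)
    (hw : w ∉ C) (hC : C ⊆ E) (hwE : w ∈ E) : PathIn G E u w (n + 1) :=
  append h ha (nil (mem_singleton w)) (by simpa using hw) hC (by simpa using hwE)

theorem reverse {C : Set V} {u v : V} {n : ℕ} (h : PathIn G C u v n) : PathIn G C v u n := by
  induction h with
  | nil hu => exact nil hu
  | cons hu ha _ ih => exact snoc ih ha.symm (by simp) sdiff_subset hu

/-- Either a path avoids `v`, or the final segment of it gives a path starting at `v`. -/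
theorem avoid_or_suffix {C : Set V} {u b : V} {n : ℕ} (h : PathIn G C u b n) (v : V) :
    PathIn G (C \ {v}) u b n ∨ ∃ m, PathIn G C v b m := by
  induction h with
  | @nil C u hu =>
    by_cases huv : u = v
    · exact .inr ⟨0, huv ▸ nil hu⟩
    · exact .inl (nil ⟨hu, huv⟩)
  | @cons C u w b n hu ha hp ih =>
    by_cases huv : u = v
    · exact .inr ⟨_, huv ▸ cons hu ha hp⟩
    · rcases ih with ih | ⟨m, ih⟩
      · refine .inl (cons ⟨hu, huv⟩ ha ?_)
        rwa [sdiff_sdiff_comm]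
      · exact .inr ⟨m, ih.mono sdiff_subset⟩

/-- If the path already meets `v`, its final segment from `v` is used, so the length is not
controlled. -/
theorem exists_cons {C : Set V} {u v b : V} {n : ℕ} (h : PathIn G C u b n) (hv : v ∈ C)
    (ha : G.Adj v u) : ∃ m, PathIn G C v b m := by
  rcases h.avoid_or_suffix v with h | h
  · exact ⟨_, cons hv ha h⟩
  · exact h

theorem exists_walk {C : Set V} {u v : V} {n : ℕ} (h : PathIn G C u v n) :
    ∃ p : G.Walk u v, p.IsPath ∧ p.length = n ∧ ∀ w ∈ p.support, w ∈ C := by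
  induction h with
  | nil hu => exact ⟨.nil, by simp, rfl, by simpa using hu⟩
  | cons hu ha _ ih =>
    obtain ⟨p, hp, hl, hs⟩ := ih
    refine ⟨.cons ha p, ?_, by simp [hl], ?_⟩
    · rw [SimpleGraph.Walk.cons_isPath_iff]
      exact ⟨hp, fun h => (hs _ h).2 rfl⟩
    · intro w hw
      rw [SimpleGraph.Walk.support_cons, List.mem_cons] at hw
      rcases hw with rfl | hw
      · exact hu
      · exact (hs _ hw).1

variable {C : Set V}

theorem one {u v : V} (hu : u ∈ C) (hv : v ∈ C) (h : G.Adj u v) : PathIn G C u v 1 :=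
  .cons hu h (.nil ⟨hv, h.ne'⟩)

/-- Prolonging a path by one vertex at the front. -/
theorem cons₁ {D : Set V} {u w b : V} {n : ℕ} (hp : PathIn G D w b n) (hD : D ⊆ C) (hu : u ∈ C)
    (huD : u ∉ D) (h : G.Adj u w) : PathIn G C u b (n + 1) :=
  .cons hu h (hp.mono fun x hx => ⟨hD hx, fun hxu => huD (by rwa [← mem_singleton_iff.1 hxu])⟩)

/-- Prolonging a path by two vertices at the front. -/
theorem cons₂ {D : Set V} {u v w b : V} {n : ℕ} (hp : PathIn G D w b n) (hD : D ⊆ C) (hu : u ∈ C)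
    (huD : u ∉ D) (hv : v ∈ C) (hvD : v ∉ D) (huv : G.Adj u v) (hvw : G.Adj v w) :
    PathIn G C u b (n + 2) :=
  .cons hu huv (hp.cons₁ (fun x hx => ⟨hD hx, fun hxu => huD (by
    rwa [← mem_singleton_iff.1 hxu])⟩) ⟨hv, huv.ne'⟩ hvD hvw)

theorem two {u v w : V} (hu : u ∈ C) (hv : v ∈ C) (hw : w ∈ C) (huv : G.Adj u v)
    (hvw : G.Adj v w) (h : u ≠ w) : PathIn G C u w 2 :=
  .cons hu huv (one ⟨hv, huv.ne'⟩ ⟨hw, h.symm⟩ hvw)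

theorem three {u v w x : V} (hu : u ∈ C) (hv : v ∈ C) (hw : w ∈ C) (hx : x ∈ C) (huv : G.Adj u v)
    (hvw : G.Adj v w) (hwx : G.Adj w x) (h : u ≠ w) (h' : u ≠ x) (h'' : v ≠ x) :
    PathIn G C u x 3 :=
  .cons hu huv (two ⟨hv, huv.ne'⟩ ⟨hw, h.symm⟩ ⟨hx, h'.symm⟩ hvw hwx h'')

theorem four {u v w x y : V} (hu : u ∈ C) (hv : v ∈ C) (hw : w ∈ C) (hx : x ∈ C) (hy : y ∈ C)
    (huv : G.Adj u v) (hvw : G.Adj v w) (hwx : G.Adj w x) (hxy : G.Adj x y) (h₁ : u ≠ w)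
    (h₂ : u ≠ x) (h₃ : u ≠ y) (h₄ : v ≠ x) (h₅ : v ≠ y) (h₆ : w ≠ y) : PathIn G C u y 4 :=
  .cons hu huv (three ⟨hv, huv.ne'⟩ ⟨hw, h₁.symm⟩ ⟨hx, h₂.symm⟩ ⟨hy, h₃.symm⟩ hvw hwx hxy h₄ h₅ h₆)

end PathIn

/-! ### Boundaries, components and reachability -/

/-- The neighbours in `C` of the vertices of `S` lie in `S ∪ U`. -/
def BoundaryIn (G : SimpleGraph V) (C S U : Set V) : Prop :=
  ∀ s ∈ S, ∀ w ∈ C, G.Adj s w → w ∈ S ∨ w ∈ U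

/-- The vertices from which `B` can be reached inside `C`. -/
def reach (G : SimpleGraph V) (C B : Set V) : Set V :=
  {v | ∃ b ∈ B, ∃ n, PathIn G C v b n}

/-- The neighbours of the vertices of `S`. -/
def nbrs (G : SimpleGraph V) (S : Set V) : Set V := {v | ∃ s ∈ S, G.Adj s v}

/-- The lengths of the paths from `X` to `Y` inside `C`. -/
def lengths (G : SimpleGraph V) (C X Y : Set V) : Set ℕ :=
  {n | ∃ a ∈ X, ∃ b ∈ Y, PathIn G C a b n}

theorem reach_subset {C B : Set V} : reach G C B ⊆ C := by
  rintro v ⟨b, _, n, h⟩; exact h.left_mem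

theorem mem_reach_of_mem {C B : Set V} {v : V} (hC : v ∈ C) (hB : v ∈ B) : v ∈ reach G C B :=
  ⟨v, hB, 0, .nil hC⟩

theorem mem_reach_of_adj {C B : Set V} {v w : V} (hv : v ∈ C) (hw : w ∈ reach G C B)
    (ha : G.Adj v w) : v ∈ reach G C B := by
  obtain ⟨b, hb, n, h⟩ := hw
  exact ⟨b, hb, h.exists_cons hv ha⟩

theorem reach_mono {C D B : Set V} (h : C ⊆ D) : reach G C B ⊆ reach G D B := by
  rintro v ⟨b, hb, n, hp⟩; exact ⟨b, hb, n, hp.mono h⟩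

theorem PathIn.in_reach {C B : Set V} {v b : V} {n : ℕ} (h : PathIn G C v b n) (hb : b ∈ B) :
    PathIn G (reach G C B) v b n := by
  induction h with
  | nil hu => exact .nil (mem_reach_of_mem hu hb)
  | @cons C u w b n hu ha hp ih =>
    refine .cons ⟨_, hb, _, .cons hu ha hp⟩ ha ((ih hb).mono fun x hx =>
      ⟨reach_mono sdiff_subset hx, (reach_subset hx).2⟩)

theorem PathIn.in_closed {D S : Set V} {v b : V} {n : ℕ} (h : PathIn G D v b n) (hv : v ∈ S)
    (hS : BoundaryIn G D S ∅) : PathIn G S v b n := by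
  induction h generalizing S with
  | nil hu => exact .nil hv
  | @cons C u w b n hu ha hp ih =>
    have hw : w ∈ S := by simpa using hS u hv w hp.left_mem.1 ha
    refine .cons hv ha (ih ⟨hw, hp.left_mem.2⟩ ?_)
    intro s hs x hx hsx
    exact .inl ⟨by simpa using hS s hs.1 x hx.1 hsx, hx.2⟩

/-- A path from a vertex of `S` to `B` has no edge along which to leave `S`, so its end lies in `S`.
-/
theorem closed_reach_inter {C B S : Set V} (hne : S.Nonempty) (hS : S ⊆ reach G C B)
    (hc : BoundaryIn G (reach G C B) S ∅) : (S ∩ B).Nonempty := by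
  obtain ⟨s, hs⟩ := hne
  obtain ⟨b, hb, n, hp⟩ := hS hs
  exact ⟨b, ((hp.in_reach hb).in_closed hs hc).right_mem, hb⟩

/-- The component of `w` in `C` has no proper nonempty closed subset. -/
theorem eq_of_closed_reach {C S : Set V} {w : V} (hne : S.Nonempty)
    (hS : S ⊆ reach G C {w}) (hc : BoundaryIn G (reach G C {w}) S ∅) : S = reach G C {w} := by
  by_contra hSne
  have h1 := closed_reach_inter hne hS hc
  have h2 : (reach G C {w} \ S).Nonempty := by
    rw [sdiff_nonempty]; exact fun h => hSne (hS.antisymm h)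
  have h3 := closed_reach_inter h2 sdiff_subset (fun s hs x hx ha => .inl ⟨hx, fun hxS => by
    have := hc x hxS s hs.1 ha.symm
    simp only [mem_empty_iff_false, or_false] at this
    exact hs.2 this⟩)
  obtain ⟨a, ha, rfl⟩ := h1
  obtain ⟨b, hb, rfl⟩ := h3
  exact hb.2 ha

/-- If some vertex of a component reaches `B`, then every vertex of it does. -/
theorem reach_singleton_subset {C B : Set V} {w v : V} (hv : v ∈ reach G C {w})
    (hvB : v ∈ reach G C B) : reach G C {w} ⊆ reach G C B := by
  have hclosed : BoundaryIn G (reach G C {w}) (reach G C {w} ∩ reach G C B) ∅ := by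
    intro s hs x hx hsx
    exact .inl ⟨hx, mem_reach_of_adj (reach_subset hx) hs.2 hsx.symm⟩
  have := eq_of_closed_reach (S := reach G C {w} ∩ reach G C B) ⟨v, hv, hvB⟩ inter_subset_left
    hclosed
  rw [← this]
  exact inter_subset_right

theorem nbrs_singleton {u v : V} : v ∈ nbrs G {u} ↔ G.Adj u v := by simp [nbrs]

/-- If a set `R` closed in `C` avoids some of `C` then the rest of `C` is closed too. -/
theorem BoundaryIn.compl {C R : Set V} (h : BoundaryIn G C R ∅) : BoundaryIn G C (C \ R) ∅ := by
  intro s hs w hw ha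
  refine .inl ⟨hw, fun hR => hs.2 ?_⟩
  simpa using h w hR s hs.1 ha.symm

/-! ### Patterns of path lengths -/

/-- Number patterns of three good path lengths. -/
def Good (L : Set ℕ) : Prop :=
  ∃ m, (m ∈ L ∧ m + 2 ∈ L ∧ m + 4 ∈ L) ∨ (m ∈ L ∧ m + 1 ∈ L ∧ m + 3 ∈ L) ∨
    (m ∈ L ∧ m + 2 ∈ L ∧ m + 3 ∈ L)

/-- `L` contains two numbers that differ by one or two. -/
def HasPair (L : Set ℕ) : Prop := ∃ m ∈ L, m + 1 ∈ L ∨ m + 2 ∈ L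

theorem Good.shift {L L' : Set ℕ} (h : Good L) (k : ℕ) (hk : ∀ n ∈ L, n + k ∈ L') : Good L' := by
  obtain ⟨m, h⟩ := h
  refine ⟨m + k, ?_⟩
  rcases h with ⟨h1, h2, h3⟩ | ⟨h1, h2, h3⟩ | ⟨h1, h2, h3⟩
  · exact .inl ⟨hk _ h1, by convert hk _ h2 using 1; omega, by convert hk _ h3 using 1; omega⟩
  · exact .inr (.inl ⟨hk _ h1, by convert hk _ h2 using 1; omega,
      by convert hk _ h3 using 1; omega⟩)
  · exact .inr (.inr ⟨hk _ h1, by convert hk _ h2 using 1; omega,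
      by convert hk _ h3 using 1; omega⟩)

theorem HasPair.shift {L L' : Set ℕ} (h : HasPair L) (k : ℕ) (hk : ∀ n ∈ L, n + k ∈ L') :
    HasPair L' := by
  obtain ⟨m, h1, h2 | h2⟩ := h
  · exact ⟨m + k, hk _ h1, .inl (by convert hk _ h2 using 1; omega)⟩
  · exact ⟨m + k, hk _ h1, .inr (by convert hk _ h2 using 1; omega)⟩

/-- The arithmetic behind all detours: a gap of one gives m, m + 1, m + 3, and a gap of two gives m,
m + 2, m + 4, where the last length uses the longer prolongation. -/
theorem HasPair.good {L L' : Set ℕ} (h : HasPair L) (k : ℕ) (hk : ∀ n ∈ L, n + k ∈ L')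
    (hk2 : ∀ n ∈ L, n + (k + 2) ∈ L') : Good L' := by
  obtain ⟨m, h1, h2 | h2⟩ := h
  · exact ⟨m + k, .inr (.inl ⟨hk _ h1, by convert hk _ h2 using 1; omega,
      by convert hk2 _ h2 using 1; omega⟩)⟩
  · exact ⟨m + k, .inl ⟨hk _ h1, by convert hk _ h2 using 1; omega,
      by convert hk2 _ h2 using 1; omega⟩⟩

theorem Good.of_even {L : Set ℕ} {m : ℕ} (h0 : m ∈ L) (h2 : m + 2 ∈ L) (h4 : m + 4 ∈ L) :
    Good L := ⟨m, .inl ⟨h0, h2, h4⟩⟩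

theorem Good.of_one_three {L : Set ℕ} {m : ℕ} (h0 : m ∈ L) (h1 : m + 1 ∈ L) (h3 : m + 3 ∈ L) :
    Good L := ⟨m, .inr (.inl ⟨h0, h1, h3⟩)⟩

/-! ### Degrees counting the root edges -/

open Classical in
/-- The indicator of a proposition. -/
noncomputable def ind (p : Prop) : ℕ := if p then 1 else 0

theorem ind_of {p : Prop} (h : p) : ind p = 1 := if_pos h

theorem ind_of_not {p : Prop} (h : ¬ p) : ind p = 0 := if_neg h

theorem ind_le_one (p : Prop) : ind p ≤ 1 := by unfold ind; split_ifs <;> omega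

theorem ind_mono {p q : Prop} (h : p → q) : ind p ≤ ind q := by
  unfold ind; split_ifs <;> first | omega | tauto

/-- The degree of `v` in the graph that arises from `G[C]` by adding two roots with neighbourhoods
`X` and `Y`. -/
noncomputable def rdeg (G : SimpleGraph V) (C X Y : Set V) (v : V) : ℕ :=
  (C ∩ G.neighborSet v).ncard + ind (v ∈ X) + ind (v ∈ Y)

theorem rdeg_symm (C X Y : Set V) (v : V) : rdeg G C X Y v = rdeg G C Y X v := by
  unfold rdeg; omega

/-- Bookkeeping for the passage from `C` to `D`: `R` collects the neighbours that are lost, the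
indicators compare the root edges before and after, and `k` is the net loss. -/
theorem rdeg_le_add [Finite V] {C D X Y A B : Set V} {v : V} {k : ℕ} (R : Set V)
    (hR : ∀ w ∈ C, G.Adj v w → w ∈ D ∨ w ∈ R)
    (h : R.ncard + ind (v ∈ X) + ind (v ∈ Y) ≤ ind (v ∈ A) + ind (v ∈ B) + k) :
    rdeg G C X Y v ≤ rdeg G D A B v + k := by
  have h1 : C ∩ G.neighborSet v ⊆ (D ∩ G.neighborSet v) ∪ R := by
    rintro w ⟨hw, ha⟩
    rcases hR w hw ha with h | h
    · exact .inl ⟨h, ha⟩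
    · exact .inr h
  have h2 := (ncard_le_ncard h1).trans (ncard_union_le _ _)
  unfold rdeg
  omega

/-- If the neighbours of `v` in `C` lie in `R`, then the degree is at most that of `R` plus two. -/
theorem rdeg_le [Finite V] {C X Y : Set V} {v : V} (R : Set V)
    (hR : ∀ w ∈ C, G.Adj v w → w ∈ R) :
    rdeg G C X Y v ≤ R.ncard + ind (v ∈ X) + ind (v ∈ Y) := by
  have h2 := ncard_le_ncard (s := C ∩ G.neighborSet v) (t := R) fun w hw => hR w hw.1 hw.2
  unfold rdeg
  omega

theorem ncard_pair_le (a b : V) : ({a, b} : Set V).ncard ≤ 2 :=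
  (ncard_insert_le _ _).trans (by simp)

theorem ncard_triple_le (a b c : V) : ({a, b, c} : Set V).ncard ≤ 3 :=
  (ncard_insert_le _ _).trans (by have := ncard_pair_le b c; omega)

theorem ncard_le_one_of {S : Set V} (h : ∀ a ∈ S, ∀ b ∈ S, a = b) : S.ncard ≤ 1 := by
  rcases S.eq_empty_or_nonempty with rfl | ⟨a, ha⟩
  · simp
  · rw [show S = {a} from Set.ext fun b => ⟨fun hb => h b hb a ha, fun hb => by
      rw [mem_singleton_iff] at hb; exact hb ▸ ha⟩]
    simp

/-! ### Linked and rooted graphs, and the smaller ones inside them -/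

/-- If `u` is the only neighbour of `S` and `S` misses `Y`, then `u` reaches `Y` outside `S`. -/
theorem mem_reach_sdiff {C Y S : Set V} {u : V}
    (hc : ∀ S ⊆ C, S.Nonempty → BoundaryIn G C S ∅ → (S ∩ Y).Nonempty) (hu : u ∈ C)
    (hb : BoundaryIn G C S {u}) (hY : ∀ s ∈ S, s ∉ Y) : u ∈ reach G (C \ S) Y := by
  by_contra hR
  obtain ⟨b, hb1, hb2⟩ := hc (C \ reach G (C \ S) Y) sdiff_subset ⟨u, hu, hR⟩ (by
    intro s hs w hw ha
    refine .inl ⟨hw, fun hwR => ?_⟩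
    by_cases hsS : s ∈ S
    · rcases hb s hsS w hw ha with h | h
      · exact (reach_subset hwR).2 h
      · rw [mem_singleton_iff] at h
        exact hR (h ▸ hwR)
    · exact hs.2 (mem_reach_of_adj ⟨hs.1, hsS⟩ hwR ha))
  by_cases hbS : b ∈ S
  · exact hY b hbS hb2
  · exact hb1.2 (mem_reach_of_mem ⟨hb1.1, hbS⟩ hb2)

/-- The connectivity of a rooted graph with inner vertices `C`, in which the neighbourhoods of the
two roots are `X` and `Y`: joining the roots makes it `2`-connected. -/
structure Linked (G : SimpleGraph V) (C X Y : Set V) : Prop where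
  -- This is connectedness after deleting either root; `cut` is connectedness after deleting an
  -- inner vertex `u`.
  closed : ∀ S ⊆ C, S.Nonempty → BoundaryIn G C S ∅ → (S ∩ X).Nonempty ∧ (S ∩ Y).Nonempty
  cut : ∀ u ∈ C, ∀ S ⊆ C, S.Nonempty → u ∉ S → BoundaryIn G C S {u} → ∃ s ∈ S, s ∈ X ∨ s ∈ Y

/-- A linked rooted graph all of whose inner vertices, except possibly `z`, have degree at least
`k`. -/
structure Rooted (G : SimpleGraph V) (k : ℕ) (C X Y : Set V) (z : V) : Prop
    extends Linked G C X Y where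
  deg : ∀ v ∈ C, v ≠ z → k ≤ rdeg G C X Y v
  -- This excludes `C = {z}`, where the degree condition is empty.
  nontriv : ∃ v ∈ C, v ≠ z

namespace Linked

variable {C X Y : Set V}

theorem symm (h : Linked G C X Y) : Linked G C Y X where
  closed S hS hne hb := (h.closed S hS hne hb).symm
  cut u hu S hS hne huS hb := by
    obtain ⟨s, hs, h | h⟩ := h.cut u hu S hS hne huS hb
    · exact ⟨s, hs, .inr h⟩
    · exact ⟨s, hs, .inl h⟩

theorem inter_right (h : Linked G C X Y) (hne : C.Nonempty) : (C ∩ Y).Nonempty :=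
  (h.closed C Subset.rfl hne fun _ _ _ hw _ => .inl hw).2

theorem inter_left (h : Linked G C X Y) (hne : C.Nonempty) : (C ∩ X).Nonempty :=
  (h.closed C Subset.rfl hne fun _ _ _ hw _ => .inl hw).1

theorem mem_reach (h : Linked G C X Y) {S : Set V} {u : V} (hu : u ∈ C)
    (hb : BoundaryIn G C S {u}) (hY : ∀ s ∈ S, s ∉ Y) : u ∈ reach G (C \ S) Y :=
  mem_reach_sdiff (fun S hS hne hb => (h.closed S hS hne hb).2) hu hb hY

/-- Contracting the neighbourhood of the first root into the root. -/
theorem contract_left (h : Linked G C X Y) :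
    Linked G (reach G (C \ X) Y) (nbrs G (C ∩ X)) Y := by
  have hsub : reach G (C \ X) Y ⊆ C := reach_subset.trans sdiff_subset
  -- A set with no contact to `X` has the same boundary in `C` as in the contracted graph, so
  -- connectivity is inherited.
  have key : ∀ S ⊆ reach G (C \ X) Y, ∀ U : Set V, BoundaryIn G (reach G (C \ X) Y) S U →
      (∀ s ∈ S, s ∉ nbrs G (C ∩ X)) → BoundaryIn G C S U := by
    intro S hS U hb hn s hs w hw ha
    by_cases hwX : w ∈ X
    · exact absurd ⟨w, ⟨hw, hwX⟩, ha.symm⟩ (hn s hs)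
    · exact hb s hs w (mem_reach_of_adj ⟨hw, hwX⟩ (hS hs) ha.symm) ha
  refine ⟨fun S hS hne hb => ⟨?_, closed_reach_inter hne hS hb⟩, ?_⟩
  · by_contra hcon
    obtain ⟨s, hs, hsX⟩ := (h.closed S (hS.trans hsub) hne
      (key S hS _ hb fun s hs hn => hcon ⟨s, hs, hn⟩)).1
    exact (reach_subset (hS hs)).2 hsX
  · intro u hu S hS hne huS hb
    by_contra! hcon
    obtain ⟨s, hs, hsX | hsY⟩ := h.cut u (hsub hu) S (hS.trans hsub) hne huS
      (key S hS _ hb fun s hs => (hcon s hs).1)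
    · exact (reach_subset (hS hs)).2 hsX
    · exact (hcon s hs).2 hsY

/-- The rooted graph formed by a component outside `X`, with a vertex `a ∈ X` as one root and the
other vertices of `X` contracted into the other root. -/
theorem component (h : Linked G C X Y) {a s w : V} (ha : a ∈ C) (haX : a ∈ X)
    (hs : s ∈ reach G (C \ X) {w}) (has : G.Adj a s)
    (hY : ∀ v ∈ reach G (C \ X) {w}, v ∉ Y) :
    Linked G (reach G (C \ X) {w}) (nbrs G ((C ∩ X) \ {a})) (nbrs G {a}) := by
  have hsub : reach G (C \ X) {w} ⊆ C := reach_subset.trans sdiff_subset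
  have key : ∀ S ⊆ reach G (C \ X) {w}, ∀ U : Set V, BoundaryIn G (reach G (C \ X) {w}) S U →
      (∀ s ∈ S, s ∉ nbrs G ((C ∩ X) \ {a})) → BoundaryIn G C S (U ∪ {a}) := by
    intro S hS U hb hn s hs x hx hsx
    by_cases hxX : x ∈ X
    · by_cases hxa : x = a
      · exact .inr (.inr hxa)
      · exact absurd ⟨x, ⟨⟨hx, hxX⟩, hxa⟩, hsx.symm⟩ (hn s hs)
    · rcases hb s hs x (mem_reach_of_adj ⟨hx, hxX⟩ (hS hs) hsx.symm) hsx with h | h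
      · exact .inl h
      · exact .inr (.inl h)
  refine ⟨fun S hS hne hb => ?_, ?_⟩
  · have hSW := eq_of_closed_reach hne hS hb
    refine ⟨?_, s, hSW ▸ hs, nbrs_singleton.2 has⟩
    by_contra hcon
    -- Without contact to `X \ {a}` the component would hang on `a` alone.
    obtain ⟨s, hs, hs'⟩ := h.cut a ha S (hS.trans hsub) hne (fun h => (reach_subset (hS h)).2 haX)
      (by simpa using key S hS _ hb fun s hs hn => hcon ⟨s, hs, hn⟩)
    rcases hs' with hs' | hs'
    · exact (reach_subset (hS hs)).2 hs'
    · exact hY s (hS hs) hs'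
  · intro u hu S hS hne huS hb
    by_contra! hcon
    have hb' : BoundaryIn G C S {u} := by
      intro s hs x hx hsx
      rcases key S hS _ hb (fun s hs => (hcon s hs).1) s hs x hx hsx with h | h | h
      · exact .inl h
      · exact .inr h
      · rw [mem_singleton_iff] at h
        exact absurd (nbrs_singleton.2 (h ▸ hsx.symm)) (hcon s hs).2
    obtain ⟨s, hs, hsX | hsY⟩ := h.cut u (hsub hu) S (hS.trans hsub) hne huS hb'
    · exact (reach_subset (hS hs)).2 hsX
    · exact hY s (hS hs) hsY

end Linked

namespace Rooted

variable {k : ℕ} {C X Y : Set V} {z : V}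

theorem symm (h : Rooted G k C X Y z) : Rooted G k C Y X z :=
  { h.toLinked.symm with
    deg := fun v hv hz => by rw [rdeg_symm]; exact h.deg v hv hz
    nontriv := h.nontriv }

theorem nonempty (h : Rooted G k C X Y z) : C.Nonempty := let ⟨v, hv, _⟩ := h.nontriv; ⟨v, hv⟩

/-- Contracting the neighbourhood of the first root into the root. -/
theorem contract_left [Finite V] (h : Rooted G k C X Y z)
    (hX : ∀ v ∈ reach G (C \ X) Y, v ≠ z → ∀ a ∈ C ∩ X, ∀ b ∈ C ∩ X,
      G.Adj v a → G.Adj v b → a = b)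
    (hne : ∃ v ∈ reach G (C \ X) Y, v ≠ z) :
    Rooted G k (reach G (C \ X) Y) (nbrs G (C ∩ X)) Y z := by
  have hsub : reach G (C \ X) Y ⊆ C := reach_subset.trans sdiff_subset
  refine { h.toLinked.contract_left with deg := ?_, nontriv := hne }
  intro v hv hz
  -- At most one neighbour in `X` is lost, and the edge to the new root makes up for it.
  refine (h.deg v (hsub hv) hz).trans (rdeg_le_add (k := 0) (C ∩ X ∩ G.neighborSet v)
    (fun w hw ha => ?_) ?_)
  · by_cases hwX : w ∈ X
    · exact .inr ⟨⟨hw, hwX⟩, ha⟩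
    · exact .inl (mem_reach_of_adj ⟨hw, hwX⟩ hv ha.symm)
  · rw [ind_of_not (reach_subset hv).2]
    have : (C ∩ X ∩ G.neighborSet v).ncard ≤ ind (v ∈ nbrs G (C ∩ X)) := by
      by_cases hn : v ∈ nbrs G (C ∩ X)
      · rw [ind_of hn]
        exact ncard_le_one_of fun a ha b hb => hX v hv hz a ha.1 b hb.1 ha.2 hb.2
      · rw [show C ∩ X ∩ G.neighborSet v = ∅ from ?_]
        · simp
        · rw [eq_empty_iff_forall_notMem]
          exact fun w hw => hn ⟨w, hw.1, G.adj_symm hw.2⟩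
    omega

/-- The rooted graph formed by a component outside `X`, with a vertex `a ∈ X` as one root and the
other vertices of `X` contracted into the other root. -/
theorem component [Finite V] (h : Rooted G k C X Y z) {a s w : V} (ha : a ∈ C) (haX : a ∈ X)
    (hs : s ∈ reach G (C \ X) {w}) (has : G.Adj a s)
    (hX : ∀ v ∈ reach G (C \ X) {w}, v ≠ z → ∀ a ∈ C ∩ X, ∀ b ∈ C ∩ X,
      G.Adj v a → G.Adj v b → a = b)
    (hY : ∀ v ∈ reach G (C \ X) {w}, v ∉ Y) (hne : ∃ v ∈ reach G (C \ X) {w}, v ≠ z) :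
    Rooted G k (reach G (C \ X) {w}) (nbrs G ((C ∩ X) \ {a})) (nbrs G {a}) z := by
  have hsub : reach G (C \ X) {w} ⊆ C := reach_subset.trans sdiff_subset
  refine { h.toLinked.component ha haX hs has hY with deg := ?_, nontriv := hne }
  intro v hv hz
  refine (h.deg v (hsub hv) hz).trans (rdeg_le_add (k := 0) (C ∩ X ∩ G.neighborSet v)
    (fun w hw ha => ?_) ?_)
  · by_cases hwX : w ∈ X
    · exact .inr ⟨⟨hw, hwX⟩, ha⟩
    · exact .inl (mem_reach_of_adj ⟨hw, hwX⟩ hv ha.symm)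
  · rw [ind_of_not (reach_subset hv).2, ind_of_not (hY v hv)]
    have h1 := ncard_le_one_of (S := C ∩ X ∩ G.neighborSet v)
      fun a ha b hb => hX v hv hz a ha.1 b hb.1 ha.2 hb.2
    rcases (C ∩ X ∩ G.neighborSet v).eq_empty_or_nonempty with h0 | ⟨b, hb⟩
    · simp [h0]
    · by_cases hba : b = a
      · rw [ind_of (nbrs_singleton.2 (hba ▸ G.adj_symm hb.2))]
        omega
      · rw [ind_of (show v ∈ nbrs G ((C ∩ X) \ {a}) from ⟨b, ⟨hb.1, hba⟩, G.adj_symm hb.2⟩)]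
        omega

/-- The rooted graph on one side of a separation whose separator is `u` and the first root. -/
theorem side [Finite V] (h : Rooted G k C X Y z) {S : Set V} {u : V} (hS : S ⊆ C) (hu : u ∈ C)
    (huS : u ∉ S) (hb : BoundaryIn G C S {u}) (hY : ∀ s ∈ S, s ∉ Y) (hne : ∃ s ∈ S, s ≠ z) :
    Rooted G k S X (nbrs G {u}) z := by
  refine ⟨⟨fun S' hS' hne' hb' => ⟨?_, ?_⟩, ?_⟩, ?_, hne⟩
  · obtain ⟨s, hs, h | h⟩ := h.cut u hu S' (hS'.trans hS) hne' (fun h => huS (hS' h)) (by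
      intro s hs w hw ha
      rcases hb s (hS' hs) w hw ha with h | h
      · exact .inl (by simpa using hb' s hs w h ha)
      · exact .inr h)
    · exact ⟨s, hs, h⟩
    · exact absurd h (hY s (hS' hs))
  · by_contra hcon
    obtain ⟨s, hs, hsY⟩ := (h.closed S' (hS'.trans hS) hne' (by
      intro s hs w hw ha
      rcases hb s (hS' hs) w hw ha with h | h
      · exact hb' s hs w h ha
      · rw [mem_singleton_iff] at h
        exact absurd ⟨s, hs, nbrs_singleton.2 (h ▸ ha.symm)⟩ hcon)).2
    exact hY s (hS' hs) hsY
  · intro w hw S' hS' hne' hwS' hb'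
    by_contra! hcon
    obtain ⟨s, hs, h | h⟩ := h.cut w (hS hw) S' (hS'.trans hS) hne' hwS' (by
      intro s hs x hx ha
      rcases hb s (hS' hs) x hx ha with h | h
      · exact hb' s hs x h ha
      · rw [mem_singleton_iff] at h
        exact absurd (nbrs_singleton.2 (h ▸ ha.symm)) (hcon s hs).2)
    · exact (hcon s hs).1 h
    · exact hY s (hS' hs) h
  · intro v hv hz
    refine (h.deg v (hS hv) hz).trans (rdeg_le_add (k := 0) ({u} ∩ G.neighborSet v) ?_ ?_)
    · intro w hw ha
      rcases hb v hv w hw ha with h | h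
      · exact .inl h
      · exact .inr ⟨h, ha⟩
    · rw [ind_of_not (hY v hv)]
      by_cases huv : G.Adj u v
      · rw [ind_of (nbrs_singleton.2 huv)]
        have := ncard_le_one_of (S := {u} ∩ G.neighborSet v) fun a ha b hb => ha.1.trans hb.1.symm
        omega
      · rw [show {u} ∩ G.neighborSet v = ∅ from ?_]
        · simp
        · rw [eq_empty_iff_forall_notMem]
          rintro w ⟨rfl, hw⟩
          exact huv (G.adj_symm hw)

/-- One path from `u` to `Y` outside `S` serves as a common tail, so all lengths are shifted by the
same amount. -/
theorem side_lengths (h : Rooted G k C X Y z) {S : Set V} {u : V} (hS : S ⊆ C) (hu : u ∈ C)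
    (hb : BoundaryIn G C S {u}) (hY : ∀ s ∈ S, s ∉ Y) :
    ∃ m, ∀ n ∈ lengths G S X (nbrs G {u}), n + m ∈ lengths G C X Y := by
  obtain ⟨b, hbY, m, hp⟩ := h.mem_reach hu hb hY
  refine ⟨m + 1, ?_⟩
  rintro n ⟨a, ha, q, hq, hp'⟩
  exact ⟨a, ha, b, hbY, hp'.append (nbrs_singleton.1 hq).symm hp disjoint_sdiff_right hS
    sdiff_subset⟩

end Rooted

/-! ### Lifting path lengths back to `C` -/

theorem PathIn.of_attached {D Y : Set V} {t : V}
    (h : t ∈ Y ∨ ∃ r ∈ reach G D Y, G.Adj t r) (ht : t ∉ D) :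
    ∃ b ∈ Y, ∃ m, PathIn G (insert t D) t b m := by
  rcases h with h | ⟨r, ⟨b, hb, m, hp⟩, ha⟩
  · exact ⟨t, h, 0, .nil (mem_insert _ _)⟩
  · refine ⟨b, hb, m + 1, .cons (mem_insert _ _) ha (hp.mono fun x hx => ⟨.inr hx, ?_⟩)⟩
    rintro rfl
    exact ht hx

theorem lengths_contract_left {C X Y : Set V} {n : ℕ}
    (h : n ∈ lengths G (reach G (C \ X) Y) (nbrs G (C ∩ X)) Y) : n + 1 ∈ lengths G C X Y := by
  obtain ⟨p, ⟨a, ha, hap⟩, b, hb, hp⟩ := h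
  refine ⟨a, ha.2, b, hb, .cons ha.1 hap (hp.mono fun x hx => ?_)⟩
  have := reach_subset hx
  exact ⟨this.1, fun hxa => this.2 (by rw [mem_singleton_iff] at hxa; exact hxa ▸ ha.2)⟩

theorem lengths_contract_right {C X Y : Set V} {n : ℕ}
    (h : n ∈ lengths G (reach G (C \ Y) X) X (nbrs G (C ∩ Y))) : n + 1 ∈ lengths G C X Y := by
  obtain ⟨a, ha, p, ⟨b, hb, hbp⟩, hp⟩ := h
  exact ⟨a, ha, b, hb.2, hp.snoc hbp.symm (fun h => (reach_subset h).2 hb.2)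
    (reach_subset.trans sdiff_subset) hb.1⟩

/-- The vertex `a` lies in both root neighbourhoods, so the lifted path ends at `a`; the two new
edges lead from `X` into the component and from it to `a`. -/
theorem lengths_component {C X Y : Set V} {n : ℕ} {a w : V} (ha : a ∈ C) (haX : a ∈ X)
    (haY : a ∈ Y)
    (h : n ∈ lengths G (reach G (C \ X) {w}) (nbrs G ((C ∩ X) \ {a})) (nbrs G {a})) :
    n + 2 ∈ lengths G C X Y := by
  obtain ⟨p, ⟨r, hr, hrp⟩, q, hq, hp⟩ := h
  rw [nbrs_singleton] at hq
  have h1 : PathIn G (C \ {r}) p a (n + 1) := hp.snoc hq.symm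
    (fun h => (reach_subset h).2 haX) (fun x hx => ⟨(reach_subset hx).1, fun hxr =>
      (reach_subset hx).2 (by rw [mem_singleton_iff] at hxr; exact hxr ▸ hr.1.2)⟩)
      ⟨ha, fun h => hr.2 h.symm⟩
  exact ⟨r, hr.1.2, a, haY, .cons hr.1.1 hrp h1⟩

/-! ### Two paths from minimum degree three -/

/-- If `a` or `b` continues to `Y` while avoiding the other and `d`, that path and its detour
through `d` differ by two. Otherwise `d` cuts off from `Y` a side containing `a` and `b`, and
induction applies there. -/
theorem Rooted.hasPair_of_common_nbrs [Finite V] {C X Y : Set V} {z : V}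
    (h : Rooted G 3 C X Y z)
    (ih : ∀ (C' X' Y' : Set V) (z' : V), C'.ncard < C.ncard → Rooted G 3 C' X' Y' z' →
      HasPair (lengths G C' X' Y')) {d a b : V} (hd : d ∈ C) (hdX : d ∉ X)
    (ha : a ∈ C) (haX : a ∈ X) (hb : b ∈ C) (hbX : b ∈ X) (hab : a ≠ b) (hda : G.Adj d a)
    (hdb : G.Adj d b) : HasPair (lengths G C X Y) := by
  have hda' : a ≠ d := fun h => hdX (h ▸ haX)
  have hdb' : b ≠ d := fun h => hdX (h ▸ hbX)
  by_cases hat : a ∈ Y ∨ ∃ r ∈ reach G (C \ {a, b, d}) Y, G.Adj a r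
  · obtain ⟨y, hy, m, hp⟩ := PathIn.of_attached hat (by simp)
    refine ⟨m, ⟨a, haX, y, hy, hp.mono (by grind)⟩, .inr ⟨b, hbX, y, hy, ?_⟩⟩
    exact .cons hb hdb.symm (.cons (by grind) hda (hp.mono (by grind)))
  by_cases hbt : b ∈ Y ∨ ∃ r ∈ reach G (C \ {a, b, d}) Y, G.Adj b r
  · obtain ⟨y, hy, m, hp⟩ := PathIn.of_attached hbt (by simp)
    refine ⟨m, ⟨b, hbX, y, hy, hp.mono (by grind)⟩, .inr ⟨a, haX, y, hy, ?_⟩⟩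
    exact .cons ha hda.symm (.cons (by grind) hdb (hp.mono (by grind)))
  push Not at hat hbt
  have hR : reach G (C \ {a, b, d}) Y ⊆ C \ {a, b, d} := reach_subset
  set S := C \ (insert d (reach G (C \ {a, b, d}) Y)) with hSdef
  have hSC : S ⊆ C := sdiff_subset
  have hdS : d ∉ S := by simp [S]
  have haS : a ∈ S := ⟨ha, by
    rintro (h | h)
    · exact hda' h
    · exact (hR h).2 (by simp)⟩
  have hbS : b ∈ S := ⟨hb, by
    rintro (h | h)
    · exact hdb' h
    · exact (hR h).2 (by simp)⟩
  have hbd : BoundaryIn G C S {d} := by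
    intro s hs w hw hsw
    by_cases hwd : w = d
    · exact .inr hwd
    refine .inl ⟨hw, ?_⟩
    rintro (h | h)
    · exact hwd h
    by_cases hsa : s = a
    · exact hat.2 w h (hsa ▸ hsw)
    by_cases hsb : s = b
    · exact hbt.2 w h (hsb ▸ hsw)
    refine hs.2 (.inr (mem_reach_of_adj ⟨hs.1, ?_⟩ h hsw))
    rintro (h | h | h)
    · exact hsa h
    · exact hsb h
    · exact hs.2 (.inl h)
  have hSY : ∀ s ∈ S, s ∉ Y := by
    intro s hs hsY
    refine hs.2 (.inr (mem_reach_of_mem ⟨hs.1, ?_⟩ hsY))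
    rintro (rfl | rfl | h)
    · exact hat.1 hsY
    · exact hbt.1 hsY
    · exact hs.2 (.inl h)
  have hne : ∃ s ∈ S, s ≠ z := by
    by_cases haz : a = z
    · exact ⟨b, hbS, fun h => hab (haz.trans h.symm)⟩
    · exact ⟨a, haS, haz⟩
  obtain ⟨m, hm⟩ := h.side_lengths hSC hd hbd hSY
  exact (ih S X _ z (ncard_lt_ncard ⟨hSC, fun h => hdS (h hd)⟩)
    (h.side hSC hd hdS hbd hSY hne)).shift m hm

/-- A rooted graph of minimum degree at least `3`, up to one exceptional vertex, has two paths
between the roots whose lengths differ by one or two. -/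
theorem Rooted.hasPair [Finite V] {C X Y : Set V} {z : V} (h : Rooted G 3 C X Y z) :
    HasPair (lengths G C X Y) := by
  induction hn : C.ncard using Nat.strong_induction_on generalizing C X Y z with
  | _ n ih =>
  subst hn
  have ih' : ∀ (C' X' Y' : Set V) (z' : V), C'.ncard < C.ncard → Rooted G 3 C' X' Y' z' →
      HasPair (lengths G C' X' Y') := fun C' X' Y' z' hlt h' => ih _ hlt h' rfl
  by_cases hA : ∃ d ∈ C, d ∉ X ∧ d ≠ z ∧ ∃ a ∈ C ∩ X, ∃ b ∈ C ∩ X, a ≠ b ∧ G.Adj d a ∧ G.Adj d b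
  · obtain ⟨d, hd, hdX, -, a, ha, b, hb, hab, hda, hdb⟩ := hA
    exact h.hasPair_of_common_nbrs ih' hd hdX ha.1 ha.2 hb.1 hb.2 hab hda hdb
  have hX : ∀ v ∈ C \ X, v ≠ z → ∀ a ∈ C ∩ X, ∀ b ∈ C ∩ X, G.Adj v a → G.Adj v b → a = b := by
    intro v hv hvz a ha b hb hva hvb
    by_contra hab
    exact hA ⟨v, hv.1, hv.2, hvz, a, ha, b, hb, hab, hva, hvb⟩
  obtain ⟨x₀, hx₀C, hx₀X⟩ := h.inter_left h.nonempty
  have hlt : ∀ B : Set V, (reach G (C \ X) B).ncard < C.ncard := fun B =>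
    ncard_lt_ncard ⟨reach_subset.trans sdiff_subset, fun hC => (reach_subset (hC hx₀C)).2 hx₀X⟩
  -- Contracting `X` now preserves degrees, so only the case where `Y` meets the outside of `X` in
  -- at most `z` survives.
  by_cases hD : ∃ v ∈ reach G (C \ X) Y, v ≠ z
  · exact (ih' _ _ _ z (hlt _) (h.contract_left
      (fun v hv => hX v (reach_subset hv)) hD)).shift 1 fun n hn => lengths_contract_left hn
  push Not at hD
  have hYX : ∀ y ∈ C, y ∈ Y → y ∉ X → y = z := fun y hy hyY hyX =>
    hD y (mem_reach_of_mem ⟨hy, hyX⟩ hyY)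
  by_cases ha : ∃ a ∈ C, a ∈ X ∧ a ∈ Y ∧ a ≠ z
  · obtain ⟨a, ha, haX, haY, haz⟩ := ha
    have h0 : 0 ∈ lengths G C X Y := ⟨a, haX, a, haY, .nil ha⟩
    obtain ⟨c, hc, hac⟩ : ∃ c ∈ C, G.Adj a c := by
      by_contra! hcon
      have h1 := h.deg a ha haz
      have h2 := rdeg_le (X := X) (Y := Y) (∅ : Set V) (fun w hw haw => (hcon w hw haw).elim)
      have h3 := ind_le_one (a ∈ X)
      have h4 := ind_le_one (a ∈ Y)
      simp only [ncard_empty] at h2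
      omega
    have hca : c ≠ a := hac.ne'
    by_cases hcX : c ∈ X
    · exact ⟨0, h0, .inl ⟨c, hcX, a, haY, .cons hc hac.symm (.nil ⟨ha, hca.symm⟩)⟩⟩
    -- The component of `c` is rooted at `a` and the rest of `X`, unless it is just `z`.
    by_cases hW : ∃ v ∈ reach G (C \ X) {c}, v ≠ z
    · refine (ih' _ _ _ z (hlt _) (h.component ha haX (mem_reach_of_mem ⟨hc, hcX⟩ rfl) hac
        (fun v hv => hX v (reach_subset hv)) ?_ hW)).shift 2
        fun n hn => lengths_component ha haX haY hn
      intro v hv hvY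
      obtain ⟨w, hw, hwz⟩ := hW
      have hcY : c ∈ reach G (C \ X) Y := by
        obtain ⟨b, rfl, n, hp⟩ := hv
        exact ⟨v, hvY, n, hp.reverse⟩
      exact hwz (hD w (reach_singleton_subset
        (mem_reach_of_mem (C := C \ X) (B := {c}) ⟨hc, hcX⟩ rfl) hcY hw))
    push Not at hW
    have hcz : c = z := hW c (mem_reach_of_mem ⟨hc, hcX⟩ rfl)
    subst hcz
    by_cases hcY : c ∈ Y
    · exact ⟨0, h0, .inl ⟨a, haX, c, hcY, .cons ha hac (.nil ⟨hc, hca⟩)⟩⟩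
    have hcN : ∀ w ∈ C, G.Adj c w → w ∈ X := by
      intro w hw hcw
      by_contra hwX
      exact hcw.ne' (hW w (mem_reach_of_adj ⟨hw, hwX⟩ (mem_reach_of_mem ⟨hc, hcX⟩ rfl) hcw.symm))
    -- Since `a` does not cut off `c`, there is a second neighbour `b`; the path b, c, a has length
    -- two, against the trivial path at `a`.
    obtain ⟨b, hb, hcb, hba⟩ : ∃ b ∈ C, G.Adj c b ∧ b ≠ a := by
      by_contra! hcon
      obtain ⟨s, rfl, hs⟩ := h.cut a ha {c} (by simpa using hc) (singleton_nonempty c) hca.symm (by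
        rintro s rfl w hw hsw
        exact .inr (hcon w hw hsw))
      exact hs.elim hcX hcY
    refine ⟨0, h0, .inr ⟨b, hcN b hb hcb, a, haY, ?_⟩⟩
    exact .cons hb hcb.symm (.cons ⟨hc, hcb.ne⟩ hac.symm (.nil ⟨⟨ha, hba.symm⟩, hca.symm⟩))
  · push Not at ha
    have hYz : ∀ y ∈ C, y ∈ Y → y = z := by
      intro y hy hyY
      by_cases hyX : y ∈ X
      · exact ha y hy hyX hyY
      · exact hYX y hy hyY hyX
    -- The second root has the exceptional vertex as its only neighbour. Making that vertex the root
    -- leaves no exception inside the smaller graph.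
    obtain ⟨y, hy, hyY⟩ := h.inter_right h.nonempty
    have hyz := hYz y hy hyY
    subst hyz
    have hbd : BoundaryIn G C (C \ {y}) {y} := by
      intro s hs w hw _
      by_cases hwy : w = y
      · exact .inr hwy
      · exact .inl ⟨hw, hwy⟩
    have hSY : ∀ s ∈ C \ {y}, s ∉ Y := fun s hs hsY => hs.2 (hYz s hs.1 hsY)
    have hne : ∃ s ∈ C \ {y}, s ≠ y := by
      obtain ⟨v, hv, hvy⟩ := h.nontriv
      exact ⟨v, ⟨hv, hvy⟩, hvy⟩
    obtain ⟨m, hm⟩ := h.side_lengths sdiff_subset hy hbd hSY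
    exact (ih' (C \ {y}) X _ y (ncard_lt_ncard ⟨sdiff_subset, fun h => (h hy).2 rfl⟩)
      (h.side (S := C \ {y}) sdiff_subset hy (fun h => h.2 rfl) hbd hSY hne)).shift m hm

/-! ### Disjoint paths from the roots -/

/-- In a linked rooted graph there is a path between the roots through any given inner vertex. -/
theorem Linked.exists_through [Finite V] {C X Y : Set V} (h : Linked G C X Y) {q : V}
    (hq : q ∈ C) : ∃ A B : Set V, A ⊆ C ∧ B ⊆ C ∧ Disjoint A B ∧ (∃ a ∈ X, ∃ n, PathIn G A a q n) ∧
      (q ∈ Y ∨ ∃ r ∈ reach G B Y, G.Adj q r) := by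
  induction hn : C.ncard using Nat.strong_induction_on generalizing C X Y with
  | _ n ih =>
  subst hn
  by_cases hqX : q ∈ X
  · refine ⟨{q}, C \ {q}, by simpa using hq, sdiff_subset, disjoint_sdiff_right,
      ⟨q, hqX, 0, .nil rfl⟩, ?_⟩
    by_contra! hcon
    obtain ⟨s, hs, hsY⟩ := (h.closed (C \ reach G (C \ {q}) Y) sdiff_subset
      ⟨q, hq, fun h => (reach_subset h).2 rfl⟩ (by
        intro s hs w hw ha
        refine .inl ⟨hw, fun hwR => ?_⟩
        by_cases hsq : s = q
        · exact hcon.2 w hwR (hsq ▸ ha)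
        · exact hs.2 (mem_reach_of_adj ⟨hs.1, hsq⟩ hwR ha))).2
    by_cases hsq : s = q
    · exact hcon.1 (hsq ▸ hsY)
    · exact hs.2 (mem_reach_of_mem ⟨hs.1, hsq⟩ hsY)
  obtain ⟨x₀, hx₀C, hx₀X⟩ := h.inter_left ⟨q, hq⟩
  have hlt : ∀ B : Set V, (reach G (C \ X) B).ncard < C.ncard := fun B =>
    ncard_lt_ncard ⟨reach_subset.trans sdiff_subset, fun hC => (reach_subset (hC hx₀C)).2 hx₀X⟩
  by_cases hqY : q ∈ reach G (C \ X) Y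
  · obtain ⟨A, B, hA, hB, hAB, ⟨p, ⟨a, ha, hap⟩, n, hp⟩, hr⟩ :=
      ih _ (hlt Y) h.contract_left hqY rfl
    have hsub : reach G (C \ X) Y ⊆ C := reach_subset.trans sdiff_subset
    have hA' : a ∉ A := fun h => (reach_subset (hA h)).2 ha.2
    have hB' : a ∉ B := fun h => (reach_subset (hB h)).2 ha.2
    refine ⟨insert a A, B, insert_subset ha.1 (hA.trans hsub), hB.trans hsub,
      disjoint_insert_left.2 ⟨hB', hAB⟩, ⟨a, ha.2, n + 1, .cons (mem_insert _ _) hap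
        (hp.mono (by grind))⟩, hr⟩
  -- The component of `q` outside `X` misses `Y`. The induction hypothesis is used inside it, with a
  -- suitable vertex of `X` as the second root.
  have hqD : q ∈ reach G (C \ X) {q} := mem_reach_of_mem ⟨hq, hqX⟩ rfl
  have hDY : ∀ v ∈ reach G (C \ X) {q}, v ∉ Y := fun v hv hvY =>
    hqY (reach_singleton_subset hv (mem_reach_of_mem (reach_subset hv) hvY) hqD)
  set D := reach G (C \ X) {q} with hD
  have hDC : D ⊆ C := reach_subset.trans sdiff_subset
  set N := C ∩ X ∩ nbrs G D with hN
  set Z := C \ (D ∪ N) with hZ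
  have hout : ∀ s ∈ D, ∀ w ∈ C, G.Adj s w → w ∈ D ∨ w ∈ N := by
    intro s hs w hw ha
    by_cases hwX : w ∈ X
    · exact .inr ⟨⟨hw, hwX⟩, s, hs, ha⟩
    · exact .inl (mem_reach_of_adj ⟨hw, hwX⟩ hs ha.symm)
  -- Some neighbour of the component continues to `Y` through `Z`; otherwise the vertices not
  -- reaching `Y` there would form a closed set missing `Y`.
  obtain ⟨a, haN, hat⟩ : ∃ a ∈ N, a ∈ Y ∨ ∃ r ∈ reach G Z Y, G.Adj a r := by
    by_contra! hcon
    obtain ⟨s, hs, hsY⟩ := (h.closed (C \ reach G Z Y) sdiff_subset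
      ⟨q, hq, fun h => (reach_subset h).2 (.inl hqD)⟩ (by
        intro s hs w hw ha
        refine .inl ⟨hw, fun hwR => ?_⟩
        by_cases hsD : s ∈ D
        · exact (reach_subset hwR).2 (hout s hsD w hw ha)
        by_cases hsN : s ∈ N
        · exact (hcon s hsN).2 w hwR ha
        · exact hs.2 (mem_reach_of_adj ⟨hs.1, fun h => h.elim hsD hsN⟩ hwR ha))).2
    by_cases hsD : s ∈ D
    · exact hDY s hsD hsY
    by_cases hsN : s ∈ N
    · exact (hcon s hsN).1 hsY
    · exact hs.2 (mem_reach_of_mem ⟨hs.1, fun h => h.elim hsD hsN⟩ hsY)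
  obtain ⟨y, hy, m, hpy⟩ := PathIn.of_attached hat (by grind)
  obtain ⟨⟨haC, haX⟩, s, hsD, hsa⟩ := id haN
  obtain ⟨A, B, hA, hB, hAB, ⟨p, ⟨c, hc, hcp⟩, n, hp⟩, hr⟩ :=
    ih _ (hlt {q}) (h.component haC haX hsD hsa.symm hDY) hqD rfl
  have hcN : c ∈ N := ⟨hc.1, p, hA hp.left_mem, hcp.symm⟩
  have hXD : ∀ x ∈ X, x ∉ D := fun x hx hxD => (reach_subset hxD).2 hx
  have hcA : c ∉ A := fun h => hXD c hc.1.2 (hA h)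
  have hcB : c ∉ B := fun h => hXD c hc.1.2 (hB h)
  have haA : a ∉ A := fun h => hXD a haX (hA h)
  have haB : a ∉ B := fun h => hXD a haX (hB h)
  have hca : c ≠ a := hc.2
  refine ⟨insert c A, B ∪ insert a Z, insert_subset hc.1.1 (hA.trans hDC),
    union_subset (hB.trans hDC) (insert_subset haC sdiff_subset), ?_,
    ⟨c, hc.1.2, n + 1, .cons (mem_insert _ _) hcp (hp.mono (by grind))⟩, .inr ?_⟩
  · rw [disjoint_left] at hAB ⊢
    intro v hv hv'
    rcases hv with rfl | hv <;> rcases hv' with hv' | rfl | hv'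
    · exact hcB hv'
    · exact hca rfl
    · exact hv'.2 (.inr hcN)
    · exact hAB hv hv'
    · exact haA hv
    · exact hv'.2 (.inl (hA hv))
  · rcases hr with hr | ⟨r, ⟨b, hb, k, hpb⟩, hqr⟩
    · exact ⟨a, ⟨y, hy, m, hpy.mono subset_union_right⟩, (nbrs_singleton.1 hr).symm⟩
    · refine ⟨r, ⟨y, hy, _, hpb.append (nbrs_singleton.1 hb).symm hpy ?_ subset_union_left
        subset_union_right⟩, hqr⟩
      rw [disjoint_left]
      rintro v hv (rfl | hv')
      · exact haB hv
      · exact hv'.2 (.inl (hB hv))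

/-- The initial segment of a path up to the point where it enters `S`. -/
theorem PathIn.prefix_avoiding {A C S U : Set V} {a q : V} {n : ℕ} (h : PathIn G A a q n)
    (ha : a ∉ S) (hq : q ∈ S) (hA : A ⊆ C) (hb : BoundaryIn G C S U) :
    ∃ w ∈ U, ∃ m, PathIn G (A \ S) a w m := by
  induction h with
  | nil _ => exact absurd hq ha
  | @cons A u w v n hu hadj hp ih =>
    by_cases hw : w ∈ S
    · exact ⟨u, (hb w hw u (hA hu) hadj.symm).resolve_left ha, 0, .nil ⟨hu, ha⟩⟩
    · obtain ⟨x, hx, m, hm⟩ := ih hw hq (sdiff_subset.trans hA)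
      refine ⟨x, hx, m + 1, .cons ⟨hu, ha⟩ hadj ?_⟩
      rwa [sdiff_sdiff_comm]

/-- Two disjoint paths from the roots to a two-vertex separator. -/
theorem Linked.exists_linkage [Finite V] {C X Y S : Set V} (h : Linked G C X Y) {u v : V}
    (hS : S ⊆ C) (hne : S.Nonempty) (hb : BoundaryIn G C S {u, v}) (hX : ∀ s ∈ S, s ∉ X)
    (hY : ∀ s ∈ S, s ∉ Y) :
    ∃ w w' : V, ((w = u ∧ w' = v) ∨ (w = v ∧ w' = u)) ∧ ∃ A B : Set V, A ⊆ C \ S ∧ B ⊆ C \ S ∧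
      Disjoint A B ∧ (∃ a ∈ X, ∃ n, PathIn G A a w n) ∧ ∃ b ∈ Y, ∃ n, PathIn G B w' b n := by
  obtain ⟨q, hq⟩ := hne
  obtain ⟨A, B, hA, hB, hAB, ⟨a, ha, n, hp⟩, hr⟩ := h.exists_through (hS hq)
  obtain ⟨r, ⟨b, hbY, m, hp'⟩, hqr⟩ := hr.resolve_left (hY q hq)
  obtain ⟨w, hw, k, hk⟩ := hp.prefix_avoiding (fun h => hX a h ha) hq hA hb
  have hqA : q ∈ A := hp.right_mem
  have hqB : q ∉ B := disjoint_left.1 hAB hqA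
  obtain ⟨w', hw', k', hk'⟩ := (hp'.reverse.snoc hqr.symm hqB (subset_insert q B)
    (mem_insert q B)).prefix_avoiding (fun h => hY b h hbY) hq (insert_subset (hS hq) hB) hb
  have hk'' := hk'.mono (D := B \ S) (by grind)
  have hww : w ≠ w' := fun h =>
    disjoint_left.1 hAB hk.right_mem.1 (h ▸ hk''.right_mem.1)
  refine ⟨w, w', ?_, A \ S, B \ S, sdiff_subset_sdiff_left hA, sdiff_subset_sdiff_left hB,
    hAB.mono sdiff_subset sdiff_subset, ⟨a, ha, k, hk⟩, b, hbY, k', hk''.reverse⟩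
  rcases hw with rfl | rfl <;> rcases hw' with rfl | rfl <;> simp_all

theorem lengths_symm (C X Y : Set V) : lengths G C X Y = lengths G C Y X := by
  ext n
  constructor <;> rintro ⟨a, ha, b, hb, hp⟩ <;> exact ⟨b, hb, a, ha, hp.reverse⟩

theorem lengths_mono {C D X Y : Set V} (h : C ⊆ D) : lengths G C X Y ⊆ lengths G D X Y := by
  rintro n ⟨a, ha, b, hb, hp⟩; exact ⟨a, ha, b, hb, hp.mono h⟩

/-! ### Triangle-freeness and minimal counterexamples -/

/-- `G[C]` is triangle-free, also after adding a root with neighbourhood `Y`. -/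
structure TriFree (G : SimpleGraph V) (C Y : Set V) : Prop where
  tri : ∀ a ∈ C, ∀ b ∈ C, ∀ c ∈ C, G.Adj a b → G.Adj b c → G.Adj a c → False
  ind : ∀ a ∈ C, ∀ b ∈ C, a ∈ Y → b ∈ Y → G.Adj a b → False

theorem TriFree.mono {C D Y Y' : Set V} (h : TriFree G C Y) (hD : D ⊆ C) (hY : Y' ⊆ Y) :
    TriFree G D Y' where
  tri a ha b hb c hc := h.tri a (hD ha) b (hD hb) c (hD hc)
  ind a ha b hb haY hbY := h.ind a (hD ha) b (hD hb) (hY haY) (hY hbY)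

/-- The neighbourhood of an inner vertex is independent, so any inner vertex may become the second
root. -/
theorem TriFree.nbr {C D Y : Set V} (h : TriFree G C Y) (hD : D ⊆ C) {u : V} (hu : u ∈ C) :
    TriFree G D (nbrs G {u}) where
  tri a ha b hb c hc := h.tri a (hD ha) b (hD hb) c (hD hc)
  ind a ha b hb haY hbY hab := h.tri u hu a (hD ha) b (hD hb) (nbrs_singleton.1 haY) hab
    (nbrs_singleton.1 hbY)

/-- Joining the roots makes the rooted graph `3`-connected, up to separators cutting off just the
exceptional vertex `z`. -/
structure Tight (G : SimpleGraph V) (C X Y : Set V) (z : V) : Prop where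
  conn : ∀ S ⊆ C, S.Nonempty → BoundaryIn G C S ∅ → S = C
  left : ∀ S ⊆ C, ∀ u ∈ C, u ∉ S → BoundaryIn G C S {u} → (∀ s ∈ S, s ∉ Y) → ∀ s ∈ S, s = z
  right : ∀ S ⊆ C, ∀ u ∈ C, u ∉ S → BoundaryIn G C S {u} → (∀ s ∈ S, s ∉ X) → ∀ s ∈ S, s = z
  inner : ∀ S ⊆ C, ∀ u ∈ C, ∀ v ∈ C, u ∉ S → v ∉ S → BoundaryIn G C S {u, v} →
    (∀ s ∈ S, s ∉ X) → (∀ s ∈ S, s ∉ Y) → ∀ s ∈ S, s = z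

theorem Tight.symm {C X Y : Set V} {z : V} (h : Tight G C X Y z) : Tight G C Y X z where
  conn := h.conn
  left := h.right
  right := h.left
  inner S hS u hu v hv huS hvS hb hX hY := h.inner S hS u hu v hv huS hvS hb hY hX

/-- A minimal counterexample. -/
structure Minimal (G : SimpleGraph V) (C X Y : Set V) (z : V) : Prop where
  rooted : Rooted G 4 C X Y z
  triFree : TriFree G C Y
  not_good : ¬ Good (lengths G C X Y)
  ih : ∀ (C' X' Y' : Set V) (z' : V), C'.ncard < C.ncard → Rooted G 4 C' X' Y' z' →
    TriFree G C' Y' → Good (lengths G C' X' Y')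
  ih_edge : ∀ X' Y' : Set V, (C ∩ X').ncard + (C ∩ Y').ncard < (C ∩ X).ncard + (C ∩ Y).ncard →
    Rooted G 4 C X' Y' z → TriFree G C Y' → Good (lengths G C X' Y')

/-- The rooted graph on the far side of a separator consisting of two inner vertices. -/
theorem Rooted.inner_side [Finite V] {k : ℕ} {C X Y S : Set V} {z u v : V}
    (h : Rooted G k C X Y z) (hS : S ⊆ C) (hu : u ∈ C) (hv : v ∈ C) (huv : u ≠ v) (huS : u ∉ S)
    (hvS : v ∉ S) (hb : BoundaryIn G C S {u, v}) (hX : ∀ s ∈ S, s ∉ X) (hY : ∀ s ∈ S, s ∉ Y)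
    (hne : ∃ s ∈ S, s ≠ z) : Rooted G k S (nbrs G {u}) (nbrs G {v}) z := by
  have key : ∀ S' ⊆ S, ∀ U : Set V, BoundaryIn G S S' U → ∀ s ∈ S', ∀ x ∈ C, G.Adj s x →
      x ∈ S' ∨ x ∈ U ∨ x = u ∨ x = v := by
    intro S' hS' U hb' s hs x hx ha
    rcases hb s (hS' hs) x hx ha with h | h
    · rcases hb' s hs x h ha with h | h
      · exact .inl h
      · exact .inr (.inl h)
    · exact .inr (.inr h)
  have hcut : ∀ w ∈ C, ∀ S' ⊆ S, S'.Nonempty → w ∉ S' → ¬ BoundaryIn G C S' {w} := by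
    intro w hw S' hS' hne hwS' hb'
    obtain ⟨s, hs, h | h⟩ := h.cut w hw S' (hS'.trans hS) hne hwS' hb'
    · exact hX s (hS' hs) h
    · exact hY s (hS' hs) h
  refine ⟨⟨fun S' hS' hne' hb' => ⟨?_, ?_⟩, ?_⟩, ?_, hne⟩
  · by_contra hcon
    refine hcut v hv S' hS' hne' (fun h => hvS (hS' h)) fun s hs x hx ha => ?_
    rcases key S' hS' _ hb' s hs x hx ha with h | h | rfl | rfl
    · exact .inl h
    · exact h.elim
    · exact absurd ⟨s, hs, nbrs_singleton.2 ha.symm⟩ hcon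
    · exact .inr rfl
  · by_contra hcon
    refine hcut u hu S' hS' hne' (fun h => huS (hS' h)) fun s hs x hx ha => ?_
    rcases key S' hS' _ hb' s hs x hx ha with h | h | rfl | rfl
    · exact .inl h
    · exact h.elim
    · exact .inr rfl
    · exact absurd ⟨s, hs, nbrs_singleton.2 ha.symm⟩ hcon
  · intro w hw S' hS' hne' hwS' hb'
    by_contra! hcon
    refine hcut w (hS hw) S' hS' hne' hwS' fun s hs x hx ha => ?_
    rcases key S' hS' _ hb' s hs x hx ha with h | h | rfl | rfl
    · exact .inl h
    · exact .inr h
    · exact absurd (nbrs_singleton.2 ha.symm) (hcon s hs).1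
    · exact absurd (nbrs_singleton.2 ha.symm) (hcon s hs).2
  · intro x hx hz
    refine (h.deg x (hS hx) hz).trans (rdeg_le_add (k := 0) ({u, v} ∩ G.neighborSet x) ?_ ?_)
    · intro w hw ha
      rcases hb x hx w hw ha with h | h
      · exact .inl h
      · exact .inr ⟨h, ha⟩
    · rw [ind_of_not (hX x hx), ind_of_not (hY x hx)]
      have hsub : {u, v} ∩ G.neighborSet x ⊆ ({u} ∩ G.neighborSet x) ∪ ({v} ∩ G.neighborSet x) := by
        rintro w ⟨rfl | rfl, hw⟩
        · exact .inl ⟨rfl, hw⟩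
        · exact .inr ⟨rfl, hw⟩
      have h1 : ∀ a, ({a} ∩ G.neighborSet x).ncard ≤ ind (x ∈ nbrs G {a}) := by
        intro a
        by_cases ha : G.Adj a x
        · rw [ind_of (nbrs_singleton.2 ha)]
          exact ncard_le_one_of fun b hb c hc => hb.1.trans hc.1.symm
        · rw [show {a} ∩ G.neighborSet x = ∅ from ?_]
          · simp
          · rw [eq_empty_iff_forall_notMem]
            rintro w ⟨rfl, hw⟩
            exact ha (G.adj_symm hw)
      have h2 := (ncard_le_ncard hsub).trans (ncard_union_le _ _)
      have h3 := h1 u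
      have h4 := h1 v
      omega

/-! ### Connectivity of a minimal counterexample -/

namespace Minimal

variable {C X Y : Set V} {z : V}

/-- The side becomes a smaller rooted graph with `u` as second root, and a common tail transfers its
good lengths back. -/
theorem false_of_left [Finite V] (h : Minimal G C X Y z) {S : Set V} {u : V} (hS : S ⊆ C)
    (hu : u ∈ C) (huS : u ∉ S) (hb : BoundaryIn G C S {u}) (hY : ∀ s ∈ S, s ∉ Y)
    (hne : ∃ s ∈ S, s ≠ z) : False := by
  obtain ⟨m, hm⟩ := h.rooted.side_lengths hS hu hb hY
  exact h.not_good ((h.ih S X _ z (ncard_lt_ncard ⟨hS, fun h => huS (h hu)⟩)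
    (h.rooted.side hS hu huS hb hY hne) (h.triFree.nbr hS hu)).shift m hm)

theorem false_of_right [Finite V] (h : Minimal G C X Y z) {S : Set V} {u : V} (hS : S ⊆ C)
    (hu : u ∈ C) (huS : u ∉ S) (hb : BoundaryIn G C S {u}) (hX : ∀ s ∈ S, s ∉ X)
    (hne : ∃ s ∈ S, s ≠ z) : False := by
  obtain ⟨m, hm⟩ := h.rooted.symm.side_lengths hS hu hb hX
  refine h.not_good ((h.ih S (nbrs G {u}) Y z (ncard_lt_ncard ⟨hS, fun h => huS (h hu)⟩)
    (h.rooted.symm.side hS hu huS hb hX hne).symm (h.triFree.mono hS subset_rfl)).shift m ?_)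
  intro n hn
  rw [lengths_symm] at hn ⊢
  exact hm n hn

/-- Disjoint paths join the roots to the two cut vertices, in an order dictated by `exists_linkage`.
They prolong all paths across `S` equally, so good lengths for the smaller graph with the cut
vertices as roots are good lengths in `C`. -/
theorem false_of_inner [Finite V] (h : Minimal G C X Y z) {S : Set V} {u v : V} (hS : S ⊆ C)
    (hu : u ∈ C) (hv : v ∈ C) (huS : u ∉ S) (hvS : v ∉ S) (hb : BoundaryIn G C S {u, v})
    (hX : ∀ s ∈ S, s ∉ X) (hY : ∀ s ∈ S, s ∉ Y) (hne : ∃ s ∈ S, s ≠ z) : False := by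
  have hne' : S.Nonempty := let ⟨s, hs, _⟩ := hne; ⟨s, hs⟩
  obtain ⟨w, w', hw, A, B, hA, hB, hAB, ⟨a, ha, n, hp⟩, b, hbY, m, hp'⟩ :=
    h.rooted.exists_linkage hS hne' hb hX hY
  have hww : w ≠ w' := fun h => disjoint_left.1 hAB hp.right_mem (h ▸ hp'.left_mem)
  have hwC : w ∈ C ∧ w' ∈ C ∧ w ∉ S ∧ w' ∉ S := by
    rcases hw with ⟨rfl, rfl⟩ | ⟨rfl, rfl⟩ <;> exact ⟨‹_›, ‹_›, ‹_›, ‹_›⟩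
  have hb' : BoundaryIn G C S {w, w'} := by
    rcases hw with ⟨rfl, rfl⟩ | ⟨rfl, rfl⟩
    · exact hb
    · rwa [pair_comm]
  refine h.not_good ((h.ih S (nbrs G {w}) (nbrs G {w'}) z
    (ncard_lt_ncard ⟨hS, fun h => huS (h hu)⟩)
    (h.rooted.inner_side hS hwC.1 hwC.2.1 hww hwC.2.2.1 hwC.2.2.2 hb' hX hY hne)
    (h.triFree.nbr hS hwC.2.1)).shift (n + m + 2) ?_)
  rintro k ⟨p, hpw, q, hqw, hpq⟩
  have h1 := hpq.append (nbrs_singleton.1 hqw).symm hp' (E := S ∪ B)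
    (disjoint_left.2 fun x hx hx' => (hB hx').2 hx) subset_union_left subset_union_right
  have h2 := hp.append (nbrs_singleton.1 hpw) h1 (E := C)
    (disjoint_left.2 fun x hx hx' => hx'.elim (hA hx).2 (disjoint_left.1 hAB hx))
    (hA.trans sdiff_subset) (union_subset hS (hB.trans sdiff_subset))
  exact ⟨a, ha, b, hbY, by convert h2 using 1; omega⟩

theorem tight [Finite V] (h : Minimal G C X Y z) : Tight G C X Y z where
  conn S hS hne hb := by
    have key : ∀ S ⊆ C, S ≠ C → (∃ s ∈ S, s ≠ z) → ¬ BoundaryIn G C S ∅ := by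
      intro S hS hSC hne hb
      refine h.not_good ((h.ih S X Y z (ncard_lt_ncard (hS.ssubset_of_ne hSC))
        ⟨⟨fun S' hS' hne' hb' => h.rooted.closed S' (hS'.trans hS) hne' ?_,
          fun u hu S' hS' hne' huS' hb' => h.rooted.cut u (hS hu) S' (hS'.trans hS) hne' huS' ?_⟩,
          fun v hv hz => (h.rooted.deg v (hS hv) hz).trans (rdeg_le_add (k := 0) ∅ ?_ ?_), hne⟩
        (h.triFree.mono hS subset_rfl)).shift 0 fun n hn => lengths_mono hS hn)
      · intro s hs w hw ha
        exact hb' s hs w (by simpa using hb s (hS' hs) w hw ha) ha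
      · intro s hs w hw ha
        exact hb' s hs w (by simpa using hb s (hS' hs) w hw ha) ha
      · exact fun w hw ha => hb v hv w hw ha
      · simp
    -- One of `S` and `C \ S` contains a vertex other than `z`, and that part alone is a smaller
    -- rooted graph.
    by_contra hSC
    obtain ⟨v, hv, hvz⟩ := h.rooted.nontriv
    by_cases hvS : v ∈ S
    · exact key S hS hSC ⟨v, hvS, hvz⟩ hb
    · refine key (C \ S) sdiff_subset ?_ ⟨v, ⟨hv, hvS⟩, hvz⟩ hb.compl
      obtain ⟨s, hs⟩ := hne
      intro heq
      have := hS hs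
      rw [← heq] at this
      exact this.2 hs
  left S hS u hu huS hb hY s hs := by
    by_contra hsz
    exact h.false_of_left hS hu huS hb hY ⟨s, hs, hsz⟩
  right S hS u hu huS hb hX s hs := by
    by_contra hsz
    exact h.false_of_right hS hu huS hb hX ⟨s, hs, hsz⟩
  inner S hS u hu v hv huS hvS hb hX hY s hs := by
    by_contra hsz
    exact h.false_of_inner hS hu hv huS hvS hb hX hY ⟨s, hs, hsz⟩

end Minimal

variable {C X Y : Set V} {z : V}

/-! ### Deleting root edges and exceptional vertices -/

/-- Deleting the edge between the first root and a vertex of large degree. -/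
theorem Rooted.delete_edge [Finite V] (h : Rooted G 4 C X Y z) (t : Tight G C X Y z) {a : V}
    (ha : a ∈ C) (h3 : 3 ≤ rdeg G C X Y a) (h5 : a ≠ z → 5 ≤ rdeg G C X Y a) :
    Rooted G 4 C (X \ {a}) Y z := by
  refine ⟨⟨fun S hS hne hb => ⟨?_, (h.closed S hS hne hb).2⟩, ?_⟩, ?_, h.nontriv⟩
  · have hSC := t.conn S hS hne hb
    subst hSC
    by_contra hcon
    -- If `a` were the only contact of the first root, everything else would be at most `z`. For `a
    -- ≠ z` this leaves `a` with degree at most three.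
    have h1 := t.right (S \ {a}) sdiff_subset a ha (fun h => h.2 rfl) (fun s hs w hw _ => by
      by_cases hwa : w = a
      · exact .inr hwa
      · exact .inl ⟨hw, hwa⟩) (fun s hs hsX => hcon ⟨s, hs.1, hsX, hs.2⟩)
    by_cases haz : a = z
    · obtain ⟨v, hv, hvz⟩ := h.nontriv
      exact hvz (h1 v ⟨hv, fun h => hvz (h.trans haz)⟩)
    · have h2 := rdeg_le (G := G) (C := S) (X := X) (Y := Y) (v := a) {z} fun w hw haw =>
        h1 w ⟨hw, haw.ne'⟩
      have := h5 haz
      have := ind_le_one (a ∈ X)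
      have := ind_le_one (a ∈ Y)
      rw [ncard_singleton] at h2
      omega
  · intro u hu S hS hne huS hb
    by_contra! hcon
    -- A violating set misses `Y`, so it is `{z}`. If `a` is this vertex, its only possible edges go
    -- to `u` and the first root, contrary to degree three.
    have h1 := t.left S hS u hu huS hb fun s hs => (hcon s hs).2
    obtain ⟨s, hs⟩ := hne
    have hsz := h1 s hs
    subst hsz
    by_cases has : a = s
    · subst has
      have h2 := rdeg_le (G := G) (C := C) (X := X) (Y := Y) (v := a) {u} fun w hw haw =>
        (hb a hs w hw haw).resolve_left fun hwS => haw.ne' (h1 w hwS)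
      rw [ncard_singleton, ind_of_not (hcon a hs).2] at h2
      have := ind_le_one (a ∈ X)
      omega
    · obtain ⟨s', hs', h' | h'⟩ := h.cut u hu S hS ⟨s, hs⟩ huS hb
      · have := h1 s' hs'
        subst this
        exact (hcon s' hs').1 ⟨h', fun h => has h.symm⟩
      · exact (hcon s' hs').2 h'
  · intro v hv hvz
    have h4 := h.deg v hv hvz
    by_cases hva : v = a
    · subst hva
      have := h5 hvz
      have := rdeg_le_add (G := G) (C := C) (D := C) (X := X) (Y := Y) (A := X \ {v})
        (B := Y) (v := v) (k := 1) ∅ (fun w hw _ => .inl hw) (by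
          have := ind_le_one (v ∈ X)
          simp only [ncard_empty]
          omega)
      omega
    · have := rdeg_le_add (G := G) (C := C) (D := C) (X := X) (Y := Y) (A := X \ {a})
        (B := Y) (v := v) (k := 0) ∅ (fun w hw _ => .inl hw) (by
          have := ind_mono (p := v ∈ X) (q := v ∈ X \ {a}) fun h => ⟨h, hva⟩
          simp only [ncard_empty]; omega)
      omega

/-- Deleting an exceptional vertex of degree at most two that is adjacent to a root. -/
theorem Rooted.delete_exceptional [Finite V] (h : Rooted G 4 C X Y z) (t : Tight G C X Y z)
    (hz : z ∈ C) (hzX : z ∈ X) (h2 : rdeg G C X Y z ≤ 2) :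
    ∃ u, Rooted G 4 (C \ {z}) X Y u := by
  obtain ⟨v₀, hv₀, hv₀z⟩ := h.nontriv
  -- This is the only inner neighbour of `z`, hence the only vertex losing degree: it becomes the
  -- new exception.
  obtain ⟨u, hu, hzu⟩ : ∃ u ∈ C, G.Adj z u := by
    by_contra! hcon
    have := t.conn {z} (by simpa using hz) (singleton_nonempty z) (by
      rintro s rfl w hw ha
      exact absurd ha (hcon w hw))
    rw [← this] at hv₀
    exact hv₀z hv₀
  have hpos : 1 ≤ (C ∩ G.neighborSet z).ncard :=
    Nat.one_le_iff_ne_zero.2 fun h0 => by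
      rw [ncard_eq_zero] at h0
      exact (h0 ▸ (⟨hu, hzu⟩ : u ∈ C ∩ G.neighborSet z) : u ∈ (∅ : Set V))
  unfold rdeg at h2
  rw [ind_of hzX] at h2
  have hzY : z ∉ Y := fun hzY => by rw [ind_of hzY] at h2; omega
  have huniq : ∀ w ∈ C, G.Adj z w → w = u := by
    intro w hw hzw
    exact (ncard_le_one (toFinite _)).1 (by omega : (C ∩ G.neighborSet z).ncard ≤ 1) w ⟨hw, hzw⟩ u
      ⟨hu, hzu⟩
  have huz : u ≠ z := hzu.ne'
  have hstep : ∀ S ⊆ C \ {z}, u ∉ S → ∀ U, BoundaryIn G (C \ {z}) S U → BoundaryIn G C S U := by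
    intro S hS huS U hb s hs w hw ha
    by_cases hwz : w = z
    · subst hwz
      exact absurd (huniq s (hS hs).1 ha.symm ▸ hs) huS
    · exact hb s hs w ⟨hw, hwz⟩ ha
  have hstep' : ∀ S ⊆ C \ {z}, u ∈ S → ∀ U, BoundaryIn G (C \ {z}) S U →
      BoundaryIn G C (insert z S) U := by
    rintro S hS huS U hb s (rfl | hs) w hw ha
    · exact .inl (.inr (huniq w hw ha ▸ huS))
    · by_cases hwz : w = z
      · exact .inl (.inl hwz)
      · rcases hb s hs w ⟨hw, hwz⟩ ha with h | h
        · exact .inl (.inr h)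
        · exact .inr h
  refine ⟨u, ⟨⟨fun S hS hne hb => ?_, ?_⟩, ?_, ?_⟩⟩
  · by_cases huS : u ∈ S
    · have hSC := t.conn (insert z S) (insert_subset hz (hS.trans sdiff_subset)) ⟨z, .inl rfl⟩
        (hstep' S hS huS _ hb)
      obtain ⟨⟨x, hx, hxX⟩, y, hy, hyY⟩ := h.closed C subset_rfl ⟨z, hz⟩ fun _ _ w hw _ => .inl hw
      refine ⟨?_, ?_⟩
      · by_contra hcon
        refine huz (t.right S (hS.trans sdiff_subset) z hz (fun h => (hS h).2 rfl)
          (fun s hs w hw _ => ?_) (fun s hs hsX => hcon ⟨s, hs, hsX⟩) u huS)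
        rw [← hSC] at hw
        exact hw.symm
      · rw [← hSC] at hy
        rcases hy with rfl | hy
        · exact absurd hyY hzY
        · exact ⟨y, hy, hyY⟩
    · have := t.conn S (hS.trans sdiff_subset) hne (hstep S hS huS _ hb)
      rw [this] at huS
      exact absurd hu huS
  · intro w hw S hS hne hwS hb
    by_cases huS : u ∈ S
    · by_contra! hcon
      refine huz (t.left (insert z S) (insert_subset hz (hS.trans sdiff_subset)) w hw.1 ?_
        (hstep' S hS huS _ hb) ?_ u (.inr huS))
      · rintro (h | h)
        · exact hw.2 h
        · exact hwS h
      · rintro s (rfl | hs)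
        · exact hzY
        · exact (hcon s hs).2
    · exact h.cut w hw.1 S (hS.trans sdiff_subset) hne hwS (hstep S hS huS _ hb)
  · intro v hv hvu
    refine (h.deg v hv.1 hv.2).trans (rdeg_le_add (k := 0) ∅ (fun w hw ha => .inl ⟨hw, ?_⟩)
      (by simp))
    rintro rfl
    exact hvu (huniq v hv.1 ha.symm)
  · by_contra! hcon
    have h4 := h.deg u hu huz
    have h5 := rdeg_le (G := G) (C := C) (X := X) (Y := Y) (v := u) {z} fun w hw ha => by
      by_contra hwz
      exact ha.ne' (hcon w ⟨hw, hwz⟩)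
    have := ind_le_one (u ∈ X)
    have := ind_le_one (u ∈ Y)
    rw [ncard_singleton] at h5
    omega

theorem ncard_inter_diff_lt [Finite V] {a : V} (ha : a ∈ C) (haX : a ∈ X) :
    (C ∩ (X \ {a})).ncard < (C ∩ X).ncard :=
  ncard_lt_ncard ⟨fun _ hx => ⟨hx.1, hx.2.1⟩, fun h => (h ⟨ha, haX⟩).2.2 rfl⟩

namespace Minimal

/-- A `z` of degree at most two can be deleted; a larger degree permits deleting its root edge
instead. Both contradict minimality. -/
theorem notMem_left [Finite V] (h : Minimal G C X Y z) (hz : z ∈ C) : z ∉ X := by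
  intro hzX
  by_cases h2 : rdeg G C X Y z ≤ 2
  · obtain ⟨u, hu⟩ := h.rooted.delete_exceptional h.tight hz hzX h2
    exact h.not_good ((h.ih (C \ {z}) X Y u
      (ncard_lt_ncard ⟨sdiff_subset, fun h => (h hz).2 rfl⟩) hu
      (h.triFree.mono sdiff_subset subset_rfl)).shift 0 fun n hn => lengths_mono sdiff_subset hn)
  · have hm := h.ih_edge (X \ {z}) Y (by have := ncard_inter_diff_lt hz hzX; omega)
      (h.rooted.delete_edge h.tight hz (by omega) (fun h => absurd rfl h)) h.triFree
    exact h.not_good (hm.shift 0 fun n ⟨a, ha, b, hb, hp⟩ => ⟨a, ha.1, b, hb, hp⟩)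

theorem notMem_right [Finite V] (h : Minimal G C X Y z) (hz : z ∈ C) : z ∉ Y := by
  intro hzY
  by_cases h2 : rdeg G C Y X z ≤ 2
  · obtain ⟨u, hu⟩ := h.rooted.symm.delete_exceptional h.tight.symm hz hzY h2
    exact h.not_good ((h.ih (C \ {z}) X Y u
      (ncard_lt_ncard ⟨sdiff_subset, fun h => (h hz).2 rfl⟩) hu.symm
      (h.triFree.mono sdiff_subset subset_rfl)).shift 0 fun n hn => lengths_mono sdiff_subset hn)
  · have hm := h.ih_edge X (Y \ {z}) (by have := ncard_inter_diff_lt hz hzY; omega)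
      (h.rooted.symm.delete_edge h.tight.symm hz (by omega) (fun h => absurd rfl h)).symm
      (h.triFree.mono subset_rfl sdiff_subset)
    exact h.not_good (hm.shift 0 fun n ⟨a, ha, b, hb, hp⟩ => ⟨a, ha, b, hb.1, hp⟩)

theorem ne_of_mem_left [Finite V] (h : Minimal G C X Y z) {a : V} (ha : a ∈ C) (haX : a ∈ X) :
    a ≠ z := fun haz => h.notMem_left (haz ▸ ha) (haz ▸ haX)

theorem ne_of_mem_right [Finite V] (h : Minimal G C X Y z) {a : V} (ha : a ∈ C) (haY : a ∈ Y) :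
    a ≠ z := fun haz => h.notMem_right (haz ▸ ha) (haz ▸ haY)

/-- At degree five or more the root edge could be deleted without breaking the bound, contrary to
minimality. -/
theorem rdeg_left [Finite V] (h : Minimal G C X Y z) {a : V} (ha : a ∈ C) (haX : a ∈ X) :
    rdeg G C X Y a ≤ 4 := by
  by_contra h5
  have hm := h.ih_edge (X \ {a}) Y (by have := ncard_inter_diff_lt ha haX; omega)
    (h.rooted.delete_edge h.tight ha (by omega) (fun _ => by omega)) h.triFree
  exact h.not_good (hm.shift 0 fun n ⟨a, ha, b, hb, hp⟩ => ⟨a, ha.1, b, hb, hp⟩)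

theorem rdeg_right [Finite V] (h : Minimal G C X Y z) {a : V} (ha : a ∈ C) (haY : a ∈ Y) :
    rdeg G C X Y a ≤ 4 := by
  by_contra h5
  rw [rdeg_symm] at h5
  have hm := h.ih_edge X (Y \ {a}) (by have := ncard_inter_diff_lt ha haY; omega)
    (h.rooted.symm.delete_edge h.tight.symm ha (by omega) (fun _ => by omega)).symm
    (h.triFree.mono subset_rfl sdiff_subset)
  exact h.not_good (hm.shift 0 fun n ⟨a, ha, b, hb, hp⟩ => ⟨a, ha, b, hb.1, hp⟩)

/-- If `a` were the only neighbour of the second root, the rest of `C` could only be `z`, and `a`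
would have degree at most three. -/
theorem exists_ne_right [Finite V] (h : Minimal G C X Y z) {a : V} (ha : a ∈ C) (haY : a ∈ Y) :
    ∃ b ∈ C, b ∈ Y ∧ b ≠ a := by
  by_contra! hcon
  have h1 := h.tight.left (C \ {a}) sdiff_subset a ha (fun h => h.2 rfl) (fun s hs w hw _ => by
      by_cases hwa : w = a
      · exact .inr hwa
      · exact .inl ⟨hw, hwa⟩) (fun s hs hsY => hs.2 (hcon s hs.1 hsY))
  have h2 := rdeg_le (G := G) (C := C) (X := X) (Y := Y) (v := a) {z}
    fun w hw haw => h1 w ⟨hw, haw.ne'⟩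
  have := h.rooted.deg a ha (h.ne_of_mem_right ha haY)
  have := ind_le_one (a ∈ X)
  have := ind_le_one (a ∈ Y)
  rw [ncard_singleton] at h2
  omega

/-! ### Pieces cut off by roots and further vertices -/

/-- A linked piece `Q` of a minimal counterexample together with a further vertex `d`, which may
have low degree. -/
theorem good_insert [Finite V] (h : Minimal G C X Y z) {Q A B : Set V} {d : V}
    (hQ : Linked G Q A B) (hdQ : d ∉ Q) (hne : Q.Nonempty)
    (hdeg : ∀ q ∈ Q, 4 ≤ rdeg G Q A B q + ind (G.Adj q d)) (htf : TriFree G (insert d Q) B)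
    (hlt : (insert d Q).ncard < C.ncard) : Good (lengths G (insert d Q) A B) := by
  -- With two neighbours in `Q`, the vertex `d` can be added without spoiling linkedness and is the
  -- exception.
  by_cases hd : ∃ p ∈ Q, ∃ p' ∈ Q, p ≠ p' ∧ G.Adj d p ∧ G.Adj d p'
  · obtain ⟨p, hp, p', hp', hpp, hdp, hdp'⟩ := hd
    have hpd : p ≠ d := hdp.ne'
    have hpd' : p' ≠ d := hdp'.ne'
    refine h.ih _ A B d hlt ⟨⟨?_, ?_⟩, ?_, ⟨p, .inr hp, hpd⟩⟩ htf
    · intro S hS hne' hb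
      have hSQ : S \ {d} ⊆ Q := fun s hs => (hS hs.1).resolve_left hs.2
      obtain ⟨⟨a, ha, haA⟩, b, hb, hbB⟩ := hQ.closed (S \ {d}) hSQ (by
        by_cases hdS : d ∈ S
        · exact ⟨p, by simpa using hb d hdS p (.inr hp) hdp, hpd⟩
        · obtain ⟨s, hs⟩ := hne'
          exact ⟨s, hs, fun h => hdS (h ▸ hs)⟩) (fun s hs w hw ha => .inl ⟨by
          simpa using hb s hs.1 w (.inr hw) ha, fun h => hdQ (h ▸ hw)⟩)
      exact ⟨⟨a, ha.1, haA⟩, b, hb.1, hbB⟩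
    · intro u hu S hS hne' huS hb
      have hSQ : S \ {d} ⊆ Q := fun s hs => (hS hs.1).resolve_left hs.2
      have hne'' : (S \ {d}).Nonempty := by
        by_cases hdS : d ∈ S
        · by_cases hpu : p = u
          · exact ⟨p', (hb d hdS p' (.inr hp') hdp').resolve_right
              fun h => hpp (hpu.trans h.symm), hpd'⟩
          · exact ⟨p, (hb d hdS p (.inr hp) hdp).resolve_right hpu, hpd⟩
        · obtain ⟨s, hs⟩ := hne'
          exact ⟨s, hs, fun h => hdS (h ▸ hs)⟩
      have hb' : BoundaryIn G Q (S \ {d}) {u} := fun s hs w hw ha => by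
        rcases hb s hs.1 w (.inr hw) ha with h | h
        · exact .inl ⟨h, fun h => hdQ (h ▸ hw)⟩
        · exact .inr h
      rcases hu with rfl | hu
      · obtain ⟨⟨a, ha, haA⟩, -⟩ := hQ.closed _ hSQ hne'' fun s hs w hw ha =>
          .inl ((hb' s hs w hw ha).resolve_right fun h => hdQ (h ▸ hw))
        exact ⟨a, ha.1, .inl haA⟩
      · obtain ⟨s, hs, h⟩ := hQ.cut u hu _ hSQ hne'' (fun h => huS h.1) hb'
        exact ⟨s, hs.1, h⟩
    · intro q hq hqd
      have hqQ := hq.resolve_left hqd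
      refine (hdeg q hqQ).trans ?_
      unfold rdeg
      have : (Q ∩ G.neighborSet q).ncard + ind (G.Adj q d) ≤
          (insert d Q ∩ G.neighborSet q).ncard := by
        by_cases hqd' : G.Adj q d
        · rw [ind_of hqd', ← ncard_insert_of_notMem (a := d) (fun h => hdQ h.1)]
          refine ncard_le_ncard ?_
          rintro w (rfl | hw)
          · exact ⟨.inl rfl, hqd'⟩
          · exact ⟨.inr hw.1, hw.2⟩
        · rw [ind_of_not hqd']
          exact ncard_le_ncard fun w hw => ⟨.inr hw.1, hw.2⟩
      omega
  -- Otherwise `d` is discarded: at most its single neighbour `d'` in `Q` loses degree and becomes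
  -- the exception.
  · obtain ⟨d', hd'⟩ : ∃ d', ∀ p ∈ Q, G.Adj d p → p = d' := by
      by_cases hp : ∃ p ∈ Q, G.Adj d p
      · obtain ⟨p, hp, hdp⟩ := hp
        refine ⟨p, fun p' hp' hdp' => ?_⟩
        by_contra hpp
        exact hd ⟨p', hp', p, hp, hpp, hdp', hdp⟩
      · exact ⟨d, fun p hp' hdp => absurd ⟨p, hp', hdp⟩ hp⟩
    refine (h.ih Q A B d' ((ncard_le_ncard (subset_insert d Q)).trans_lt hlt) ⟨hQ, ?_, ?_⟩
      (htf.mono (subset_insert d Q) subset_rfl)).shift 0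
      fun n hn => lengths_mono (subset_insert d Q) hn
    · intro v hv hvd
      have := hdeg v hv
      rwa [ind_of_not fun h => hvd (hd' v hv h.symm), add_zero] at this
    · by_contra! hcon
      obtain ⟨q, hq⟩ := hne
      have h1 := hdeg q hq
      have h2 := rdeg_le (G := G) (C := Q) (X := A) (Y := B) (v := q) ∅ fun w hw ha =>
        absurd ((hcon q hq).trans (hcon w hw).symm) ha.ne
      have := ind_le_one (q ∈ A)
      have := ind_le_one (q ∈ B)
      have := ind_le_one (G.Adj q d)
      rw [ncard_empty] at h2
      omega

/-- No vertex `d` together with both roots cuts off a piece not containing `z`. -/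
theorem false_of_separator [Finite V] (h : Minimal G C X Y z) {Q : Set V} {d c : V} (hQ : Q ⊆ C)
    (hne : Q.Nonempty) (hd : d ∈ C) (hdQ : d ∉ Q) (hzQ : z ∉ Q) (hb : BoundaryIn G C Q {d})
    (hc : c ∈ C) (hcd : c ≠ d) (hcQ : c ∉ Q) : False := by
  have hsub : insert d Q ⊆ C := insert_subset hd hQ
  have hz : ∀ S ⊆ Q, S.Nonempty → ¬ ∀ s ∈ S, s = z := fun S hS ⟨s, hs⟩ h =>
    hzQ (h s hs ▸ hS hs)
  have key : ∀ S ⊆ Q, ∀ U, BoundaryIn G Q S U → ∀ s ∈ S, ∀ w ∈ C, G.Adj s w →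
      w ∈ S ∨ w ∈ U ∨ w = d := by
    intro S hS U hb' s hs w hw ha
    rcases hb s (hS hs) w hw ha with h | h
    · rcases hb' s hs w h ha with h | h
      · exact .inl h
      · exact .inr (.inl h)
    · exact .inr (.inr h)
  -- As `z` is not in `Q`, tightness makes `Q` linked; `c` only ensures that the new graph is
  -- smaller.
  refine h.not_good ((h.good_insert (Q := Q) (d := d) (A := X) (B := Y)
    ⟨fun S hS hne' hb' => ⟨?_, ?_⟩, ?_⟩ hdQ hne ?_ (h.triFree.mono hsub subset_rfl)
    (ncard_lt_ncard ⟨hsub, fun h => (h hc).elim hcd hcQ⟩)).shift 0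
    fun n hn => lengths_mono hsub hn)
  · by_contra hcon
    refine hz S hS hne' (h.tight.right S (hS.trans hQ) d hd (fun h => hdQ (hS h)) ?_
      fun s hs hsX => hcon ⟨s, hs, hsX⟩)
    intro s hs w hw ha
    rcases key S hS _ hb' s hs w hw ha with h | h | h
    · exact .inl h
    · exact h.elim
    · exact .inr h
  · by_contra hcon
    refine hz S hS hne' (h.tight.left S (hS.trans hQ) d hd (fun h => hdQ (hS h)) ?_
      fun s hs hsX => hcon ⟨s, hs, hsX⟩)
    intro s hs w hw ha
    rcases key S hS _ hb' s hs w hw ha with h | h | h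
    · exact .inl h
    · exact h.elim
    · exact .inr h
  · intro u hu S hS hne' huS hb'
    by_contra! hcon
    exact hz S hS hne' (h.tight.inner S (hS.trans hQ) u (hQ hu) d hd huS (fun h => hdQ (hS h))
      (key S hS _ hb') (fun s hs => (hcon s hs).1) fun s hs => (hcon s hs).2)
  · intro q hq
    have h1 := h.rooted.deg q (hQ hq) fun h => hzQ (h ▸ hq)
    refine h1.trans (rdeg_le_add ({d} ∩ G.neighborSet q) (fun w hw ha => ?_) ?_)
    · rcases hb q hq w hw ha with h | h
      · exact .inl h
      · exact .inr ⟨h, ha⟩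
    · have : ({d} ∩ G.neighborSet q).ncard ≤ ind (G.Adj q d) := by
        by_cases hqd : G.Adj q d
        · rw [ind_of hqd]
          exact ncard_le_one_of fun a ha b hb => ha.1.trans hb.1.symm
        · rw [show {d} ∩ G.neighborSet q = ∅ from ?_]
          · simp
          · rw [eq_empty_iff_forall_notMem]
            rintro w ⟨rfl, hw⟩
            exact hqd hw
      omega

/-- No vertices `d`, `v` together with the first root cut off a piece not containing `z`, if `v`
still reaches the second root. -/
theorem false_of_separator_left [Finite V] (h : Minimal G C X Y z) {Q : Set V} {d v : V}
    (hQ : Q ⊆ C) (hne : Q.Nonempty) (hd : d ∈ C) (hdQ : d ∉ Q) (hzQ : z ∉ Q)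
    (hb : BoundaryIn G C Q {d, v}) (hQY : ∀ q ∈ Q, q ∉ Y)
    (hv : v ∈ reach G (C \ insert d Q) Y) : False := by
  have hsub : insert d Q ⊆ C := insert_subset hd hQ
  have hvC : v ∈ C := (reach_subset hv).1
  have hvd : v ≠ d := fun h => (reach_subset hv).2 (.inl h)
  have hvQ : v ∉ Q := fun h => (reach_subset hv).2 (.inr h)
  have hz : ∀ S ⊆ Q, S.Nonempty → ¬ ∀ s ∈ S, s = z := fun S hS ⟨s, hs⟩ h =>
    hzQ (h s hs ▸ hS hs)
  have key : ∀ S ⊆ Q, ∀ U, BoundaryIn G Q S U → ∀ s ∈ S, ∀ w ∈ C, G.Adj s w →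
      w ∈ S ∨ w ∈ U ∨ w = d ∨ w = v := by
    intro S hS U hb' s hs w hw ha
    rcases hb s (hS hs) w hw ha with h | h
    · rcases hb' s hs w h ha with h | h
      · exact .inl h
      · exact .inr (.inl h)
    · exact .inr (.inr h)
  obtain ⟨y, hy, m, hp⟩ := hv
  -- Here `v` acts as second root, and its path to `Y` is the common tail.
  refine h.not_good ((h.good_insert (Q := Q) (d := d) (A := X) (B := nbrs G {v})
    ⟨fun S hS hne' hb' => ⟨?_, ?_⟩, ?_⟩ hdQ hne ?_ (h.triFree.nbr hsub hvC)
    (ncard_lt_ncard ⟨hsub, fun h => (h hvC).elim hvd hvQ⟩)).shift (m + 1) ?_)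
  · by_contra hcon
    refine hz S hS hne' (h.tight.inner S (hS.trans hQ) d hd v hvC (fun h => hdQ (hS h))
      (fun h => hvQ (hS h)) ?_ (fun s hs hsX => hcon ⟨s, hs, hsX⟩) fun s hs => hQY s (hS hs))
    intro s hs w hw ha
    rcases key S hS _ hb' s hs w hw ha with h | h | h
    · exact .inl h
    · exact h.elim
    · exact .inr h
  · by_contra hcon
    refine hz S hS hne' (h.tight.left S (hS.trans hQ) d hd (fun h => hdQ (hS h)) ?_
      fun s hs => hQY s (hS hs))
    intro s hs w hw ha
    rcases key S hS _ hb' s hs w hw ha with h | h | h | h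
    · exact .inl h
    · exact h.elim
    · exact .inr h
    · exact absurd ⟨s, hs, nbrs_singleton.2 (h ▸ ha.symm)⟩ hcon
  · intro u hu S hS hne' huS hb'
    by_contra! hcon
    refine hz S hS hne' (h.tight.inner S (hS.trans hQ) u (hQ hu) d hd huS (fun h => hdQ (hS h))
      ?_ (fun s hs => (hcon s hs).1) fun s hs => hQY s (hS hs))
    intro s hs w hw ha
    rcases key S hS _ hb' s hs w hw ha with h | h | h | h
    · exact .inl h
    · exact .inr (.inl h)
    · exact .inr (.inr h)
    · exact absurd (nbrs_singleton.2 (h ▸ ha.symm)) (hcon s hs).2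
  · intro q hq
    have h1 := h.rooted.deg q (hQ hq) fun h => hzQ (h ▸ hq)
    refine h1.trans (rdeg_le_add (({d} ∩ G.neighborSet q) ∪ ({v} ∩ G.neighborSet q))
      (fun w hw ha => ?_) ?_)
    · rcases hb q hq w hw ha with h | h | h
      · exact .inl h
      · exact .inr (.inl ⟨h, ha⟩)
      · exact .inr (.inr ⟨h, ha⟩)
    · have key' : ∀ a, ({a} ∩ G.neighborSet q).ncard ≤ ind (G.Adj q a) := by
        intro a
        by_cases hqa : G.Adj q a
        · rw [ind_of hqa]
          exact ncard_le_one_of fun a ha b hb => ha.1.trans hb.1.symm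
        · rw [show {a} ∩ G.neighborSet q = ∅ from ?_]
          · simp
          · rw [eq_empty_iff_forall_notMem]
            rintro w ⟨rfl, hw⟩
            exact hqa hw
      have h2 := ncard_union_le ({d} ∩ G.neighborSet q) ({v} ∩ G.neighborSet q)
      have h3 := key' d
      have h4 := key' v
      have h5 := ind_mono (p := G.Adj q v) (q := q ∈ nbrs G {v}) fun h => nbrs_singleton.2 h.symm
      rw [ind_of_not (hQY q hq)]
      omega
  · rintro n ⟨a, ha, q, hq, hp'⟩
    exact ⟨a, ha, y, hy, hp'.append (nbrs_singleton.1 hq).symm hp disjoint_sdiff_right hsub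
      sdiff_subset⟩

/-! ### The case of unique neighbours in `X` -/

/-- The subcase in which a vertex `v` has two neighbours adjacent to both roots. -/
theorem false_of_two_nbrs_right [Finite V] (h : Minimal G C X Y z) (hYX : ∀ y ∈ C, y ∈ Y → y ∈ X)
    (hN : ∀ a ∈ C, a ∈ Y → ∀ w ∈ C, G.Adj a w → w ∈ X ∨ w = z)
    (hzN : z ∈ C → ∀ a ∈ C, a ∈ Y → G.Adj a z → ∀ w ∈ C, G.Adj z w → w ∈ X)
    {v a b : V} (hv : v ∈ C) (hvX : v ∈ X) (hvY : v ∉ Y) (ha : a ∈ C) (haY : a ∈ Y)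
    (hb : b ∈ C) (hbY : b ∈ Y) (hab : a ≠ b) (hva : G.Adj v a) (hvb : G.Adj v b) : False := by
  -- A further neighbour a' in `X` would give a; v, a; and a', a, v, b, of lengths 0, 1, 3.
  have aux : ∀ a ∈ C, a ∈ Y → ∀ b ∈ C, b ∈ Y → a ≠ b → G.Adj v a → G.Adj v b →
      ∀ a' ∈ C, G.Adj a a' → a' ≠ v → a' = z := by
    intro a ha haY b hb hbY hab hva hvb a' ha' haa' ha'v
    refine (hN a ha haY a' ha' haa').resolve_left fun ha'X => h.not_good ?_
    have h4 : a' ≠ b := fun h' => h.triFree.ind a ha b hb haY hbY (h' ▸ haa')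
    refine Good.of_one_three (m := 0) ⟨a, hYX a ha haY, a, haY, .nil ha⟩
      ⟨v, hvX, a, haY, .one hv ha hva⟩ ⟨a', ha'X, b, hbY, .three ha' ha hv hb haa'.symm hva.symm hvb
        ha'v h4 hab⟩
  -- The two roots and `v` account for degree three only, so the fourth neighbour must be `z`.
  have exz : ∀ a ∈ C, a ∈ Y → ∀ b ∈ C, b ∈ Y → a ≠ b → G.Adj v a → G.Adj v b →
      z ∈ C ∧ G.Adj a z := by
    intro a ha haY b hb hbY hab hva hvb
    by_contra hcon
    have h1 := h.rooted.deg a ha (h.ne_of_mem_right ha haY)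
    have h2 := rdeg_le (G := G) (C := C) (X := X) (Y := Y) (v := a) {v} fun w hw haw => by
      by_contra hwv
      have := aux a ha haY b hb hbY hab hva hvb w hw haw hwv
      subst this
      exact hcon ⟨hw, haw⟩
    have := ind_le_one (a ∈ X)
    have := ind_le_one (a ∈ Y)
    rw [ncard_singleton] at h2
    omega
  obtain ⟨hz, haz⟩ := exz a ha haY b hb hbY hab hva hvb
  obtain ⟨-, hbz⟩ := exz b hb hbY a ha haY hab.symm hvb hva
  have hvz : ¬ G.Adj v z := fun hvz => h.triFree.tri v hv a ha z hz hva haz hvz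
  have n1 := hva.ne
  have n5 : v ≠ z := h.ne_of_mem_left hv hvX
  -- A third neighbour c of `z` lies in `X` and gives a; c, z, a; and c, z, a, v, b, of lengths 0,
  -- 2, 4.
  have hzab : ∀ c ∈ C, G.Adj z c → c = a ∨ c = b := by
    intro c hc hzc
    by_contra! hcon
    obtain ⟨hca, hcb⟩ := hcon
    have hcX := hzN hz a ha haY haz c hc hzc
    have h2 : c ≠ v := fun h' => hvz (h' ▸ hzc.symm)
    exact h.not_good (Good.of_even (m := 0) ⟨a, hYX a ha haY, a, haY, .nil ha⟩
      ⟨c, hcX, a, haY, .two hc hz ha hzc.symm haz.symm hca⟩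
      ⟨c, hcX, b, hbY, .four hc hz ha hv hb hzc.symm haz.symm hva.symm hvb hca h2 hcb n5.symm
        hbz.ne' hab⟩)
  -- Among `a`, `b`, `z` no edge leads outside except to `v`, so `v` and the roots separate the
  -- remaining vertices.
  refine h.false_of_separator (Q := C \ {v, a, b, z}) (d := v) (c := a) sdiff_subset ?_ hv
    (by simp) (by simp) ?_ ha n1.symm (by simp)
  · by_contra hcon
    rw [not_nonempty_iff_eq_empty, sdiff_eq_empty] at hcon
    have h1 := h.rooted.deg v hv n5
    have h2 := rdeg_le (G := G) (C := C) (X := X) (Y := Y) (v := v) {a, b} fun w hw haw => by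
      rcases hcon hw with rfl | rfl | rfl | rfl
      · exact absurd haw (G.irrefl)
      · exact .inl rfl
      · exact .inr rfl
      · exact absurd haw hvz
    have := ind_le_one (v ∈ X)
    have := ncard_pair_le a b
    rw [ind_of_not hvY] at h2
    omega
  · rintro s ⟨hs, hs'⟩ w hw hsw
    simp only [mem_insert_iff, mem_singleton_iff, not_or] at hs'
    by_cases hwv : w = v
    · exact .inr hwv
    refine .inl ⟨hw, ?_⟩
    rintro (rfl | rfl | rfl | rfl)
    · exact hwv rfl
    · exact hs'.2.2.2 (aux w ha haY b hb hbY hab hva hvb s hs hsw.symm hs'.1)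
    · exact hs'.2.2.2 (aux w hb hbY a ha haY hab.symm hvb hva s hs hsw.symm hs'.1)
    · exact (hzab s hs hsw.symm).elim hs'.2.1 hs'.2.2.1

/-- In a minimal counterexample some vertex not adjacent to the first root has two neighbours
adjacent to it. -/
theorem false_of_unique_nbrs [Finite V] (h : Minimal G C X Y z)
    (hB : ∀ v ∈ C, v ∉ X → v ≠ z → ∀ a ∈ C ∩ X, ∀ b ∈ C ∩ X, G.Adj v a → G.Adj v b → a = b) :
    False := by
  obtain ⟨x₀, hx₀C, hx₀X⟩ := h.rooted.inter_left h.rooted.nonempty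
  obtain ⟨y₀, hy₀C, hy₀Y⟩ := h.rooted.inter_right h.rooted.nonempty
  have hlt : ∀ B : Set V, (reach G (C \ X) B).ncard < C.ncard := fun B =>
    ncard_lt_ncard ⟨reach_subset.trans sdiff_subset, fun hC => (reach_subset (hC hx₀C)).2 hx₀X⟩
  -- A vertex of `Y` outside `X` would make the contraction of `X` a nontrivial smaller rooted
  -- graph.
  have hYX : ∀ y ∈ C, y ∈ Y → y ∈ X := by
    intro y hy hyY
    by_contra hyX
    exact h.not_good ((h.ih _ _ _ z (hlt _) (h.rooted.contract_left
      (fun v hv => hB v (reach_subset hv).1 (reach_subset hv).2)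
      ⟨y, mem_reach_of_mem ⟨hy, hyX⟩ hyY, h.ne_of_mem_right hy hyY⟩)
      (h.triFree.mono (reach_subset.trans sdiff_subset) subset_rfl)).shift 1
      fun n hn => lengths_contract_left hn)
  -- Since `a` lies in `X` and `Y`, a component next to it is rooted at `a` and the rest of `X`;
  -- minimality leaves only the component `{z}`.
  have hW : ∀ a ∈ C, a ∈ Y → ∀ w ∈ C, w ∉ X → G.Adj a w → ∀ v ∈ reach G (C \ X) {w}, v = z := by
    intro a ha haY w hw hwX haw v hv
    by_contra hvz
    exact h.not_good ((h.ih _ _ _ z (hlt _) (h.rooted.component ha (hYX a ha haY)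
      (mem_reach_of_mem ⟨hw, hwX⟩ rfl) haw
      (fun v hv => hB v (reach_subset hv).1 (reach_subset hv).2)
      (fun v hv hvY => (reach_subset hv).2 (hYX v (reach_subset hv).1 hvY)) ⟨v, hv, hvz⟩)
      (h.triFree.nbr (reach_subset.trans sdiff_subset) ha)).shift 2
      fun n hn => lengths_component ha (hYX a ha haY) haY hn)
  have hN : ∀ a ∈ C, a ∈ Y → ∀ w ∈ C, G.Adj a w → w ∈ X ∨ w = z := by
    intro a ha haY w hw haw
    by_contra! hcon
    exact hcon.2 (hW a ha haY w hw hcon.1 haw w (mem_reach_of_mem ⟨hw, hcon.1⟩ rfl))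
  have hzN : z ∈ C → ∀ a ∈ C, a ∈ Y → G.Adj a z → ∀ w ∈ C, G.Adj z w → w ∈ X := by
    intro hz a ha haY haz w hw hzw
    by_contra hwX
    have hzX := h.notMem_left hz
    exact hzw.ne' (hW a ha haY z hz hzX haz w (mem_reach_of_adj ⟨hw, hwX⟩
      (mem_reach_of_mem ⟨hz, hzX⟩ rfl) hzw.symm))
  by_cases hβ : ∃ v ∈ C, v ∉ Y ∧ v ≠ z ∧ ∃ a ∈ C ∩ Y, ∃ b ∈ C ∩ Y, a ≠ b ∧ G.Adj v a ∧ G.Adj v b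
  · obtain ⟨v, hv, hvY, hvz, a, ha, b, hb, hab, hva, hvb⟩ := hβ
    have hvX : v ∈ X := by
      by_contra hvX
      exact hab (hB v hv hvX hvz a ⟨ha.1, hYX a ha.1 ha.2⟩ b ⟨hb.1, hYX b hb.1 hb.2⟩ hva hvb)
    exact h.false_of_two_nbrs_right hYX hN hzN hv hvX hvY ha.1 ha.2 hb.1 hb.2 hab hva hvb
  have hβ' : ∀ v ∈ reach G (C \ Y) X, v ≠ z → ∀ a ∈ C ∩ Y, ∀ b ∈ C ∩ Y,
      G.Adj v a → G.Adj v b → a = b := by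
    intro v hv hvz a ha b hb hva hvb
    by_contra hab
    exact hβ ⟨v, (reach_subset hv).1, (reach_subset hv).2, hvz, a, ha, b, hb, hab, hva, hvb⟩
  obtain ⟨c, hc, hcX, hyc⟩ : ∃ c ∈ C, c ∈ X ∧ G.Adj y₀ c := by
    by_contra! hcon
    have h1 := h.rooted.deg y₀ hy₀C (h.ne_of_mem_right hy₀C hy₀Y)
    have h2 := rdeg_le (G := G) (C := C) (X := X) (Y := Y) (v := y₀) {z} fun w hw haw =>
      (hN y₀ hy₀C hy₀Y w hw haw).resolve_left fun hwX => hcon w hw hwX haw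
    have := ind_le_one (y₀ ∈ X)
    have := ind_le_one (y₀ ∈ Y)
    rw [ncard_singleton] at h2
    omega
  have hcY : c ∉ Y := fun hcY => h.triFree.ind y₀ hy₀C c hc hy₀Y hcY hyc
  -- The paths a; p, a; and a, p, q, b have lengths 0, 1, 3. This makes the contracted neighbourhood
  -- of the second root independent.
  have hα : ∀ p ∈ C, ∀ q ∈ C, ∀ a ∈ C, ∀ b ∈ C, p ∉ Y → q ∉ Y → a ∈ Y → b ∈ Y → G.Adj p q →
      G.Adj a p → G.Adj b q → p ∈ X → False := by
    intro p hp q hq a ha b hb hpY hqY haY hbY hpq hap hbq hpX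
    have h4 : a ≠ q := fun h => hqY (h ▸ haY)
    have h5 : b ≠ p := fun h => hpY (h ▸ hbY)
    have h6 : a ≠ b := by
      rintro rfl
      exact h.triFree.tri a ha p hp q hq hap hpq hbq
    exact h.not_good (Good.of_one_three (m := 0) ⟨a, hYX a ha haY, a, haY, .nil ha⟩
      ⟨p, hpX, a, haY, .one hp ha hap.symm⟩
      ⟨a, hYX a ha haY, b, hbY, .three ha hp hq hb hap hpq hbq.symm h4 h6 h5.symm⟩)
  refine h.not_good ((h.ih (reach G (C \ Y) X) X (nbrs G (C ∩ Y)) z ?_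
    (h.rooted.symm.contract_left hβ' ⟨c, mem_reach_of_mem ⟨hc, hcY⟩ hcX,
      h.ne_of_mem_left hc hcX⟩).symm ⟨?_, ?_⟩).shift 1 fun n hn => lengths_contract_right hn)
  · exact ncard_lt_ncard ⟨reach_subset.trans sdiff_subset,
      fun hC => (reach_subset (hC hy₀C)).2 hy₀Y⟩
  · exact (h.triFree.mono (reach_subset.trans sdiff_subset) subset_rfl).tri
  · rintro p hp q hq ⟨a, ha, hap⟩ ⟨b, hb, hbq⟩ hpq
    have hp' := reach_subset hp
    have hq' := reach_subset hq
    rcases hN a ha.1 ha.2 p hp'.1 hap with hpX | hpz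
    · exact hα p hp'.1 q hq'.1 a ha.1 b hb.1 hp'.2 hq'.2 ha.2 hb.2 hpq hap hbq hpX
    · rcases hN b hb.1 hb.2 q hq'.1 hbq with hqX | hqz
      · exact hα q hq'.1 p hp'.1 b hb.1 a ha.1 hq'.2 hp'.2 hb.2 ha.2 hpq.symm hbq hap hqX
      · exact hpq.ne (hpz.trans hqz.symm)

end Minimal

/-! ### Common neighbours of two vertices -/

theorem exists_ne_of_two_le_ncard [Finite V] {S : Set V} (h : 2 ≤ S.ncard) (a : V) :
    ∃ c ∈ S, c ≠ a := by
  by_contra! hcon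
  have := ncard_le_one_of fun b hb c hc => (hcon b hb).trans (hcon c hc).symm
  omega

theorem exists_ne_ne_of_three_le_ncard [Finite V] {S : Set V} (h : 3 ≤ S.ncard) (a b : V) :
    ∃ c ∈ S, c ≠ a ∧ c ≠ b := by
  by_contra! hcon
  have h1 : S ⊆ {a, b} := fun c hc => by
    by_cases hca : c = a
    · exact .inl hca
    · exact .inr (hcon c hc hca)
  have := (ncard_le_ncard h1).trans (ncard_pair_le a b)
  omega

theorem boundary_of_reach {C K B S U : Set V} (hS : S ⊆ reach G (C \ K) B)
    (hb : BoundaryIn G (reach G (C \ K) B) S U) {s w : V} (hs : s ∈ S) (hw : w ∈ C)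
    (ha : G.Adj s w) : w ∈ S ∨ w ∈ U ∨ w ∈ K := by
  by_cases hwK : w ∈ K
  · exact .inr (.inr hwK)
  · rcases hb s hs w (mem_reach_of_adj ⟨hw, hwK⟩ (hS hs) ha.symm) ha with h | h
    · exact .inl h
    · exact .inr (.inl h)

/-- Adjacent vertices outside `K` lie in the same components of `C \ K`. -/
theorem mem_or_mem_of_reach {C K B : Set V} {v w : V} (hv : v ∈ reach G (C \ K) B) (hw : w ∈ C)
    (ha : G.Adj v w) : w ∈ reach G (C \ K) B ∨ w ∈ K := by
  by_cases hwK : w ∈ K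
  · exact .inr hwK
  · exact .inl (mem_reach_of_adj ⟨hw, hwK⟩ hv ha.symm)

theorem ncard_le_ind_of_subsingleton {S : Set V} {p : Prop} (h : ∀ a ∈ S, ∀ b ∈ S, a = b)
    (hp : S.Nonempty → p) : S.ncard ≤ ind p := by
  rcases S.eq_empty_or_nonempty with rfl | hS
  · simp
  · rw [ind_of (hp hS)]
    exact ncard_le_one_of h

namespace Minimal

theorem false_of_boundary_left [Finite V] (h : Minimal G C X Y z) {S : Set V} {u : V} (hS : S ⊆ C)
    (hne : S.Nonempty) (hu : u ∈ C) (huS : u ∉ S) (hb : BoundaryIn G C S {u})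
    (hY : ∀ s ∈ S, s ∉ Y) : False := by
  obtain ⟨s, hs, h' | h'⟩ := h.rooted.cut u hu S hS hne huS hb
  · exact h.ne_of_mem_left (hS hs) h' (h.tight.left S hS u hu huS hb hY s hs)
  · exact hY s hs h'

/-- If three common neighbours of `d` and `e` are adjacent to the first root, then the rest of the
graph does not reach the second root. -/
theorem reach_eq_empty [Finite V] (h : Minimal G C X Y z) {d e : V} (hd : d ∈ C)
    (he : e ∈ C) (hde : d ≠ e) {T : Set V}
    (hT : ∀ t, t ∈ T ↔ t ∈ C ∧ t ∈ X ∧ G.Adj d t ∧ G.Adj e t) (h3 : 3 ≤ T.ncard) :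
    (∀ t ∈ T, t ∉ Y) ∧ reach G (C \ (insert d (insert e T))) Y = ∅ := by
  have hdT : d ∉ T := fun h => ((hT d).1 h).2.2.1.ne rfl
  have heT : e ∉ T := fun h => ((hT e).1 h).2.2.2.ne rfl
  have hDK := reach_subset (G := G) (C := C \ (insert d (insert e T))) (B := Y)
  have hDC := hDK.trans sdiff_subset
  -- A tail of length m from t can be preceded by nothing, by t₁, d, or by t₁, d, t₂, e, giving m, m
  -- + 2, m + 4.
  have hatt : ∀ t ∈ T, ¬ (t ∈ Y ∨ ∃ r ∈ reach G (C \ (insert d (insert e T))) Y, G.Adj t r) := by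
    intro t ht hat
    have htD : t ∉ C \ (insert d (insert e T)) := fun h => h.2 (.inr (.inr ht))
    have hdD : d ∉ insert t (C \ (insert d (insert e T))) := by
      rintro (rfl | h)
      · exact hdT ht
      · exact h.2 (.inl rfl)
    have heD : e ∉ insert t (C \ (insert d (insert e T))) := by
      rintro (rfl | h)
      · exact heT ht
      · exact h.2 (.inr (.inl rfl))
    obtain ⟨y, hy, m, hp⟩ := PathIn.of_attached hat htD
    obtain ⟨t₁, ht₁, h1, -⟩ := exists_ne_ne_of_three_le_ncard h3 t t
    obtain ⟨t₂, ht₂, h2, h12⟩ := exists_ne_ne_of_three_le_ncard h3 t t₁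
    have hT' := (hT t).1 ht
    have hT₁ := (hT t₁).1 ht₁
    have hT₂ := (hT t₂).1 ht₂
    have hsub : insert t (C \ (insert d (insert e T))) ⊆ C := insert_subset hT'.1 sdiff_subset
    have h1D : ∀ s ∈ T, s ≠ t → s ∉ insert t (C \ (insert d (insert e T))) := by
      rintro s hs hst (rfl | h)
      · exact hst rfl
      · exact h.2 (.inr (.inr hs))
    have hp2 : PathIn G (C \ {t₁, d}) t₂ y (m + 2) := hp.cons₂ (fun x hx => ⟨hsub hx, by
      rintro (rfl | rfl)
      · exact h1D _ ht₁ h1 hx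
      · exact hdD hx⟩) ⟨hT₂.1, by
      rintro (rfl | rfl)
      · exact h12 rfl
      · exact hdT ht₂⟩ (h1D t₂ ht₂ h2) ⟨he, by
      rintro (rfl | rfl)
      · exact heT ht₁
      · exact hde rfl⟩ heD hT₂.2.2.2.symm hT'.2.2.2
    exact h.not_good (Good.of_even (m := m) ⟨t, hT'.2.1, y, hy, hp.mono hsub⟩
      ⟨t₁, hT₁.2.1, y, hy, hp.cons₂ hsub hT₁.1 (h1D t₁ ht₁ h1) hd hdD hT₁.2.2.1.symm hT'.2.2.1⟩
      ⟨t₁, hT₁.2.1, y, hy, hp2.cons₂ sdiff_subset hT₁.1 (by simp) hd (by simp)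
        hT₁.2.2.1.symm hT₂.2.2.1⟩)
  refine ⟨fun t ht htY => hatt t ht (.inl htY), ?_⟩
  by_contra! hne
  have hTD : ∀ s ∈ reach G (C \ (insert d (insert e T))) Y, ∀ w ∈ T, ¬ G.Adj s w :=
    fun s hs w hw ha => hatt w hw (.inr ⟨s, hs, ha.symm⟩)
  have key : ∀ S ⊆ reach G (C \ (insert d (insert e T))) Y, ∀ U,
      BoundaryIn G (reach G (C \ (insert d (insert e T))) Y) S U →
      (∀ s ∈ S, s ∉ nbrs G {d, e}) → BoundaryIn G C S U := by
    intro S hS U hb hn s hs w hw ha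
    rcases boundary_of_reach hS hb hs hw ha with h | h | h | h | h
    · exact .inl h
    · exact .inr h
    · exact absurd ⟨w, .inl h, ha.symm⟩ (hn s hs)
    · exact absurd ⟨w, .inr h, ha.symm⟩ (hn s hs)
    · exact absurd ha (hTD s (hS hs) w h)
  -- The first root absorbs `d`, `e` and `T`. A vertex adjacent to both `d` and `e` is not in `X`,
  -- as it would lie in `T`; so each vertex loses at most one degree.
  have hR : Rooted G 3 (reach G (C \ (insert d (insert e T))) Y) (nbrs G {d, e}) Y z := by
    refine ⟨⟨fun S hS hSne hb => ⟨?_, closed_reach_inter hSne hS hb⟩, ?_⟩, ?_, ?_⟩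
    · by_contra hcon
      have := h.tight.conn S (hS.trans hDC) hSne
        (key S hS _ hb fun s hs hn => hcon ⟨s, hs, hn⟩)
      exact (hDK (hS (this.symm ▸ hd : d ∈ S))).2 (.inl rfl)
    · intro u hu S hS hSne huS hb
      by_contra! hcon
      exact h.false_of_boundary_left (hS.trans hDC) hSne (hDC hu) huS
        (key S hS _ hb fun s hs => (hcon s hs).1) fun s hs => (hcon s hs).2
    · intro v hv hvz
      have h4 := h.rooted.deg v (hDC hv) hvz
      have h5 := rdeg_le_add (G := G) (C := C) (D := reach G (C \ (insert d (insert e T))) Y)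
        (X := X) (Y := Y) (A := nbrs G {d, e}) (B := Y) (v := v) (k := 1)
        ({d, e} ∩ G.neighborSet v) (fun w hw ha => by
          rcases mem_or_mem_of_reach hv hw ha with h | h | h | h
          · exact .inl h
          · exact .inr ⟨.inl h, ha⟩
          · exact .inr ⟨.inr h, ha⟩
          · exact absurd ha (hTD v hv w h)) (by
          by_cases hde' : G.Adj v d ∧ G.Adj v e
          · have hvX : v ∉ X := fun hvX => (hDK hv).2 (.inr (.inr ((hT v).2
              ⟨hDC hv, hvX, hde'.1.symm, hde'.2.symm⟩)))
            have := (ncard_le_ncard (inter_subset_left (s := {d, e}) (t := G.neighborSet v))).trans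
              (ncard_pair_le d e)
            rw [ind_of_not hvX, ind_of (show v ∈ nbrs G {d, e} from ⟨d, .inl rfl, hde'.1.symm⟩)]
            omega
          · have := ncard_le_ind_of_subsingleton (S := {d, e} ∩ G.neighborSet v)
              (p := v ∈ nbrs G {d, e}) (by
                rintro a ⟨rfl | rfl, ha⟩ b ⟨rfl | rfl, hb⟩
                · rfl
                · exact absurd ⟨ha, hb⟩ hde'
                · exact absurd ⟨hb, ha⟩ hde'
                · rfl) (by
                rintro ⟨a, ha, ha'⟩
                exact ⟨a, ha, (G.adj_symm ha')⟩)
            have := ind_le_one (v ∈ X)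
            omega)
      omega
    · obtain ⟨v, hv, hvY⟩ := closed_reach_inter hne subset_rfl fun s hs w hw _ => .inl hw
      exact ⟨v, hv, h.ne_of_mem_right (hDC hv) hvY⟩
  -- The starts t, a and t', b, t, a differ in length by two.
  have hpre : ∀ D : Set V, D ⊆ C → (∀ t ∈ T, t ∉ D) → ∀ a b, a ∈ C → b ∈ C → a ≠ b →
      (∀ t ∈ T, G.Adj a t ∧ G.Adj b t) → a ∉ D → b ∉ D → ∀ p y n, y ∈ Y → PathIn G D p y n →
      G.Adj a p → n + 2 ∈ lengths G C X Y ∧ n + 4 ∈ lengths G C X Y := by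
    intro D hD hTD a b ha hb hab hTab haD hbD p y n hy hp hap
    obtain ⟨t, ht, -, -⟩ := exists_ne_ne_of_three_le_ncard h3 d d
    obtain ⟨t', ht', htt, -⟩ := exists_ne_ne_of_three_le_ncard h3 t t
    have hTt := (hT t).1 ht
    have hTt' := (hT t').1 ht'
    have h1 : PathIn G (insert t (insert a D)) t y (n + 2) :=
      hp.cons₂ (fun x hx => .inr (.inr hx)) (.inl rfl) (hTD t ht) (.inr (.inl rfl)) haD
        (hTab t ht).1.symm hap
    refine ⟨⟨t, hTt.2.1, y, hy, h1.mono (insert_subset hTt.1 (insert_subset ha hD))⟩,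
      t', hTt'.2.1, y, hy, h1.cons₂ (insert_subset hTt.1 (insert_subset ha hD)) hTt'.1 ?_ hb ?_
      (hTab t' ht').2.symm (hTab t ht).2⟩
    · rintro (h | h | h)
      · exact htt h
      · exact (hTab t' ht').1.ne h.symm
      · exact hTD t' ht' h
    · rintro (h | h | h)
      · exact (hTab t ht).2.ne h
      · exact hab h.symm
      · exact hbD h
  have hlen : ∀ n ∈ lengths G (reach G (C \ (insert d (insert e T))) Y) (nbrs G {d, e}) Y,
      n + 2 ∈ lengths G C X Y ∧ n + 4 ∈ lengths G C X Y := by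
    rintro n ⟨p, ⟨a, rfl | rfl, hap⟩, y, hy, hp⟩
    · exact hpre _ hDC (fun t ht h => (hDK h).2 (.inr (.inr ht))) a e hd he hde
        (fun t ht => ((hT t).1 ht).2.2) (fun h => (hDK h).2 (.inl rfl))
        (fun h => (hDK h).2 (.inr (.inl rfl))) p y n hy hp hap
    · exact hpre _ hDC (fun t ht h => (hDK h).2 (.inr (.inr ht))) a d he hd hde.symm
        (fun t ht => ((hT t).1 ht).2.2.symm) (fun h => (hDK h).2 (.inr (.inl rfl)))
        (fun h => (hDK h).2 (.inl rfl)) p y n hy hp hap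
  exact h.not_good (hR.hasPair.good 2 (fun n hn => (hlen n hn).1) fun n hn => (hlen n hn).2)

/-- No three common neighbours of `d` and `e` are adjacent to the first root. -/
theorem ncard_common_nbrs_le [Finite V] (h : Minimal G C X Y z) {d e : V} (hd : d ∈ C)
    (he : e ∈ C) (hde : d ≠ e) {T : Set V}
    (hT : ∀ t, t ∈ T ↔ t ∈ C ∧ t ∈ X ∧ G.Adj d t ∧ G.Adj e t) : T.ncard ≤ 2 := by
  by_contra! h3
  replace h3 : 3 ≤ T.ncard := h3
  obtain ⟨hTY, hD⟩ := h.reach_eq_empty hd he hde hT h3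
  have hdT : d ∉ T := fun h => ((hT d).1 h).2.2.1.ne rfl
  have heT : e ∉ T := fun h => ((hT e).1 h).2.2.2.ne rfl
  have hYde : ∀ y ∈ C, y ∈ Y → y = d ∨ y = e := by
    intro y hy hyY
    by_contra! hcon
    refine (hD ▸ mem_reach_of_mem (G := G) (C := C \ (insert d (insert e T))) (B := Y)
      ⟨hy, ?_⟩ hyY : y ∈ (∅ : Set V))
    rintro (h | h | h)
    · exact hcon.1 h
    · exact hcon.2 h
    · exact hTY y h hyY
  obtain ⟨y₀, hy₀C, hy₀Y⟩ := h.rooted.inter_right h.rooted.nonempty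
  obtain ⟨y₁, hy₁C, hy₁Y, hy₁⟩ := h.exists_ne_right hy₀C hy₀Y
  have hY : d ∈ Y ∧ e ∈ Y := by
    rcases hYde y₀ hy₀C hy₀Y with rfl | rfl <;> rcases hYde y₁ hy₁C hy₁Y with rfl | rfl
    · exact absurd rfl hy₁
    · exact ⟨hy₀Y, hy₁Y⟩
    · exact ⟨hy₁Y, hy₀Y⟩
    · exact absurd rfl hy₁
  -- A vertex of `Y` has at most three inner neighbours, and `T` already supplies them.
  have hN : ∀ a ∈ C, a ∈ Y → (∀ t ∈ T, G.Adj a t) → ∀ w ∈ C, G.Adj a w → w ∈ T := by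
    intro a ha haY haT w hw haw
    have h1 := h.rdeg_right ha haY
    unfold rdeg at h1
    rw [ind_of haY] at h1
    have h2 := eq_of_subset_of_ncard_le (s := T) (t := C ∩ G.neighborSet a)
      (fun t ht => ⟨((hT t).1 ht).1, haT t ht⟩) (by omega)
    rw [h2]
    exact ⟨hw, haw⟩
  have hNd := hN d hd hY.1 fun t ht => ((hT t).1 ht).2.2.1
  have hNe := hN e he hY.2 fun t ht => ((hT t).1 ht).2.2.2
  -- Otherwise t, d; t, d, t', e; and s, d, t, w, t', e have lengths 1, 3, 5.
  have huniq : ∀ w ∈ C \ (insert d (insert e T)), ∀ t ∈ T, ∀ t' ∈ T, G.Adj w t → G.Adj w t' →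
      t = t' := by
    intro w hw t ht t' ht' hwt hwt'
    by_contra htt
    obtain ⟨s, hs, hst, hst'⟩ := exists_ne_ne_of_three_le_ncard h3 t t'
    have h1 := (hT t).1 ht
    have h2 := (hT t').1 ht'
    have h3 := (hT s).1 hs
    have hwd : d ≠ w := fun h => hw.2 (.inl h.symm)
    have hwe : w ≠ e := fun h => hw.2 (.inr (.inl h))
    have hsw : s ≠ w := fun h => hw.2 (.inr (.inr (h ▸ hs)))
    refine h.not_good (Good.of_even (m := 1) ⟨t, h1.2.1, d, hY.1, .one h1.1 hd h1.2.2.1.symm⟩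
      ⟨t, h1.2.1, e, hY.2, .three h1.1 hd h2.1 he h1.2.2.1.symm h2.2.2.1 h2.2.2.2.symm htt
        h1.2.2.2.ne' hde⟩ ⟨s, h3.2.1, e, hY.2, .cons h3.1 h3.2.2.1.symm ?_⟩)
    exact .four ⟨hd, h3.2.2.1.ne⟩ ⟨h1.1, hst.symm⟩ ⟨hw.1, hsw.symm⟩ ⟨h2.1, hst'.symm⟩
      ⟨he, h3.2.2.2.ne⟩ h1.2.2.1 hwt.symm hwt' h2.2.2.2.symm hwd h2.2.2.1.ne hde htt
      h1.2.2.2.ne' hwe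
  obtain ⟨t₀, ht₀, -, -⟩ := exists_ne_ne_of_three_le_ncard h3 d d
  have hTt₀ := (hT t₀).1 ht₀
  obtain ⟨w₀, hw₀, htw₀⟩ : ∃ w ∈ C \ (insert d (insert e T)), G.Adj t₀ w := by
    by_contra! hcon
    have h1 := h.rooted.deg t₀ hTt₀.1 (h.ne_of_mem_left hTt₀.1 hTt₀.2.1)
    have h2 := rdeg_le (G := G) (C := C) (X := X) (Y := Y) (v := t₀) {d, e} fun w hw haw => by
      by_contra hwK
      refine hcon w ⟨hw, ?_⟩ haw
      rintro (h' | h' | h')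
      · exact hwK (.inl h')
      · exact hwK (.inr h')
      · exact h.triFree.tri d hd t₀ hTt₀.1 w hw hTt₀.2.2.1 haw ((hT w).1 h').2.2.1
    have := ncard_pair_le d e
    have := ind_le_one (t₀ ∈ X)
    rw [ind_of_not (hTY t₀ ht₀)] at h2
    omega
  have hWK := reach_subset (G := G) (C := C \ (insert d (insert e T))) (B := {w₀})
  have hWC := hWK.trans sdiff_subset
  have hw₀W := mem_reach_of_mem (G := G) (B := {w₀}) hw₀ rfl
  have hWY : ∀ s ∈ reach G (C \ (insert d (insert e T))) {w₀}, s ∉ Y := by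
    intro s hs hsY
    rcases hYde s (hWC hs) hsY with h | h
    · exact (hWK hs).2 (.inl h)
    · exact (hWK hs).2 (.inr (.inl h))
  have key : ∀ S ⊆ reach G (C \ (insert d (insert e T))) {w₀}, ∀ U,
      BoundaryIn G (reach G (C \ (insert d (insert e T))) {w₀}) S U →
      ∀ s ∈ S, ∀ w ∈ C, G.Adj s w → w ∈ S ∨ w ∈ U ∨ w ∈ T := by
    intro S hS U hb s hs w hw ha
    rcases boundary_of_reach hS hb hs hw ha with h | h | rfl | rfl | h
    · exact .inl h
    · exact .inr (.inl h)
    · exact absurd (hNd s (hWC (hS hs)) ha.symm) fun h => (hWK (hS hs)).2 (.inr (.inr h))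
    · exact absurd (hNe s (hWC (hS hs)) ha.symm) fun h => (hWK (hS hs)).2 (.inr (.inr h))
    · exact .inr (.inr h)
  have hleft : ∃ s ∈ reach G (C \ (insert d (insert e T))) {w₀}, s ∈ nbrs G (T \ {t₀}) := by
    by_contra! hcon
    refine h.false_of_boundary_left hWC ⟨w₀, hw₀W⟩ hTt₀.1
      (fun h => (hWK h).2 (.inr (.inr ht₀))) (fun s hs w hw ha => ?_) hWY
    rcases key _ subset_rfl ∅ (fun s hs w hw _ => .inl hw) s hs w hw ha with h | h | h
    · exact .inl h
    · exact h.elim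
    · refine .inr ?_
      by_contra hwt
      exact hcon s hs ⟨w, ⟨h, hwt⟩, ha.symm⟩
  -- The lone possible neighbour in `T` is repaid by a root edge, so only an edge to the old first
  -- root can be lost.
  have hR : Rooted G 3 (reach G (C \ (insert d (insert e T))) {w₀}) (nbrs G (T \ {t₀}))
      (nbrs G {t₀}) z := by
    refine ⟨⟨fun S hS hSne hb => ?_, ?_⟩, ?_, ?_⟩
    · rw [eq_of_closed_reach hSne hS hb]
      exact ⟨hleft, w₀, hw₀W, nbrs_singleton.2 htw₀⟩
    · intro u hu S hS hSne huS hb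
      by_contra! hcon
      refine h.false_of_boundary_left (hS.trans hWC) hSne (hWC hu) huS (fun s hs w hw ha => ?_)
        fun s hs => hWY s (hS hs)
      rcases key S hS _ hb s hs w hw ha with h | h | h
      · exact .inl h
      · exact .inr h
      · exfalso
        by_cases hwt : w = t₀
        · exact (hcon s hs).2 (nbrs_singleton.2 (hwt ▸ ha.symm))
        · exact (hcon s hs).1 ⟨w, ⟨h, hwt⟩, ha.symm⟩
    · intro v hv hvz
      have h4 := h.rooted.deg v (hWC hv) hvz
      have h5 := rdeg_le_add (G := G) (C := C) (D := reach G (C \ (insert d (insert e T))) {w₀})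
        (X := X) (Y := Y) (A := nbrs G (T \ {t₀})) (B := nbrs G {t₀}) (v := v) (k := 1)
        (T ∩ G.neighborSet v) (fun w hw ha => by
          rcases key _ subset_rfl ∅ (fun s hs w hw _ => .inl hw) v hv w hw ha with h | h | h
          · exact .inl h
          · exact h.elim
          · exact .inr ⟨h, ha⟩) (by
          rw [ind_of_not (hWY v hv)]
          have h6 : (T ∩ G.neighborSet v).ncard ≤ ind (v ∈ nbrs G (T \ {t₀}) ∨ v ∈ nbrs G {t₀}) :=
            ncard_le_ind_of_subsingleton
              (fun a ha b hb => huniq v (hWK hv) a ha.1 b hb.1 ha.2 hb.2) (by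
              rintro ⟨a, ha, hva⟩
              by_cases hat : a = t₀
              · exact .inr (nbrs_singleton.2 (hat ▸ G.adj_symm hva))
              · exact .inl ⟨a, ⟨ha, hat⟩, G.adj_symm hva⟩)
          have h7 : ind (v ∈ nbrs G (T \ {t₀}) ∨ v ∈ nbrs G {t₀}) ≤
              ind (v ∈ nbrs G (T \ {t₀})) + ind (v ∈ nbrs G {t₀}) := by
            unfold ind; split_ifs <;> first | omega | tauto
          have := ind_le_one (v ∈ X)
          omega)
      omega
    · by_contra! hcon
      obtain ⟨s, hs, t, ht, hts⟩ := hleft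
      have := (hcon s hs).trans (hcon w₀ hw₀W).symm
      subst this
      exact ht.2 (huniq s (hWK hs) t ht.1 t₀ ht₀ hts.symm htw₀.symm)
  -- The path enters from t and leaves through t₀ to d; starting with s, e, t instead adds two.
  have hlen : ∀ n ∈ lengths G (reach G (C \ (insert d (insert e T))) {w₀}) (nbrs G (T \ {t₀}))
      (nbrs G {t₀}), n + 3 ∈ lengths G C X Y ∧ n + 5 ∈ lengths G C X Y := by
    rintro n ⟨p, ⟨t, ht, htp⟩, q, hq, hp⟩
    obtain ⟨s, hs, hst, hst₀⟩ := exists_ne_ne_of_three_le_ncard h3 t t₀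
    have hWT : ∀ a ∈ T, a ∉ reach G (C \ (insert d (insert e T))) {w₀} :=
      fun a ha h => (hWK h).2 (.inr (.inr ha))
    have hdW : d ∉ reach G (C \ (insert d (insert e T))) {w₀} := fun h => (hWK h).2 (.inl rfl)
    have heW : e ∉ reach G (C \ (insert d (insert e T))) {w₀} :=
      fun h => (hWK h).2 (.inr (.inl rfl))
    have hTt := (hT t).1 ht.1
    have hTs := (hT s).1 hs
    have h1 : PathIn G (insert t₀ (reach G (C \ (insert d (insert e T))) {w₀})) p t₀ (n + 1) :=
      hp.snoc (nbrs_singleton.1 hq).symm (hWT t₀ ht₀) (subset_insert _ _) (.inl rfl)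
    have h2 : PathIn G (insert d (insert t₀ (reach G (C \ (insert d (insert e T))) {w₀}))) p d
        (n + 2) := h1.snoc hTt₀.2.2.1.symm (by
          rintro (h | h)
          · exact hTt₀.2.2.1.ne h
          · exact hdW h) (subset_insert _ _) (.inl rfl)
    have hsub := insert_subset hd (insert_subset hTt₀.1 hWC)
    have hmem : ∀ a ∈ T, a ≠ t₀ →
        a ∉ insert d (insert t₀ (reach G (C \ (insert d (insert e T))) {w₀})) := by
      rintro a ha hat (h | h | h)
      · exact hdT (h ▸ ha)
      · exact hat h
      · exact hWT a ha h
    have h3 : PathIn G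
        (insert t (insert d (insert t₀ (reach G (C \ (insert d (insert e T))) {w₀})))) t d (n + 3) :=
      h2.cons₁ (subset_insert _ _) (.inl rfl) (hmem t ht.1 ht.2) htp
    refine ⟨⟨t, hTt.2.1, d, hY.1, h3.mono (insert_subset hTt.1 hsub)⟩, s, hTs.2.1, d, hY.1,
      h3.cons₂ (insert_subset hTt.1 hsub) hTs.1 ?_ he ?_ hTs.2.2.2.symm hTt.2.2.2⟩
    · rintro (h | h)
      · exact hst h
      · exact hmem s hs hst₀ h
    · rintro (h | h | h | h)
      · exact heT (h ▸ ht.1)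
      · exact hde h.symm
      · exact heT (h ▸ ht₀)
      · exact heW h
  exact h.not_good (hR.hasPair.good 3 (fun n hn => (hlen n hn).1) fun n hn => (hlen n hn).2)

end Minimal

/-! ### Removing an obstacle around the exceptional vertex -/

/-- If all obstacles to being linked contain the exceptional vertex, then a largest one can be
removed, at the cost of a new exceptional vertex. -/
theorem rooted_or_exists_rooted_diff [Finite V] {k : ℕ} {D A B : Set V}
    (closed : ∀ S ⊆ D, S.Nonempty → BoundaryIn G D S ∅ → (S ∩ A).Nonempty ∧ (S ∩ B).Nonempty)
    (hz : ∀ u ∈ D, ∀ S ⊆ D, S.Nonempty → u ∉ S → BoundaryIn G D S {u} →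
      (∀ s ∈ S, s ∉ A ∧ s ∉ B) → z ∈ S)
    (deg : ∀ v ∈ D, v ≠ z → k ≤ rdeg G D A B v) (nontriv : ∃ v ∈ D, v ≠ z) :
    Rooted G k D A B z ∨ ∃ S ⊆ D, ∃ u ∈ D, z ∈ S ∧ u ∉ S ∧ BoundaryIn G D S {u} ∧
      (∀ s ∈ S, s ∉ A ∧ s ∉ B) ∧ ((∃ v ∈ D \ S, v ≠ u) → Rooted G k (D \ S) A B u) := by
  by_cases hcut : ∀ u ∈ D, ∀ S ⊆ D, S.Nonempty → u ∉ S → BoundaryIn G D S {u} →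
      ∃ s ∈ S, s ∈ A ∨ s ∈ B
  · exact .inl ⟨⟨closed, hcut⟩, deg, nontriv⟩
  right
  let F : Set (Set V) := {S | S ⊆ D ∧ S.Nonempty ∧ (∀ s ∈ S, s ∉ A ∧ s ∉ B) ∧
    ∃ u ∈ D, u ∉ S ∧ BoundaryIn G D S {u}}
  push Not at hcut
  obtain ⟨u₀, hu₀, S₀, hS₀, hne₀, huS₀, hb₀, hAB₀⟩ := hcut
  -- An obstacle left after removing `S` would either contain `u` and enlarge `S`, or be an obstacle
  -- of `D` avoiding `z`. Only `u` loses degree.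
  obtain ⟨S, ⟨hS, hne, hAB, u, hu, huS, hb⟩, hmax⟩ :=
    (toFinite F).exists_maximal ⟨S₀, hS₀, hne₀, hAB₀, u₀, hu₀, huS₀, hb₀⟩
  have hzS := hz u hu S hS hne huS hb hAB
  have hout : ∀ S' ⊆ D \ S, u ∉ S' → ∀ U, BoundaryIn G (D \ S) S' U → BoundaryIn G D S' U := by
    intro S' hS' huS' U hb' s hs w hw ha
    by_cases hwS : w ∈ S
    · rcases hb w hwS s (hS' hs).1 ha.symm with h | h
      · exact absurd h (hS' hs).2
      · exact absurd (mem_singleton_iff.1 h ▸ hs) huS'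
    · exact hb' s hs w ⟨hw, hwS⟩ ha
  have hin : ∀ S' ⊆ D \ S, u ∈ S' → ∀ U, BoundaryIn G (D \ S) S' U →
      BoundaryIn G D (S' ∪ S) U := by
    rintro S' hS' huS' U hb' s (hs | hs) w hw ha
    · by_cases hwS : w ∈ S
      · exact .inl (.inr hwS)
      · rcases hb' s hs w ⟨hw, hwS⟩ ha with h | h
        · exact .inl (.inl h)
        · exact .inr h
    · rcases hb s hs w hw ha with h | h
      · exact .inl (.inr h)
      · exact .inl (.inl (mem_singleton_iff.1 h ▸ huS'))
  refine ⟨S, hS, u, hu, hzS, huS, hb, hAB, fun hne' => ⟨⟨fun S' hS' hSne hb' => ?_, ?_⟩, ?_, hne'⟩⟩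
  · by_cases huS' : u ∈ S'
    · obtain ⟨⟨a, ha, haA⟩, b, hb, hbB⟩ := closed (S' ∪ S)
        (union_subset (hS'.trans sdiff_subset) hS) ⟨u, .inl huS'⟩ (hin S' hS' huS' _ hb')
      exact ⟨⟨a, ha.resolve_right fun h => (hAB a h).1 haA, haA⟩, b,
        hb.resolve_right fun h => (hAB b h).2 hbB, hbB⟩
    · exact closed S' (hS'.trans sdiff_subset) hSne (hout S' hS' huS' _ hb')
  · intro w hw S' hS' hSne hwS' hb'
    by_contra! hcon
    by_cases huS' : u ∈ S'
    · have := hmax (y := S' ∪ S) ⟨union_subset (hS'.trans sdiff_subset) hS, ⟨u, .inl huS'⟩,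
        fun s hs =>
        hs.elim (hcon s) (hAB s), w, hw.1, fun h => h.elim hwS' hw.2, hin S' hS' huS' _ hb'⟩
        subset_union_right
      exact huS (this (.inl huS'))
    · exact (hS' (hz w hw.1 S' (hS'.trans sdiff_subset) hSne hwS' (hout S' hS' huS' _ hb')
        hcon)).2 hzS
  · intro v hv hvu
    refine (deg v hv.1 fun h => hv.2 (h ▸ hzS)).trans (rdeg_le_add (k := 0) ∅ (fun w hw ha =>
      .inl ⟨hw, fun hwS => ?_⟩) (by simp))
    rcases hb w hwS v hv.1 ha.symm with h | h
    · exact hv.2 h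
    · exact hvu h

/-! ### Neighbours of the second root confined to `T` -/

namespace Minimal

/-- A vertex of `X` outside `Y` would leave a graph of minimum degree three, up to one exception,
between `X` and the neighbours of `Y`. Its paths end either at y or with y, d, y', and these endings
differ by two. -/
theorem left_subset_right [Finite V] (h : Minimal G C X Y z) {d : V} (hd : d ∈ C) (hdX : d ∉ X)
    {T : Set V} (hT : ∀ t, t ∈ T ↔ t ∈ C ∧ t ∈ X ∧ G.Adj d t)
    (hle : ∀ e ∈ C, e ≠ d → (T ∩ G.neighborSet e).ncard ≤ 2) (hYT : ∀ y ∈ C, y ∈ Y → y ∈ T) :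
    ∀ x ∈ C, x ∈ X → x ∈ Y := by
  by_contra! ⟨x₀, hx₀C, hx₀X, hx₀Y⟩
  -- Otherwise y; q, y; and q, y, d, y' have lengths 0, 1, 3.
  have hXY : ∀ q ∈ C, q ∈ X → ∀ y ∈ C, y ∈ Y → ¬ G.Adj q y := by
    intro q hq hqX y hy hyY hqy
    obtain ⟨y', hy', hyY', hyy⟩ := h.exists_ne_right hy hyY
    have h1 := (hT y).1 (hYT y hy hyY)
    have h2 := (hT y').1 (hYT y' hy' hyY')
    have hqY : q ∉ Y := fun hqY => h.triFree.ind q hq y hy hqY hyY hqy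
    exact h.not_good (Good.of_one_three (m := 0) ⟨y, h1.2.1, y, hyY, .nil hy⟩
      ⟨q, hqX, y, hyY, .one hq hy hqy⟩ ⟨q, hqX, y', hyY', .three hq hy hd hy' hqy h1.2.2.symm
        h2.2.2 (fun h => hdX (h ▸ hqX)) (fun h => hqY (h ▸ hyY')) hyy.symm⟩)
  have hRK := reach_subset (G := G) (C := C \ insert d Y) (B := X)
  have hRC := hRK.trans sdiff_subset
  have hRY : ∀ s ∈ reach G (C \ insert d Y) X, s ∉ Y := fun s hs h => (hRK hs).2 (.inr h)
  have hdR : d ∉ reach G (C \ insert d Y) X := fun h => (hRK h).2 (.inl rfl)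
  have hx₀R : x₀ ∈ reach G (C \ insert d Y) X := mem_reach_of_mem ⟨hx₀C, by
    rintro (h | h)
    · exact hdX (h ▸ hx₀X)
    · exact hx₀Y h⟩ hx₀X
  have key : ∀ S ⊆ reach G (C \ insert d Y) X, ∀ U,
      BoundaryIn G (reach G (C \ insert d Y) X) S U → (∀ s ∈ S, s ∉ nbrs G (C ∩ Y)) →
      ∀ s ∈ S, ∀ w ∈ C, G.Adj s w → w ∈ S ∨ w ∈ U ∨ w = d := by
    intro S hS U hb hn s hs w hw ha
    rcases boundary_of_reach hS hb hs hw ha with h | h | h | h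
    · exact .inl h
    · exact .inr (.inl h)
    · exact .inr (.inr h)
    · exact absurd ⟨w, ⟨hw, h⟩, ha.symm⟩ (hn s hs)
  have hclosed : ∀ S ⊆ reach G (C \ insert d Y) X, S.Nonempty →
      BoundaryIn G (reach G (C \ insert d Y) X) S ∅ →
      (S ∩ X).Nonempty ∧ (S ∩ nbrs G (C ∩ Y)).Nonempty := by
    refine fun S hS hne hb => ⟨closed_reach_inter hne hS hb, ?_⟩
    by_contra hcon
    refine h.false_of_boundary_left (hS.trans hRC) hne hd (fun h => hdR (hS h))
      (fun s hs w hw ha => ?_) fun s hs => hRY s (hS hs)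
    rcases key S hS _ hb (fun s hs hn => hcon ⟨s, hs, hn⟩) s hs w hw ha with h | h | h
    · exact .inl h
    · exact h.elim
    · exact .inr h
  have hlen : ∀ n ∈ lengths G (reach G (C \ insert d Y) X) X (nbrs G (C ∩ Y)),
      n + 1 ∈ lengths G C X Y ∧ n + (1 + 2) ∈ lengths G C X Y := by
    rintro n ⟨p, hpX, q, ⟨y, hy, hyq⟩, hp⟩
    obtain ⟨y', hy', hyY', hyy⟩ := h.exists_ne_right hy.1 hy.2
    have h1 := (hT y).1 (hYT y hy.1 hy.2)
    have h2 := (hT y').1 (hYT y' hy' hyY')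
    refine ⟨⟨p, hpX, y, hy.2, hp.snoc hyq.symm (fun h => hRY y h hy.2) hRC hy.1⟩,
      p, hpX, y', hyY', ?_⟩
    refine hp.append hyq.symm (D := {y, d, y'}) (.two (by simp) (by simp) (by simp) h1.2.2.symm
      h2.2.2 hyy.symm) (disjoint_left.2 ?_) hRC (by
        rintro _ (rfl | rfl | rfl)
        exacts [hy.1, hd, hy'])
    rintro _ hx (rfl | rfl | rfl)
    exacts [hRY _ hx hy.2, hdR hx, hRY _ hx hyY']
  have hdeg : ∀ v ∈ reach G (C \ insert d Y) X, v ≠ z →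
      3 ≤ rdeg G (reach G (C \ insert d Y) X) X (nbrs G (C ∩ Y)) v := by
    intro v hv hvz
    have h4 := h.rooted.deg v (hRC hv) hvz
    have h5 := rdeg_le_add (G := G) (C := C) (D := reach G (C \ insert d Y) X)
      (X := X) (Y := Y) (A := X) (B := nbrs G (C ∩ Y)) (v := v) (k := 1)
      (C ∩ insert d Y ∩ G.neighborSet v) (fun w hw ha => by
        rcases mem_or_mem_of_reach hv hw ha with h | h
        · exact .inl h
        · exact .inr ⟨⟨hw, h⟩, ha⟩) (by
        rw [ind_of_not (hRY v hv)]
        by_cases hvd : G.Adj v d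
        · have := ncard_le_one_of (S := C ∩ insert d Y ∩ G.neighborSet v) (by
            have : ∀ a ∈ C ∩ insert d Y ∩ G.neighborSet v, a = d := by
              rintro a ⟨⟨haC, had | haY⟩, hva⟩
              · exact had
              · exact (h.triFree.tri v (hRC hv) d hd a haC hvd
                  ((hT a).1 (hYT a haC haY)).2.2 hva).elim
            exact fun a ha b hb => (this a ha).trans (this b hb).symm)
          omega
        · have h6 := (ncard_le_ncard (s := C ∩ insert d Y ∩ G.neighborSet v)
            (t := T ∩ G.neighborSet v) (by
              rintro a ⟨⟨haC, had | haY⟩, hva⟩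
              · exact absurd (had ▸ hva) hvd
              · exact ⟨hYT a haC haY, hva⟩)).trans
            (hle v (hRC hv) fun h => hdR (h ▸ hv))
          by_cases hvY : v ∈ nbrs G (C ∩ Y)
          · rw [ind_of hvY]
            omega
          · have : C ∩ insert d Y ∩ G.neighborSet v = ∅ := by
              rw [eq_empty_iff_forall_notMem]
              rintro a ⟨⟨haC, had | haY⟩, hva⟩
              · exact absurd (had ▸ hva) hvd
              · exact hvY ⟨a, ⟨haC, haY⟩, G.adj_symm hva⟩
            rw [this, ncard_empty]
            omega)
    omega
  rcases rooted_or_exists_rooted_diff (k := 3) (z := z) hclosed (fun u hu S hS hne huS hb hn => by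
      obtain ⟨s, hs⟩ := hne
      have := h.tight.inner S (hS.trans hRC) u (hRC hu) d hd huS (fun h => hdR (hS h))
        (key S hS _ hb fun s hs => (hn s hs).2) (fun s hs => (hn s hs).1)
        (fun s hs => hRY s (hS hs)) s hs
      exact this ▸ hs) hdeg ⟨x₀, hx₀R, h.ne_of_mem_left hx₀C hx₀X⟩ with
    hR | ⟨S, hS, u, hu, hzS, huS, hb, hn, hR⟩
  · exact h.not_good (hR.hasPair.good 1 (fun n hn => (hlen n hn).1) fun n hn => (hlen n hn).2)
  · have hmono := lengths_mono (G := G) (X := X) (Y := nbrs G (C ∩ Y))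
      (sdiff_subset (s := reach G (C \ insert d Y) X) (t := S))
    refine h.not_good ((hR ?_).hasPair.good 1 (fun n hn => (hlen n (hmono hn)).1)
      fun n hn => (hlen n (hmono hn)).2)
    obtain ⟨-, r, hr, hrY⟩ := hclosed _ subset_rfl ⟨x₀, hx₀R⟩ fun _ _ w hw _ => .inl hw
    -- If both root contacts were `u`, it would be in `X` and adjacent to `Y`, which was excluded.
    by_cases hxu : x₀ = u
    · refine ⟨r, ⟨hr, fun h => (hn r h).2 hrY⟩, fun hru => ?_⟩
      obtain ⟨y, hy, hyr⟩ := hrY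
      exact hXY x₀ hx₀C hx₀X y hy.1 hy.2 (hxu.trans hru.symm ▸ hyr.symm)
    · exact ⟨x₀, ⟨hx₀R, fun h => (hn x₀ h).1 hx₀X⟩, hxu⟩

/-- With a third vertex s in `T`, the paths s; t, d, t'; and s, d, t, w, t' have lengths 0, 2, 4.
Without it, the degree bound of four makes `d` and `w` the only inner neighbours of t and t'. Then
`{d, w}` cuts off all other vertices, so only `z` can be there and `d` has degree at most three. -/
theorem eq_of_adj_of_left_eq_right [Finite V] (h : Minimal G C X Y z) {d : V} (hd : d ∈ C)
    (hdX : d ∉ X) (hdY : d ∉ Y) (hdz : d ≠ z) {T : Set V}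
    (hT : ∀ t, t ∈ T ↔ t ∈ C ∧ t ∈ X ∧ G.Adj d t) (hTY : ∀ t ∈ T, t ∈ Y)
    (hYT : ∀ y ∈ C, y ∈ Y → y ∈ T) (hXT : ∀ x ∈ C, x ∈ X → x ∈ T) {w t t' : V}
    (hw : w ∈ C \ insert d T) (ht : t ∈ T) (ht' : t' ∈ T) (hwt : G.Adj w t) (hwt' : G.Adj w t') :
    t = t' := by
  by_contra htt
  have h1 := (hT t).1 ht
  have h2 := (hT t').1 ht'
  have hdw : d ≠ w := fun h => hw.2 (.inl h.symm)
  have hT2 : ∀ s ∈ T, s = t ∨ s = t' := by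
    intro s hs
    by_contra! hcon
    have h3 := (hT s).1 hs
    exact h.not_good (Good.of_even (m := 0) ⟨s, h3.2.1, s, hTY s hs, .nil h3.1⟩
      ⟨t, h1.2.1, t', hTY t' ht', .two h1.1 hd h2.1 h1.2.2.symm h2.2.2 htt⟩
      ⟨s, h3.2.1, t', hTY t' ht', .four h3.1 hd h1.1 hw.1 h2.1 h3.2.2.symm h1.2.2 hwt.symm hwt'
        hcon.1 (fun h => hw.2 (.inr (h ▸ hs))) hcon.2 hdw h2.2.2.ne htt⟩)
  have hN : ∀ s ∈ T, G.Adj w s → ∀ v ∈ C, G.Adj s v → v = d ∨ v = w := by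
    intro s hs hws v hv hsv
    have h3 := (hT s).1 hs
    have h4 := h.rdeg_left h3.1 h3.2.1
    unfold rdeg at h4
    rw [ind_of h3.2.1, ind_of (hTY s hs)] at h4
    have h5 := eq_of_subset_of_ncard_le (s := {d, w}) (t := C ∩ G.neighborSet s) (by
      rintro _ (rfl | rfl)
      exacts [⟨hd, h3.2.2.symm⟩, ⟨hw.1, hws.symm⟩]) (by rw [ncard_pair hdw]; omega)
    exact (h5 ▸ ⟨hv, hsv⟩ : v ∈ ({d, w} : Set V))
  have hS := h.tight.inner (C \ {d, w, t, t'}) sdiff_subset d hd w hw.1 (by simp) (by simp)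
    (fun s hs v hv hsv => by
      by_contra! hcon
      obtain ⟨hcon, hvdw⟩ := hcon
      refine hcon ⟨hv, ?_⟩
      have hsdw : ¬ (s = d ∨ s = w) := fun h => hs.2 (h.elim .inl fun h => .inr (.inl h))
      rintro (h | h | h | h)
      · exact hvdw (.inl h)
      · exact hvdw (.inr h)
      · exact hsdw (hN t ht hwt s hs.1 (h ▸ hsv.symm))
      · exact hsdw (hN t' ht' hwt' s hs.1 (h ▸ hsv.symm)))
    (fun s hs hsX => hs.2 (.inr (.inr (hT2 s (hXT s hs.1 hsX)))))
    (fun s hs hsY => hs.2 (.inr (.inr (hT2 s (hYT s hs.1 hsY)))))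
  have h4 := h.rooted.deg d hd hdz
  have h5 := rdeg_le (G := G) (C := C) (X := X) (Y := Y) (v := d) {t, t', z} fun v hv hdv => by
    by_cases hvt : v = t
    · exact .inl hvt
    by_cases hvt' : v = t'
    · exact .inr (.inl hvt')
    refine .inr (.inr (hS v ⟨hv, ?_⟩))
    rintro (h' | h' | h' | h')
    · exact hdv.ne h'.symm
    · subst h'
      exact h.triFree.tri d hd v hv t h1.1 hdv hwt h1.2.2
    · exact hvt h'
    · exact hvt' h'
  have := ncard_triple_le t t' z
  rw [ind_of_not hdX, ind_of_not hdY] at h5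
  omega

/-- Every outside vertex has at most one neighbour in `T`, so a component outside `d` and `T` keeps
degree four when rooted at `T` and `d`, or at `T \ {t₀}` and `t₀` if `d` has no neighbour outside
`T`. Minimality applies to it directly. -/
theorem false_of_left_eq_right [Finite V] (h : Minimal G C X Y z) {d : V} (hd : d ∈ C)
    (hdX : d ∉ X) (hdY : d ∉ Y) (hdz : d ≠ z) {T : Set V}
    (hT : ∀ t, t ∈ T ↔ t ∈ C ∧ t ∈ X ∧ G.Adj d t) (h2 : 2 ≤ T.ncard) (hTY : ∀ t ∈ T, t ∈ Y)
    (hYT : ∀ y ∈ C, y ∈ Y → y ∈ T) (hXT : ∀ x ∈ C, x ∈ X → x ∈ T) : False := by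
  have huniq : ∀ w ∈ C \ insert d T, ∀ t ∈ T, ∀ t' ∈ T, G.Adj w t → G.Adj w t' → t = t' :=
    fun w hw t ht t' ht' => h.eq_of_adj_of_left_eq_right hd hdX hdY hdz hT hTY hYT hXT hw ht ht'
  have hdT : d ∉ T := fun h => hdX ((hT d).1 h).2.1
  have hWK := fun w₀ => reach_subset (G := G) (C := C \ insert d T) (B := {w₀})
  have hWC := fun w₀ => (hWK w₀).trans sdiff_subset
  have hWX : ∀ w₀, ∀ s ∈ reach G (C \ insert d T) {w₀}, s ∉ X :=
    fun w₀ s hs hsX => (hWK w₀ hs).2 (.inr (hXT s (hWC w₀ hs) hsX))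
  have hWY : ∀ w₀, ∀ s ∈ reach G (C \ insert d T) {w₀}, s ∉ Y :=
    fun w₀ s hs hsY => (hWK w₀ hs).2 (.inr (hYT s (hWC w₀ hs) hsY))
  have hWT : ∀ w₀, ∀ t ∈ T, t ∉ reach G (C \ insert d T) {w₀} :=
    fun w₀ t ht h => (hWK w₀ h).2 (.inr ht)
  have hdW : ∀ w₀, d ∉ reach G (C \ insert d T) {w₀} := fun w₀ h => (hWK w₀ h).2 (.inl rfl)
  have hlt : ∀ w₀, (reach G (C \ insert d T) {w₀}).ncard < C.ncard := fun w₀ =>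
    ncard_lt_ncard ⟨hWC w₀, fun h => hdW w₀ (h hd)⟩
  by_cases hd' : ∃ w₀ ∈ C \ insert d T, G.Adj d w₀
  · obtain ⟨w₀, hw₀, hdw₀⟩ := hd'
    have hw₀W := mem_reach_of_mem (G := G) (B := {w₀}) hw₀ rfl
    have hleft : ∃ s ∈ reach G (C \ insert d T) {w₀}, s ∈ nbrs G T := by
      by_contra! hcon
      refine h.false_of_boundary_left (hWC w₀) ⟨w₀, hw₀W⟩ hd (hdW w₀) (fun s hs w hw ha => ?_)
        (hWY w₀)
      rcases mem_or_mem_of_reach hs hw ha with h | h | h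
      · exact .inl h
      · exact .inr h
      · exact absurd ⟨w, h, ha.symm⟩ (hcon s hs)
    have hnd : ∀ v ∈ C, G.Adj v d → v ∉ nbrs G T := by
      rintro v hv hvd ⟨t, ht, htv⟩
      exact h.triFree.tri v hv d hd t ((hT t).1 ht).1 hvd ((hT t).1 ht).2.2 htv.symm
    refine h.not_good ((h.ih (reach G (C \ insert d T) {w₀}) (nbrs G T) (nbrs G {d}) z (hlt w₀)
      ⟨⟨fun S hS hne hb => ?_, ?_⟩, ?_, ?_⟩ (h.triFree.nbr (hWC w₀) hd)).shift 3 ?_)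
    · rw [eq_of_closed_reach hne hS hb]
      exact ⟨hleft, w₀, hw₀W, nbrs_singleton.2 hdw₀⟩
    · intro u hu S hS hne huS hb
      by_contra! hcon
      refine h.false_of_boundary_left (hS.trans (hWC w₀)) hne (hWC w₀ hu) huS
        (fun s hs w hw ha => ?_) fun s hs => hWY w₀ s (hS hs)
      rcases boundary_of_reach hS hb hs hw ha with h | h | h | h
      · exact .inl h
      · exact .inr h
      · exact absurd (nbrs_singleton.2 (h ▸ ha.symm)) (hcon s hs).2
      · exact absurd ⟨w, h, ha.symm⟩ (hcon s hs).1
    · intro v hv hvz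
      refine (h.rooted.deg v (hWC w₀ hv) hvz).trans (rdeg_le_add (k := 0)
        (insert d T ∩ G.neighborSet v) (fun w hw ha => ?_) ?_)
      · rcases mem_or_mem_of_reach hv hw ha with h | h
        · exact .inl h
        · exact .inr ⟨h, ha⟩
      · rw [ind_of_not (hWX w₀ v hv), ind_of_not (hWY w₀ v hv)]
        have := ncard_le_ind_of_subsingleton (S := insert d T ∩ G.neighborSet v)
          (p := v ∈ nbrs G T ∨ v ∈ nbrs G {d}) (by
            rintro a ⟨ha | ha, hva⟩ b ⟨hb | hb, hvb⟩
            · exact ha.trans hb.symm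
            · exact absurd ⟨b, hb, G.adj_symm hvb⟩ (hnd v (hWC w₀ hv) (ha ▸ hva))
            · exact absurd ⟨a, ha, G.adj_symm hva⟩ (hnd v (hWC w₀ hv) (hb ▸ hvb))
            · exact huniq v (hWK w₀ hv) a ha b hb hva hvb) (by
            rintro ⟨a, ha | ha, hva⟩
            · exact .inr (nbrs_singleton.2 (ha ▸ G.adj_symm hva))
            · exact .inl ⟨a, ha, G.adj_symm hva⟩)
        have h7 : ind (v ∈ nbrs G T ∨ v ∈ nbrs G {d}) ≤
            ind (v ∈ nbrs G T) + ind (v ∈ nbrs G {d}) := by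
          unfold ind; split_ifs <;> first | omega | tauto
        omega
    · by_contra! hcon
      obtain ⟨s, hs, hst⟩ := hleft
      have := (hcon s hs).trans (hcon w₀ hw₀W).symm
      subst this
      exact hnd s hw₀.1 hdw₀.symm hst
    · rintro n ⟨p, ⟨t, ht, htp⟩, q, hq, hp⟩
      obtain ⟨t', ht', htt⟩ := exists_ne_of_two_le_ncard h2 t
      have h1 := (hT t).1 ht
      have h2 := (hT t').1 ht'
      have h3 : PathIn G (C \ {t}) p t' (n + 2) :=
        hp.append (nbrs_singleton.1 hq).symm (D := {d, t'}) (.one (by simp) (by simp) h2.2.2)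
          (disjoint_left.2 (by
            rintro _ hx (rfl | rfl)
            exacts [hdW w₀ hx, hWT w₀ _ ht' hx]))
          (fun x hx => ⟨hWC w₀ hx, fun h => hWT w₀ t ht (mem_singleton_iff.1 h ▸ hx)⟩) (by
            rintro _ (rfl | rfl)
            exacts [⟨hd, h1.2.2.ne⟩, ⟨h2.1, htt⟩])
      exact ⟨t, h1.2.1, t', hTY t' ht', .cons h1.1 htp h3⟩
  · obtain ⟨t₀, ht₀, -⟩ := exists_ne_of_two_le_ncard h2 d
    have hTt₀ := (hT t₀).1 ht₀
    obtain ⟨w₀, hw₀, htw₀⟩ : ∃ w ∈ C \ insert d T, G.Adj t₀ w := by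
      by_contra! hcon
      have h1 := h.rooted.deg t₀ hTt₀.1 (h.ne_of_mem_left hTt₀.1 hTt₀.2.1)
      have h2 := rdeg_le (G := G) (C := C) (X := X) (Y := Y) (v := t₀) {d} fun w hw haw => by
        by_contra hwK
        refine hcon w ⟨hw, ?_⟩ haw
        rintro (h' | h')
        · exact hwK h'
        · exact h.triFree.tri d hd t₀ hTt₀.1 w hw hTt₀.2.2 haw ((hT w).1 h').2.2
      have := ind_le_one (t₀ ∈ X)
      have := ind_le_one (t₀ ∈ Y)
      rw [ncard_singleton] at h2
      omega
    have hw₀W := mem_reach_of_mem (G := G) (B := {w₀}) hw₀ rfl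
    have hWd : ∀ s ∈ reach G (C \ insert d T) {w₀}, ¬ G.Adj s d :=
      fun s hs hsd => hd' ⟨s, hWK w₀ hs, hsd.symm⟩
    have hleft : ∃ s ∈ reach G (C \ insert d T) {w₀}, s ∈ nbrs G (T \ {t₀}) := by
      by_contra! hcon
      refine h.false_of_boundary_left (hWC w₀) ⟨w₀, hw₀W⟩ hTt₀.1 (hWT w₀ t₀ ht₀)
        (fun s hs w hw ha => ?_) (hWY w₀)
      rcases mem_or_mem_of_reach hs hw ha with h | h | h
      · exact .inl h
      · exact absurd (h ▸ ha) (hWd s hs)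
      · refine .inr ?_
        by_contra hwt
        exact hcon s hs ⟨w, ⟨h, hwt⟩, ha.symm⟩
    refine h.not_good ((h.ih (reach G (C \ insert d T) {w₀}) (nbrs G (T \ {t₀})) (nbrs G {t₀}) z
      (hlt w₀) ⟨⟨fun S hS hne hb => ?_, ?_⟩, ?_, ?_⟩ (h.triFree.nbr (hWC w₀) hTt₀.1)).shift 2 ?_)
    · rw [eq_of_closed_reach hne hS hb]
      exact ⟨hleft, w₀, hw₀W, nbrs_singleton.2 htw₀⟩
    · intro u hu S hS hne huS hb
      by_contra! hcon
      refine h.false_of_boundary_left (hS.trans (hWC w₀)) hne (hWC w₀ hu) huS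
        (fun s hs w hw ha => ?_) fun s hs => hWY w₀ s (hS hs)
      rcases boundary_of_reach hS hb hs hw ha with h | h | h | h
      · exact .inl h
      · exact .inr h
      · exact absurd (h ▸ ha) (hWd s (hS hs))
      · exfalso
        by_cases hwt : w = t₀
        · exact (hcon s hs).2 (nbrs_singleton.2 (hwt ▸ ha.symm))
        · exact (hcon s hs).1 ⟨w, ⟨h, hwt⟩, ha.symm⟩
    · intro v hv hvz
      refine (h.rooted.deg v (hWC w₀ hv) hvz).trans (rdeg_le_add (k := 0)
        (T ∩ G.neighborSet v) (fun w hw ha => ?_) ?_)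
      · rcases mem_or_mem_of_reach hv hw ha with h | h | h
        · exact .inl h
        · exact absurd (h ▸ ha) (hWd v hv)
        · exact .inr ⟨h, ha⟩
      · rw [ind_of_not (hWX w₀ v hv), ind_of_not (hWY w₀ v hv)]
        have := ncard_le_ind_of_subsingleton (S := T ∩ G.neighborSet v)
          (p := v ∈ nbrs G (T \ {t₀}) ∨ v ∈ nbrs G {t₀})
          (fun a ha b hb => huniq v (hWK w₀ hv) a ha.1 b hb.1 ha.2 hb.2) (by
            rintro ⟨a, ha, hva⟩
            by_cases hat : a = t₀
            · exact .inr (nbrs_singleton.2 (hat ▸ G.adj_symm hva))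
            · exact .inl ⟨a, ⟨ha, hat⟩, G.adj_symm hva⟩)
        have h7 : ind (v ∈ nbrs G (T \ {t₀}) ∨ v ∈ nbrs G {t₀}) ≤
            ind (v ∈ nbrs G (T \ {t₀})) + ind (v ∈ nbrs G {t₀}) := by
          unfold ind; split_ifs <;> first | omega | tauto
        omega
    · by_contra! hcon
      obtain ⟨s, hs, t, ht, hts⟩ := hleft
      have := (hcon s hs).trans (hcon w₀ hw₀W).symm
      subst this
      exact ht.2 (huniq s hw₀ t ht.1 t₀ ht₀ hts.symm htw₀.symm)
    · rintro n ⟨p, ⟨t, ht, htp⟩, q, hq, hp⟩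
      have h1 := (hT t).1 ht.1
      exact ⟨t, h1.2.1, t₀, hTY t₀ ht₀, .cons h1.1 htp (hp.snoc (nbrs_singleton.1 hq).symm
        (hWT w₀ t₀ ht₀) (fun x hx => ⟨hWC w₀ hx, fun h => hWT w₀ t ht.1
          (mem_singleton_iff.1 h ▸ hx)⟩) ⟨hTt₀.1, fun h => ht.2 h.symm⟩)⟩

/-- The second root is reachable outside `d` and the vertices of `T`. -/
theorem reach_nonempty [Finite V] (h : Minimal G C X Y z) {d : V} (hd : d ∈ C)
    (hdX : d ∉ X) (hdz : d ≠ z) {T : Set V}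
    (hT : ∀ t, t ∈ T ↔ t ∈ C ∧ t ∈ X ∧ G.Adj d t) (h2 : 2 ≤ T.ncard)
    (hle : ∀ e ∈ C, e ≠ d → (T ∩ G.neighborSet e).ncard ≤ 2) :
    (reach G (C \ insert d T) Y).Nonempty := by
  by_contra hR
  have hYK : ∀ y ∈ C, y ∈ Y → y = d ∨ y ∈ T := by
    intro y hy hyY
    by_contra hcon
    exact hR ⟨y, mem_reach_of_mem ⟨hy, hcon⟩ hyY⟩
  have hdY : d ∉ Y := by
    intro hdY
    obtain ⟨y, hy, hyY, hyd⟩ := h.exists_ne_right hd hdY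
    exact h.triFree.ind d hd y hy hdY hyY ((hT y).1 ((hYK y hy hyY).resolve_left hyd)).2.2
  have hYT : ∀ y ∈ C, y ∈ Y → y ∈ T := fun y hy hyY =>
    (hYK y hy hyY).resolve_left fun h => hdY (h ▸ hyY)
  have hXY := h.left_subset_right hd hdX hT hle hYT
  exact h.false_of_left_eq_right hd hdX hdY hdz hT h2
    (fun t ht => hXY t ((hT t).1 ht).1 ((hT t).1 ht).2.1) hYT
    fun x hx hxX => hYT x hx (hXY x hx hxX)

/-! ### A vertex with two neighbours in `X` -/

/-- The subcase in which the vertices reaching the second root outside `d` and `T` are the single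
vertex `u` together with a set `S` attached only to `u` and `d`. -/
theorem false_of_single_attachment [Finite V] (h : Minimal G C X Y z) {d : V} (hd : d ∈ C)
    (hdX : d ∉ X) {T S : Set V} {u t₁ : V} (hT : ∀ t, t ∈ T ↔ t ∈ C ∧ t ∈ X ∧ G.Adj d t)
    (h2 : 2 ≤ T.ncard) (hS : S ⊆ reach G (C \ insert d T) Y)
    (hu : u ∈ reach G (C \ insert d T) Y)
    (hDS : ∀ v ∈ reach G (C \ insert d T) Y, v ∈ S ∨ v = u) (hzS : z ∈ S) (huS : u ∉ S)
    (hb : BoundaryIn G (reach G (C \ insert d T) Y) S {u})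
    (hn : ∀ s ∈ S, s ∉ nbrs G T ∧ s ∉ Y) (huY : u ∈ Y) (ht₁ : t₁ ∈ T) (htu : G.Adj t₁ u) :
    False := by
  have hDK := reach_subset (G := G) (C := C \ insert d T) (B := Y)
  have hSC : S ⊆ C := hS.trans (hDK.trans sdiff_subset)
  have huK := hDK hu
  have hdS : d ∉ S := fun h => (hDK (hS h)).2 (.inl rfl)
  have h1 := (hT t₁).1 ht₁
  have hud : u ≠ d := fun h => huK.2 (.inl h)
  have hbC : ∀ s ∈ S, ∀ w ∈ C, G.Adj s w → w ∈ S ∨ w = u ∨ w = d := by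
    intro s hs w hw ha
    rcases boundary_of_reach hS hb hs hw ha with h | h | h | h
    · exact .inl h
    · exact .inr (.inl h)
    · exact .inr (.inr h)
    · exact absurd ⟨w, h, ha.symm⟩ (hn s hs).1
  -- Otherwise t; t₁, u; and t, d, t₁, u have lengths 0, 1, 3. Hence only `u` and `d` can lie in
  -- `Y`.
  have hTY : ∀ t ∈ T, t ∉ Y := by
    intro t ht htY
    have h3 := (hT t).1 ht
    have htt : t ≠ t₁ := by
      rintro rfl
      exact h.triFree.ind t h3.1 u huK.1 htY huY htu
    exact h.not_good (Good.of_one_three (m := 0) ⟨t, h3.2.1, t, htY, .nil h3.1⟩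
      ⟨t₁, h1.2.1, u, huY, .one h1.1 huK.1 htu⟩ ⟨t, h3.2.1, u, huY, .three h3.1 hd h1.1 huK.1
        h3.2.2.symm h1.2.2 htu htt (fun h => huK.2 (.inr (h ▸ ht))) hud.symm⟩)
  have hYud : ∀ y ∈ C, y ∈ Y → y = u ∨ y = d := by
    intro y hy hyY
    by_cases hyd : y = d
    · exact .inr hyd
    refine .inl ((hDS y (mem_reach_of_mem ⟨hy, ?_⟩ hyY)).resolve_left fun h => (hn y h).2 hyY)
    rintro (h | h)
    · exact hyd h
    · exact hTY y h hyY
  have hdY : d ∈ Y := by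
    obtain ⟨y, hy, hyY, hyu⟩ := h.exists_ne_right huK.1 huY
    exact (hYud y hy hyY).resolve_left hyu ▸ hyY
  obtain ⟨d₁, hd₁, hdd₁⟩ : ∃ d₁ ∈ S, G.Adj d d₁ := by
    by_contra! hcon
    refine h.false_of_boundary_left hSC ⟨z, hzS⟩ huK.1 huS (fun s hs w hw ha => ?_)
      fun s hs => (hn s hs).2
    rcases hbC s hs w hw ha with h | h | h
    · exact .inl h
    · exact .inr h
    · exact absurd (h ▸ ha.symm) (hcon s hs)
  have hTS : ∀ t ∈ T, t ∉ S := fun t ht h => (hDK (hS h)).2 (.inr ht)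
  -- As `d` lies in `Y`, it has at most three inner neighbours: `d₁` and exactly two vertices of
  -- `T`.
  have hNd : insert d₁ T = C ∩ G.neighborSet d := by
    have h3 := h.rdeg_right hd hdY
    unfold rdeg at h3
    rw [ind_of hdY] at h3
    refine eq_of_subset_of_ncard_le ?_ ?_
    · rintro w (rfl | hw)
      · exact ⟨hSC hd₁, hdd₁⟩
      · exact ⟨((hT w).1 hw).1, ((hT w).1 hw).2.2⟩
    · rw [ncard_insert_of_notMem fun h => hTS d₁ h hd₁]
      omega
  obtain ⟨t₂, ht₂, htt⟩ := exists_ne_of_two_le_ncard h2 t₁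
  have h2' := (hT t₂).1 ht₂
  have hTt : ∀ t ∈ T, t = t₁ ∨ t = t₂ := by
    intro t ht
    by_contra! hcon
    have h3 := h.rdeg_right hd hdY
    unfold rdeg at h3
    rw [ind_of hdY, ← hNd, ncard_insert_of_notMem fun h => hTS d₁ h hd₁] at h3
    have h4 := ncard_le_ncard (s := {t, t₁, t₂}) (t := T) (by
      rintro _ (rfl | rfl | rfl)
      exacts [ht, ht₁, ht₂])
    rw [ncard_insert_of_notMem (by simp [hcon]), ncard_pair htt.symm] at h4
    omega
  have hdT : d ∉ T := fun h => hdX ((hT d).1 h).2.1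
  -- The neighbours `d`, `u` and the first root give `t₂` degree three only, so it has one more
  -- neighbour beyond them.
  obtain ⟨w₀, hw₀, hw₀D, htw₀⟩ : ∃ w ∈ C \ insert d T, w ∉ reach G (C \ insert d T) Y ∧
      G.Adj t₂ w := by
    by_contra! hcon
    have h3 := h.rooted.deg t₂ h2'.1 (h.ne_of_mem_left h2'.1 h2'.2.1)
    have h4 := rdeg_le (G := G) (C := C) (X := X) (Y := Y) (v := t₂) {d, u} fun w hw haw => by
      by_contra hwK
      refine hcon w ⟨hw, ?_⟩ ?_ haw
      · rintro (h' | h')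
        · exact hwK (.inl h')
        · exact h.triFree.tri d hd t₂ h2'.1 w hw h2'.2.2 haw ((hT w).1 h').2.2
      · intro hwD
        rcases hDS w hwD with h' | h'
        · exact (hn w h').1 ⟨t₂, ht₂, haw⟩
        · exact hwK (.inr h')
    have := ncard_pair_le d u
    have := ind_le_one (t₂ ∈ X)
    rw [ind_of_not (hTY t₂ ht₂)] at h4
    omega
  have hWK := reach_subset (G := G) (C := C \ insert d T) (B := {w₀})
  have hWC := hWK.trans sdiff_subset
  have hw₀W := mem_reach_of_mem (G := G) (B := {w₀}) hw₀ rfl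
  have hWD : ∀ s ∈ reach G (C \ insert d T) {w₀}, s ∉ reach G (C \ insert d T) Y :=
    fun s hs hsD => hw₀D (reach_singleton_subset hs hsD hw₀W)
  have hWY : ∀ s ∈ reach G (C \ insert d T) {w₀}, s ∉ Y :=
    fun s hs hsY => hWD s hs (mem_reach_of_mem (hWK hs) hsY)
  have hdW : d ∉ reach G (C \ insert d T) {w₀} := fun h => (hWK h).2 (.inl rfl)
  have huW : u ∉ reach G (C \ insert d T) {w₀} := fun h => hWD u h hu
  have hTW : ∀ t ∈ T, t ∉ reach G (C \ insert d T) {w₀} := fun t ht h => (hWK h).2 (.inr ht)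
  have hzW : z ∉ reach G (C \ insert d T) {w₀} := fun h => hWD z h (hS hzS)
  have key : ∀ S ⊆ reach G (C \ insert d T) {w₀}, ∀ U,
      BoundaryIn G (reach G (C \ insert d T) {w₀}) S U →
      ∀ s ∈ S, ∀ w ∈ C, G.Adj s w → w ∈ S ∨ w ∈ U ∨ w = t₁ ∨ w = t₂ := by
    intro S' hS' U hb s hs w hw ha
    rcases boundary_of_reach hS' hb hs hw ha with h | h | rfl | h
    · exact .inl h
    · exact .inr (.inl h)
    · rcases hNd.ge ⟨hWC (hS' hs), ha.symm⟩ with h | h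
      · exact absurd (hS (h ▸ hd₁)) (hWD s (hS' hs))
      · exact absurd (hS' hs) (hTW s h)
    · exact .inr (.inr (hTt w h))
  -- Dropping `t₁` and turning `t₂` into a root costs each vertex at most one degree.
  have hR : Rooted G 3 (reach G (C \ insert d T) {w₀}) X (nbrs G {t₂}) z := by
    refine ⟨⟨fun S' hS' hne hb => ?_, ?_⟩, ?_, w₀, hw₀W, fun h => hzW (h ▸ hw₀W)⟩
    · rw [eq_of_closed_reach hne hS' hb]
      refine ⟨?_, w₀, hw₀W, nbrs_singleton.2 htw₀⟩
      by_contra hcon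
      refine hzW (h.tight.inner _ hWC t₁ h1.1 t₂ h2'.1 (hTW t₁ ht₁) (hTW t₂ ht₂)
        (fun s hs w hw ha => ?_) (fun s hs hsX => hcon ⟨s, hs, hsX⟩) hWY w₀ hw₀W ▸ hw₀W)
      rcases key _ subset_rfl ∅ (fun _ _ w hw _ => .inl hw) s hs w hw ha with h | h | h
      · exact .inl h
      · exact h.elim
      · exact .inr h
    · intro v hv S' hS' hne hvS hb
      by_contra! hcon
      obtain ⟨s, hs⟩ := hne
      refine hzW (h.tight.inner S' (hS'.trans hWC) v (hWC hv) t₁ h1.1 hvS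
        (fun h => hTW t₁ ht₁ (hS' h)) (fun s hs w hw ha => ?_) (fun s hs => (hcon s hs).1)
        (fun s hs => hWY s (hS' hs)) s hs ▸ hS' hs)
      rcases key S' hS' _ hb s hs w hw ha with h | h | h | h
      · exact .inl h
      · exact .inr (.inl h)
      · exact .inr (.inr h)
      · exact absurd (nbrs_singleton.2 (h ▸ ha.symm)) (hcon s hs).2
    · intro v hv hvz
      have h4 := h.rooted.deg v (hWC hv) hvz
      have h5 := rdeg_le_add (G := G) (C := C) (D := reach G (C \ insert d T) {w₀})
        (X := X) (Y := Y) (A := X) (B := nbrs G {t₂}) (v := v) (k := 1)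
        ({t₁, t₂} ∩ G.neighborSet v) (fun w hw ha => by
          rcases key _ subset_rfl ∅ (fun _ _ w hw _ => .inl hw) v hv w hw ha with h | h | h
          · exact .inl h
          · exact h.elim
          · exact .inr ⟨h, ha⟩) (by
          rw [ind_of_not (hWY v hv)]
          by_cases hvt : G.Adj t₂ v
          · rw [ind_of (nbrs_singleton.2 hvt)]
            have := (ncard_le_ncard (inter_subset_left (s := {t₁, t₂})
              (t := G.neighborSet v))).trans (ncard_pair_le t₁ t₂)
            omega
          · have := ncard_le_one_of (S := {t₁, t₂} ∩ G.neighborSet v) (by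
              have : ∀ a ∈ {t₁, t₂} ∩ G.neighborSet v, a = t₁ := by
                rintro a ⟨h | h, ha⟩
                · exact h
                · exact absurd (h ▸ G.adj_symm ha) hvt
              exact fun a ha b hb => (this a ha).trans (this b hb).symm)
            omega)
      omega
  -- The endings t₂, d and t₂, d, t₁, u differ in length by two.
  have hlen : ∀ n ∈ lengths G (reach G (C \ insert d T) {w₀}) X (nbrs G {t₂}),
      n + 2 ∈ lengths G C X Y ∧ n + (2 + 2) ∈ lengths G C X Y := by
    rintro n ⟨p, hpX, q, hq, hp⟩
    refine ⟨⟨p, hpX, d, hdY, hp.append (nbrs_singleton.1 hq).symm (D := {t₂, d})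
      (.one (by simp) (by simp) h2'.2.2.symm) (disjoint_left.2 ?_) hWC ?_⟩, p, hpX, u, huY,
      hp.append (nbrs_singleton.1 hq).symm (D := {t₂, d, t₁, u}) (.three (by simp) (by simp)
        (by simp) (by simp) h2'.2.2.symm h1.2.2 htu htt (fun h => huK.2 (.inr (h ▸ ht₂)))
        hud.symm) (disjoint_left.2 ?_) hWC ?_⟩
    · rintro _ hx (rfl | rfl)
      exacts [hTW _ ht₂ hx, hdW hx]
    · rintro _ (rfl | rfl)
      exacts [h2'.1, hd]
    · rintro _ hx (rfl | rfl | rfl | rfl)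
      exacts [hTW _ ht₂ hx, hdW hx, hTW _ ht₁ hx, huW hx]
    · rintro _ (rfl | rfl | rfl | rfl)
      exacts [h2'.1, hd, h1.1, huK.1]
  exact h.not_good (hR.hasPair.good 2 (fun n hn => (hlen n hn).1) fun n hn => (hlen n hn).2)

/-- In a minimal counterexample no vertex `d ∉ X` other than `z` has two neighbours in `X`. -/
theorem false_of_common_nbrs [Finite V] (h : Minimal G C X Y z) {d : V} (hd : d ∈ C)
    (hdX : d ∉ X) (hdz : d ≠ z) {T : Set V} (hT : ∀ t, t ∈ T ↔ t ∈ C ∧ t ∈ X ∧ G.Adj d t)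
    (h2 : 2 ≤ T.ncard) : False := by
  have hle : ∀ e ∈ C, e ≠ d → (T ∩ G.neighborSet e).ncard ≤ 2 := fun e he hed =>
    h.ncard_common_nbrs_le hd he hed.symm fun t => by
      rw [mem_inter_iff, hT, SimpleGraph.mem_neighborSet]
      tauto
  have hDne := h.reach_nonempty hd hdX hdz hT h2 hle
  have hDK := reach_subset (G := G) (C := C \ insert d T) (B := Y)
  have hDC := hDK.trans sdiff_subset
  have hdD : d ∉ reach G (C \ insert d T) Y := fun h => (hDK h).2 (.inl rfl)
  have hTD : ∀ t ∈ T, t ∉ reach G (C \ insert d T) Y := fun t ht h => (hDK h).2 (.inr ht)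
  have hTd : ∀ t ∈ T, t ≠ d := fun t ht => ((hT t).1 ht).2.2.ne'
  -- With a tail of length m from v, the starts v; t, v; and t', d, t, v give m, m + 1, m + 3.
  have hXN : ∀ v ∈ reach G (C \ insert d T) Y, v ∈ X → v ∉ nbrs G T := by
    rintro v ⟨y, hy, m, hp⟩ hvX ⟨t, ht, htv⟩
    obtain ⟨t', ht', htt⟩ := exists_ne_of_two_le_ncard h2 t
    have h3 := (hT t).1 ht
    have h4 := (hT t').1 ht'
    have h5 : PathIn G (insert t (C \ insert d T)) t y (m + 1) :=
      hp.cons₁ (subset_insert _ _) (.inl rfl) (fun h => h.2 (.inr ht)) htv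
    have hsub : insert t (C \ insert d T) ⊆ C := insert_subset h3.1 sdiff_subset
    refine h.not_good (Good.of_one_three (m := m) ⟨v, hvX, y, hy, hp.mono sdiff_subset⟩
      ⟨t, h3.2.1, y, hy, h5.mono hsub⟩ ⟨t', h4.2.1, y, hy, h5.cons₂ hsub h4.1 ?_ hd ?_
        h4.2.2.symm h3.2.2⟩)
    · rintro (h | h)
      · exact htt h
      · exact h.2 (.inr ht')
    · rintro (h | h)
      · exact hTd t ht h.symm
      · exact h.2 (.inl rfl)
  have hnd : ∀ v ∈ C, G.Adj v d → v ∉ nbrs G T := by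
    rintro v hv hvd ⟨t, ht, htv⟩
    exact h.triFree.tri v hv d hd t ((hT t).1 ht).1 hvd ((hT t).1 ht).2.2 htv.symm
  have key : ∀ S ⊆ reach G (C \ insert d T) Y, ∀ U,
      BoundaryIn G (reach G (C \ insert d T) Y) S U → (∀ s ∈ S, s ∉ nbrs G T) →
      ∀ s ∈ S, ∀ w ∈ C, G.Adj s w → w ∈ S ∨ w = d ∨ w ∈ U := by
    intro S hS U hb hn s hs w hw ha
    rcases boundary_of_reach hS hb hs hw ha with h | h | h | h
    · exact .inl h
    · exact .inr (.inr h)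
    · exact .inr (.inl h)
    · exact absurd ⟨w, h, ha.symm⟩ (hn s hs)
  obtain ⟨t₀, ht₀, -⟩ := exists_ne_of_two_le_ncard h2 d
  have hTt₀ := (hT t₀).1 ht₀
  have hclosed : ∀ S ⊆ reach G (C \ insert d T) Y, S.Nonempty →
      BoundaryIn G (reach G (C \ insert d T) Y) S ∅ →
      (S ∩ nbrs G T).Nonempty ∧ (S ∩ Y).Nonempty := by
    refine fun S hS hne hb => ⟨?_, closed_reach_inter hne hS hb⟩
    by_contra hcon
    have hbC : ∀ s ∈ S, ∀ w ∈ C, G.Adj s w → w ∈ S ∨ w = d := fun s hs w hw ha =>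
      (key S hS _ hb (fun s hs hn => hcon ⟨s, hs, hn⟩) s hs w hw ha).imp_right
        fun h => h.resolve_right (notMem_empty w)
    have hdS : d ∉ S := fun h => hdD (hS h)
    -- Such an `S` is attached only to `d` and the roots. Whichever of `S` and its complement
    -- without `d` avoids `z` yields the contradiction.
    by_cases hzS : z ∈ S
    · refine h.false_of_separator (Q := C \ insert d S) (d := d) sdiff_subset
        ⟨t₀, hTt₀.1, ?_⟩ hd (by simp) (fun h => h.2 (.inr hzS)) (fun s hs w hw ha => ?_)
        (hDC (hS hzS)) hdz.symm (fun h => h.2 (.inr hzS))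
      · rintro (h | h)
        · exact hTd t₀ ht₀ h
        · exact hTD t₀ ht₀ (hS h)
      · by_cases hwd : w = d
        · exact .inr hwd
        refine .inl ⟨hw, ?_⟩
        rintro (h | h)
        · exact hwd h
        · rcases hbC w h s hs.1 ha.symm with h | h
          · exact hs.2 (.inr h)
          · exact hs.2 (.inl h)
    · exact h.false_of_separator (hS.trans hDC) hne hd hdS hzS hbC hTt₀.1 (hTd t₀ ht₀)
        fun h => hTD t₀ ht₀ (hS h)
  have hz : ∀ u ∈ reach G (C \ insert d T) Y, ∀ S ⊆ reach G (C \ insert d T) Y, S.Nonempty →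
      u ∉ S → BoundaryIn G (reach G (C \ insert d T) Y) S {u} →
      (∀ s ∈ S, s ∉ nbrs G T ∧ s ∉ Y) → z ∈ S := by
    intro u hu S hS hne huS hb hn
    by_contra hzS
    have hsub : reach G (C \ insert d T) Y \ S ⊆ C \ insert d S := by
      refine fun x hx => ⟨hDC hx.1, ?_⟩
      rintro (h | h)
      · exact hdD (h ▸ hx.1)
      · exact hx.2 h
    exact h.false_of_separator_left (hS.trans hDC) hne hd (fun h => hdD (hS h)) hzS
      (key S hS _ hb fun s hs => (hn s hs).1) (fun s hs => (hn s hs).2)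
      (reach_mono hsub (mem_reach_sdiff
        (fun S hS hne hb => (hclosed S hS hne hb).2) hu hb fun s hs => (hn s hs).2))
  -- A vertex next to `T` is neither in `X` nor adjacent to `d`; it loses at most two edges to `T`
  -- and gains a root edge. Any other vertex loses its edge to `d` or to the first root, not both,
  -- since otherwise it would lie in `T`.
  have hdeg : ∀ v ∈ reach G (C \ insert d T) Y, v ≠ z →
      3 ≤ rdeg G (reach G (C \ insert d T) Y) (nbrs G T) Y v := by
    intro v hv hvz
    have h4 := h.rooted.deg v (hDC hv) hvz
    have h5 := rdeg_le_add (G := G) (C := C) (D := reach G (C \ insert d T) Y)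
      (X := X) (Y := Y) (A := nbrs G T) (B := Y) (v := v) (k := 1)
      (insert d T ∩ G.neighborSet v) (fun w hw ha => by
        rcases mem_or_mem_of_reach hv hw ha with h | h
        · exact .inl h
        · exact .inr ⟨h, ha⟩) (by
        by_cases hvT : v ∈ nbrs G T
        · rw [ind_of hvT, ind_of_not fun hvX => hXN v hv hvX hvT]
          have := (ncard_le_ncard (s := insert d T ∩ G.neighborSet v)
            (t := T ∩ G.neighborSet v) (by
              rintro a ⟨ha | ha, hva⟩
              · exact absurd hvT (hnd v (hDC hv) (ha ▸ hva))
              · exact ⟨ha, hva⟩)).trans (hle v (hDC hv) fun h => hdD (h ▸ hv))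
          omega
        · have h6 : (insert d T ∩ G.neighborSet v).ncard ≤ ind (G.Adj v d) :=
            ncard_le_ind_of_subsingleton (by
              have : ∀ a ∈ insert d T ∩ G.neighborSet v, a = d := by
                rintro a ⟨ha | ha, hva⟩
                · exact ha
                · exact absurd ⟨a, ha, G.adj_symm hva⟩ hvT
              exact fun a ha b hb => (this a ha).trans (this b hb).symm) (by
              rintro ⟨a, ha | ha, hva⟩
              · exact ha ▸ hva
              · exact absurd ⟨a, ha, G.adj_symm hva⟩ hvT)
          have h7 : ind (G.Adj v d) + ind (v ∈ X) ≤ 1 := by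
            by_cases hvd : G.Adj v d
            · rw [ind_of_not fun hvX => hTD v ((hT v).2 ⟨hDC hv, hvX, hvd.symm⟩) hv]
              exact ind_le_one _
            · rw [ind_of_not hvd, zero_add]
              exact ind_le_one _
          omega)
    omega
  -- The path may start at t or with the detour t', d, t.
  have hlen : ∀ n ∈ lengths G (reach G (C \ insert d T) Y) (nbrs G T) Y,
      n + 1 ∈ lengths G C X Y ∧ n + (1 + 2) ∈ lengths G C X Y := by
    rintro n ⟨p, ⟨t, ht, htp⟩, y, hy, hp⟩
    obtain ⟨t', ht', htt⟩ := exists_ne_of_two_le_ncard h2 t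
    have h3 := (hT t).1 ht
    have h4 := (hT t').1 ht'
    have h5 : PathIn G (insert t (reach G (C \ insert d T) Y)) t y (n + 1) :=
      hp.cons₁ (subset_insert _ _) (.inl rfl) (hTD t ht) htp
    have hsub := insert_subset h3.1 hDC
    refine ⟨⟨t, h3.2.1, y, hy, h5.mono hsub⟩, t', h4.2.1, y, hy, h5.cons₂ hsub h4.1 ?_ hd ?_
      h4.2.2.symm h3.2.2⟩
    · rintro (h | h)
      · exact htt h
      · exact hTD t' ht' h
    · rintro (h | h)
      · exact hTd t ht h.symm
      · exact hdD h
  obtain ⟨v₀, hv₀, hv₀Y⟩ := closed_reach_inter hDne subset_rfl fun _ _ w hw _ => .inl hw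
  rcases rooted_or_exists_rooted_diff (k := 3) (z := z) hclosed hz hdeg
    ⟨v₀, hv₀, h.ne_of_mem_right (hDC hv₀) hv₀Y⟩ with hR | ⟨S, hS, u, hu, hzS, huS, hb, hn, hR⟩
  · exact h.not_good (hR.hasPair.good 1 (fun n hn => (hlen n hn).1) fun n hn => (hlen n hn).2)
  · by_cases hne : ∃ v ∈ reach G (C \ insert d T) Y \ S, v ≠ u
    · have hmono := lengths_mono (G := G) (X := nbrs G T) (Y := Y)
        (sdiff_subset (s := reach G (C \ insert d T) Y) (t := S))
      exact h.not_good ((hR hne).hasPair.good 1 (fun n hn => (hlen n (hmono hn)).1)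
        fun n hn => (hlen n (hmono hn)).2)
    -- Nothing but `u` remains beside `S`, so `u` carries all contacts both with `T` and with `Y`.
    · have hDS : ∀ v ∈ reach G (C \ insert d T) Y, v ∈ S ∨ v = u := by
        intro v hv
        by_contra! hcon
        exact hne ⟨v, ⟨hv, hcon.1⟩, hcon.2⟩
      obtain ⟨⟨v, hv, hvT⟩, -⟩ := hclosed _ subset_rfl hDne fun _ _ w hw _ => .inl hw
      obtain ⟨t, ht, htv⟩ := (hDS v hv).resolve_left (fun h => (hn v h).1 hvT) ▸ hvT
      exact h.false_of_single_attachment hd hdX hT h2 hS hu hDS hzS huS hb hn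
        ((hDS v₀ hv₀).resolve_left (fun h => (hn v₀ h).2 hv₀Y) ▸ hv₀Y) ht htv

end Minimal

theorem Minimal.false [Finite V] (h : Minimal G C X Y z) : False := by
  refine h.false_of_unique_nbrs fun v hv hvX hvz a ha b hb hva hvb => ?_
  by_contra hab
  refine h.false_of_common_nbrs hv hvX hvz (T := {t | t ∈ C ∧ t ∈ X ∧ G.Adj v t}) (fun t => .rfl) ?_
  rw [← ncard_pair hab]
  refine ncard_le_ncard ?_
  rintro _ (rfl | rfl)
  exacts [⟨ha.1, ha.2, hva⟩, ⟨hb.1, hb.2, hvb⟩]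

/-! ### The induction -/

/-- A triangle-free rooted graph of minimum degree at least `4`, up to one exceptional vertex, has
three paths of good lengths between the roots. -/
theorem Rooted.good [Finite V] (h : Rooted G 4 C X Y z) (ht : TriFree G C Y) :
    Good (lengths G C X Y) := by
  induction hn : C.ncard using Nat.strong_induction_on generalizing C X Y z with
  | _ n ih =>
  subst hn
  -- The inner induction on the number of root edges supplies `ih_edge`; it fixes `C` and `z`.
  induction hm : (C ∩ X).ncard + (C ∩ Y).ncard using Nat.strong_induction_on
    generalizing X Y with
  | _ m ih' =>
  subst hm
  by_contra hg
  exact Minimal.false ⟨h, ht, hg, fun C' X' Y' z' hlt h' ht' => ih _ hlt h' ht' rfl,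
    fun X' Y' hlt h' ht' => ih' _ hlt h' ht' rfl⟩

/-! ### Back to graphs with two roots -/

/-- A connected induced subgraph has an edge leaving any proper nonempty set of its vertices. -/
theorem exists_adj_of_induce_connected {H : SimpleGraph V} {s S : Set V} {r : V}
    (h : (H.induce s).Connected) (hS : S ⊆ s) (hne : S.Nonempty) (hr : r ∈ s) (hrS : r ∉ S) :
    ∃ a ∈ S, ∃ b ∈ s, b ∉ S ∧ H.Adj a b := by
  obtain ⟨a, ha⟩ := hne
  obtain ⟨p⟩ := h.preconnected ⟨a, hS ha⟩ ⟨r, hr⟩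
  obtain ⟨e, -, he, he'⟩ := p.exists_boundary_dart (Subtype.val ⁻¹' S) ha hrS
  exact ⟨e.fst, he, e.snd, e.snd.2, he', e.adj⟩

/-- Deleting one root forces contact with the other, and deleting an inner vertex forces contact
with some root. The added edge has no inner end, so these contacts are edges of `G`. -/
theorem IsTwoConnectedRooted.linked {x y : V} (h : IsTwoConnectedRooted G x y) :
    Linked G {x, y}ᶜ (G.neighborSet x) (G.neighborSet y) := by
  obtain ⟨hxy, -, -, hconn⟩ := h
  have hadj : ∀ a b, a ∈ ({x, y}ᶜ : Set V) → (G ⊔ SimpleGraph.edge x y).Adj a b → G.Adj a b := by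
    intro a b ha hab
    rw [SimpleGraph.sup_adj, SimpleGraph.edge_adj] at hab
    rcases hab with hab | ⟨⟨rfl, -⟩ | ⟨rfl, -⟩, -⟩
    · exact hab
    · exact absurd (.inl rfl) ha
    · exact absurd (.inr rfl) ha
  have hx : x ∉ ({x, y}ᶜ : Set V) := by simp
  have hy : y ∉ ({x, y}ᶜ : Set V) := by simp
  have hmem : ∀ b, b ∈ ({x, y}ᶜ : Set V) ∨ b = x ∨ b = y := fun b => (em (b = x ∨ b = y)).symm
  refine ⟨fun S hS hne hb => ⟨?_, ?_⟩, fun u hu S hS hne huS hb => ?_⟩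
  · obtain ⟨a, ha, b, hby, hbS, hab⟩ := exists_adj_of_induce_connected (hconn y)
      (fun s hs hsy => hy (mem_singleton_iff.1 hsy ▸ hS hs)) hne hxy fun h => hx (hS h)
    replace hab := hadj a b (hS ha) hab
    rcases hmem b with hbC | rfl | rfl
    · exact absurd ((hb a ha b hbC hab).resolve_right (notMem_empty b)) hbS
    · exact ⟨a, ha, hab.symm⟩
    · exact absurd rfl hby
  · obtain ⟨a, ha, b, hbx, hbS, hab⟩ := exists_adj_of_induce_connected (hconn x)
      (fun s hs hsx => hx (mem_singleton_iff.1 hsx ▸ hS hs)) hne hxy.symm fun h => hy (hS h)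
    replace hab := hadj a b (hS ha) hab
    rcases hmem b with hbC | rfl | rfl
    · exact absurd ((hb a ha b hbC hab).resolve_right (notMem_empty b)) hbS
    · exact absurd rfl hbx
    · exact ⟨a, ha, hab.symm⟩
  · obtain ⟨a, ha, b, hbu, hbS, hab⟩ := exists_adj_of_induce_connected (hconn u) (r := x)
      (fun s hs hsu => huS (mem_singleton_iff.1 hsu ▸ hs)) hne
      (fun h => hx (mem_singleton_iff.1 h ▸ hu)) fun h => hx (hS h)
    replace hab := hadj a b (hS ha) hab
    rcases hmem b with hbC | rfl | rfl
    · exact absurd hbS (not_not.2 ((hb a ha b hbC hab).resolve_right hbu))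
    · exact ⟨a, ha, .inl hab.symm⟩
    · exact ⟨a, ha, .inr hab.symm⟩

theorem degree_le_rdeg [Fintype V] [DecidableRel G.Adj] (x y v : V) :
    G.degree v ≤ rdeg G {x, y}ᶜ (G.neighborSet x) (G.neighborSet y) v := by
  have h1 : G.degree v = rdeg G univ ∅ ∅ v := by
    rw [rdeg, univ_inter, ncard_eq_toFinset_card', ind_of_not (notMem_empty v)]
    rfl
  have key : ∀ a, ({a} ∩ G.neighborSet v).ncard ≤ ind (v ∈ G.neighborSet a) := fun a =>
    ncard_le_ind_of_subsingleton (fun b hb c hc => hb.1.trans hc.1.symm) (by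
      rintro ⟨_, rfl, hb⟩
      exact G.adj_symm hb)
  rw [h1]
  refine rdeg_le_add (k := 0) (({x} ∩ G.neighborSet v) ∪ ({y} ∩ G.neighborSet v))
    (fun w _ ha => ?_) ?_
  · by_cases hw : w = x ∨ w = y
    · exact .inr (hw.imp (fun h => ⟨h, ha⟩) fun h => ⟨h, ha⟩)
    · exact .inl hw
  · have h2 := ncard_union_le ({x} ∩ G.neighborSet v) ({y} ∩ G.neighborSet v)
    have h3 := key x
    have h4 := key y
    rw [ind_of_not (notMem_empty v)]
    omega

theorem triFree_of_cliqueFree {x y : V} (hxy : x ≠ y)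
    (h : (G.induce ({x}ᶜ : Set V)).CliqueFree 3) : TriFree G {x, y}ᶜ (G.neighborSet y) := by
  classical
  have key : ∀ a b c, a ≠ x → b ≠ x → c ≠ x → G.Adj a b → G.Adj b c → G.Adj a c → False := by
    intro a b c ha hb hc hab hbc hac
    refine h {⟨a, ha⟩, ⟨b, hb⟩, ⟨c, hc⟩} (SimpleGraph.is3Clique_triple_iff.2 ⟨?_, ?_, ?_⟩)
    exacts [hab, hac, hbc]
  have hx : ∀ a ∈ ({x, y}ᶜ : Set V), a ≠ x := fun a ha h => ha (.inl h)
  exact ⟨fun a ha b hb c hc => key a b c (hx a ha) (hx b hb) (hx c hc),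
    fun a ha b hb haY hbY hab => key y a b hxy.symm (hx a ha) (hx b hb) haY hab hbY⟩

/-- The two extra edges are the root edges, which also gives the required minimum length two. -/
theorem exists_path_of_mem_lengths {x y : V} (hxy : x ≠ y) {n : ℕ}
    (h : n ∈ lengths G {x, y}ᶜ (G.neighborSet x) (G.neighborSet y)) :
    ∃ P : G.Path x y, P.1.length = n + 2 := by
  obtain ⟨a, ha, b, hb, hp⟩ := h
  have h1 : PathIn G {x}ᶜ a y (n + 1) := hp.snoc (G.adj_symm hb) (by simp)
    (fun v hv h => hv (.inl h)) hxy.symm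
  obtain ⟨p, hp, hl, -⟩ := (h1.cons₁ (subset_univ _) (mem_univ x) (by simp) ha).exists_walk
  exact ⟨⟨p, hp⟩, hl⟩

theorem exists_areGood {x y : V} {L : Set ℕ} (hL : ∀ n ∈ L, ∃ P : G.Path x y, P.1.length = n + 2)
    (h : Good L) : ∃ P₁ P₂ P₃ : G.Path x y, AreGood P₁ P₂ P₃ := by
  obtain ⟨m, ⟨h1, h2, h3⟩ | ⟨h1, h2, h3⟩ | ⟨h1, h2, h3⟩⟩ := h <;>
    obtain ⟨P₁, hP₁⟩ := hL _ h1 <;> obtain ⟨P₂, hP₂⟩ := hL _ h2 <;>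
    obtain ⟨P₃, hP₃⟩ := hL _ h3 <;> refine ⟨P₃, P₂, P₁, by omega, by omega, by omega, ?_⟩
  · exact .inl ⟨by omega, by omega, by omega⟩
  · right
    rw [hP₁, hP₂, hP₃, pair_comm, show m + 1 + 2 - (m + 2) = 1 by omega,
      show m + 3 + 2 - (m + 1 + 2) = 2 by omega]
  · right
    rw [hP₁, hP₂, hP₃, show m + 2 + 2 - (m + 2) = 2 by omega,
      show m + 3 + 2 - (m + 2 + 2) = 1 by omega]

end RootedPaths

theorem lemma5 {V : Type*} [Fintype V] (G : SimpleGraph V) [DecidableRel G.Adj] (x y : V)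
    (hconn : RootedPaths.IsTwoConnectedRooted G x y)
    (hdeg : RootedPaths.HasRootedMinDegreeAtLeast G x y 4)
    (htri : (G.induce ({x}ᶜ : Set V)).CliqueFree 3) :
    ∃ P₁ P₂ P₃ : G.Path x y, RootedPaths.AreGood P₁ P₂ P₃ := by
  -- The root `x` is named as the exception; it is not an inner vertex, so no inner vertex is
  -- exempt.
  have hrooted : RootedPaths.Rooted G 4 {x, y}ᶜ (G.neighborSet x) (G.neighborSet y) x := by
    refine ⟨hconn.linked, fun v hv _ => ?_, ?_⟩
    · exact (hdeg v (fun h => hv (.inl h)) fun h => hv (.inr h)).trans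
        (RootedPaths.degree_le_rdeg x y v)
    · by_contra! hcon
      have h1 : (Set.univ : Set V) ⊆ {x, y} := fun v _ => by
        by_contra hv
        exact hv (.inl (hcon v hv))
      have h2 := (Set.ncard_le_ncard h1).trans (RootedPaths.ncard_pair_le x y)
      have h3 := hconn.2.1
      rw [Set.ncard_univ] at h2
      omega
  exact RootedPaths.exists_areGood (fun n => RootedPaths.exists_path_of_mem_lengths hconn.1)
    (hrooted.good (RootedPaths.triFree_of_cliqueFree hconn.1 htri))
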